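/- Let $F/K$ be a finite Galois extension of number fields with Galois group $G$, let $d=[K:\mathbb{Q}]$, and let $S$ be a finite $G$-stable set of places of $F$ containing all Archimedean places. Notation. $G_0(\mathbb{Z}[G])$ is the Grothendieck group of finitely generated left $\mathbb{Z}[G]$-modules: it is generated by the classes $[M]$, with a relation $[M]=[L]+[N]$ for each short exact sequence $0\to L\to M\to N\to 0$. The automorphism $\sigma$ of $G_0(\mathbb{Z}[G])$ is the unique one with $\sigma[M]=[\mathrm{Hom}_{\mathbb{Z}}(M,\mathbb{Z})]$ for every finitely generated $\mathbb{Z}[G]$-module $M$ that is free over $\mathbb{Z}$, where $g\in G$ acts on $\mathrm{Hom}_{\mathbb{Z}}(M,\mathbb{Z})$ by $(g\varphi)(m)=\varphi(g^{-1}m)$. Let $\mathrm{Id}_F$ be the (discrete) group of fractional ideals of $\mathcal{O}_F$, let $F_{\mathbb{R}}=F\otimes_{\mathbb{Q}}\mathbb{R}$, and let $\mathrm{Id}_F\times_{\mathbb{R}_{>0}}F_{\mathbb{R}}^{\times}$ be the fibre product with respect to the ideal norm $\mathrm{Id}_F\to\mathbb{R}_{>0}$ and the absolute value of the $\mathbb{R}$-algebra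 norm $F_{\mathbb{R}}^{\times}\to\mathbb{R}_{>0}$. The oriented Arakelov class group $\widetilde{\mathrm{Pic}}{}^0_F$ is the cokernel, with its quotient topology, of the map $F^{\times}\to \mathrm{Id}_F\times_{\mathbb{R}_{>0}}F_{\mathbb{R}}^{\times}$, $\alpha\mapsto(\alpha\mathcal{O}_F,\alpha)$. Let $\widetilde{\mathrm{Ar}}_F=\mathrm{Hom}_{\mathrm{cts}}(\widetilde{\mathrm{Pic}}{}^0_F,\mathbb{R}/\mathbb{Z})$ be its Pontryagin dual, with $(g\chi)(a)=\chi(g^{-1}a)$ for $g\in G$. Finally, $\mathcal{O}_{F,S}^{\times}$ and $\mathrm{Cl}_{F,S}$ are the unit group and the class group of the ring $\mathcal{O}_{F,S}$ of $S$-integers of $F$, and $\mathbb{Z}[S]$ is the permutation module on $S$. Then $\widetilde{\mathrm{Ar}}_F$, $\mathcal{O}_{F,S}^{\times}$ and $\mathrm{Cl}_{F,S}$ are finitely generated $\mathbb{Z}[G]$-modules, and in $G_0(\mathbb{Z}[G])$ one has \[ [\widetilde{\mathrm{Ar}}_F] = d\cdot[\mathbb{Z}[G]] - [\mathbb{Z}[S]]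 + \sigma[\mathcal{O}_{F,S}^{\times}] - \sigma[\mathrm{Cl}_{F,S}]. \] -/

import Mathlib

open scoped nonZeroDivisors NumberField TensorProduct
universe u v

/-! ### The Grothendieck group of finitely generated modules -/

/-- The relations `[M] = [L] + [N]`, one for each short exact sequence `0 → L → M → N → 0`
of finitely generated `T`-modules. -/
def G0.relations (T : Type u) [Ring T] : Set (FreeAbelianGroup (FGModuleCat.{u} T)) :=
  {x | ∃ (L M N : FGModuleCat.{u} T) (f : L →ₗ[T] M) (g : M →ₗ[T] N),
    Function.Injective f ∧ Function.Exact f g ∧ Function.Surjective g ∧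
    x = FreeAbelianGroup.of M - (FreeAbelianGroup.of L + FreeAbelianGroup.of N)}

/-- The Grothendieck group `G₀(T)` of the category of finitely generated left `T`-modules.
(Isomorphic modules have the same class because of the exact sequences `0 → 0 → M → N → 0`.) -/
def G0 (T : Type u) [Ring T] : Type (u + 1) :=
  FreeAbelianGroup (FGModuleCat.{u} T) ⧸ AddSubgroup.closure (G0.relations T)

namespace G0

section General

variable {T : Type u} [Ring T]

noncomputable instance : AddCommGroup (G0 T) :=
  inferInstanceAs (AddCommGroup
    (FreeAbelianGroup (FGModuleCat.{u} T) ⧸ AddSubgroup.closure (G0.relations T)))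

variable (T) in
/-- The class `[M]` of a finitely generated module in `G₀(T)`. -/
noncomputable def mk (M : Type u) [AddCommGroup M] [Module T M] [Module.Finite T M] : G0 T :=
  QuotientAddGroup.mk (FreeAbelianGroup.of (FGModuleCat.of T M))

theorem mk_eq_add {L M N : Type u} [AddCommGroup L] [Module T L] [Module.Finite T L]
    [AddCommGroup M] [Module T M] [Module.Finite T M]
    [AddCommGroup N] [Module T N] [Module.Finite T N]
    (f : L →ₗ[T] M) (g : M →ₗ[T] N) (hf : Function.Injective f) (hfg : Function.Exact f g)
    (hg : Function.Surjective g) : mk T M = mk T L + mk T N := by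
  refine QuotientAddGroup.eq_iff_sub_mem.2 (AddSubgroup.subset_closure ?_)
  exact ⟨FGModuleCat.of T L, FGModuleCat.of T M, FGModuleCat.of T N, f, g, hf, hfg, hg, rfl⟩

/-- A function on finitely generated modules that is additive on short exact sequences
factors through `G₀(T)`. -/
noncomputable def lift {A : Type*} [AddCommGroup A] (φ : FGModuleCat.{u} T → A)
    (h : ∀ (L M N : FGModuleCat.{u} T) (f : L →ₗ[T] M) (g : M →ₗ[T] N),
      Function.Injective f → Function.Exact f g → Function.Surjective g → φ M = φ L + φ N) :
    G0 T →+ A :=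
  QuotientAddGroup.lift _ (FreeAbelianGroup.lift φ) <| by
    rw [AddSubgroup.closure_le]
    rintro x ⟨L, M, N, f, g, hf, hfg, hg, rfl⟩
    simp [h L M N f g hf hfg hg]

theorem lift_mk {A : Type*} [AddCommGroup A] (φ : FGModuleCat.{u} T → A) (h) (M : Type u)
    [AddCommGroup M] [Module T M] [Module.Finite T M] :
    lift φ h (mk T M) = φ (FGModuleCat.of T M) :=
  FreeAbelianGroup.lift_apply_of _ _

theorem hom_ext {A : Type*} [AddCommGroup A] {φ ψ : G0 T →+ A}
    (h : ∀ (M : Type u) [AddCommGroup M] [Module T M] [Module.Finite T M],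
      φ (mk T M) = ψ (mk T M)) : φ = ψ := by
  refine QuotientAddGroup.addMonoidHom_ext _ (FreeAbelianGroup.lift_ext _ _ fun M => ?_)
  exact h M

theorem mk_congr {M N : Type u} [AddCommGroup M] [Module T M] [Module.Finite T M]
    [AddCommGroup N] [Module T N] [Module.Finite T N] (e : M ≃ₗ[T] N) : mk T M = mk T N := by
  have h0 := mk_eq_add (T := T) (0 : PUnit.{u + 1} →ₗ[T] PUnit.{u + 1})
    (0 : PUnit.{u + 1} →ₗ[T] PUnit.{u + 1}) (Function.injective_of_subsingleton _)
    (fun x => by simp [Subsingleton.elim x 0]) (fun x => ⟨0, Subsingleton.elim _ _⟩)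
  have h1 := mk_eq_add (T := T) (0 : PUnit.{u + 1} →ₗ[T] M) e.toLinearMap
    (Function.injective_of_subsingleton _) (fun x => by simp [eq_comm (a := (0 : M))]) e.surjective
  rw [h1]
  simpa using h0

end General

/-! ### Duality -/

section Duality

variable (G : Type u) [Group G]

/-- The dual `M^* = Hom_ℤ(M, ℤ)` of a `ℤ[G]`-module `M`, with `G` acting by
`(g φ)(m) = φ (g⁻¹ m)`. -/
abbrev Dual (M : Type u) [AddCommGroup M] [Module (MonoidAlgebra ℤ G) M] : Type u :=
  (Representation.ofModule' (k := ℤ) (G := G) M).dual.asModule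

variable {G}

theorem single_smul_dual_apply {M : Type u} [AddCommGroup M] [Module (MonoidAlgebra ℤ G) M]
    (g : G) (φ : Dual G M) (m : M) :
    (Representation.asModuleEquiv _ (MonoidAlgebra.single g (1 : ℤ) • φ) : Module.Dual ℤ M) m =
      (Representation.asModuleEquiv _ φ : Module.Dual ℤ M)
        (MonoidAlgebra.single g⁻¹ (1 : ℤ) • m) := by
  rw [Representation.asModuleEquiv_map_smul]
  simp [Representation.ofModule']
  rfl

/-- An additive map that commutes with the action of the group elements is `ℤ[G]`-linear. -/
def linearOfComm {V W : Type*} [AddCommGroup V] [Module (MonoidAlgebra ℤ G) V]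
    [AddCommGroup W] [Module (MonoidAlgebra ℤ G) W] (f : V →+ W)
    (h : ∀ (g : G) (v : V), f (MonoidAlgebra.single g (1 : ℤ) • v) =
      MonoidAlgebra.single g (1 : ℤ) • f v) : V →ₗ[MonoidAlgebra ℤ G] W where
  toFun := f
  map_add' := f.map_add
  map_smul' r v := by
    induction r using MonoidAlgebra.induction_on with
    | of g => simpa using h g v
    | add x y hx hy => simp only [RingHom.id_apply] at hx hy ⊢; rw [add_smul, map_add, hx, hy, add_smul]
    | smul n x hx => simp only [RingHom.id_apply] at hx ⊢; rw [smul_assoc, map_zsmul, hx, smul_assoc]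

section

variable {L M N : Type u} [AddCommGroup L] [Module (MonoidAlgebra ℤ G) L]
  [AddCommGroup M] [Module (MonoidAlgebra ℤ G) M] [AddCommGroup N] [Module (MonoidAlgebra ℤ G) N]

/-- The transpose `N^* → M^*` of a `ℤ[G]`-linear map `M → N`. -/
noncomputable def dualMap (f : M →ₗ[MonoidAlgebra ℤ G] N) : Dual G N →ₗ[MonoidAlgebra ℤ G] Dual G M :=
  linearOfComm (V := Dual G N) (W := Dual G M)
    { toFun := fun φ => (show N →ₗ[ℤ] ℤ from φ) ∘ₗ f.toAddMonoidHom.toIntLinearMap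
      map_zero' := rfl
      map_add' := fun _ _ => rfl } <| by
    intro g φ
    refine LinearMap.ext fun m => ?_
    have h1 := single_smul_dual_apply g φ (f m)
    have h2 := single_smul_dual_apply (M := M) g
      ((show N →ₗ[ℤ] ℤ from φ) ∘ₗ f.toAddMonoidHom.toIntLinearMap : M →ₗ[ℤ] ℤ) m
    refine Eq.trans h1 (Eq.trans ?_ h2.symm)
    exact congrArg (show N →ₗ[ℤ] ℤ from φ) (f.map_smul _ _).symm

theorem dualMap_apply (f : M →ₗ[MonoidAlgebra ℤ G] N) (φ : Dual G N) (m : M) :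
    (show M →ₗ[ℤ] ℤ from dualMap f φ) m = (show N →ₗ[ℤ] ℤ from φ) (f m) := rfl

theorem dualMap_injective (g : M →ₗ[MonoidAlgebra ℤ G] N) (hg : Function.Surjective g) :
    Function.Injective (dualMap g) := by
  intro φ ψ h
  refine LinearMap.ext (f := (show N →ₗ[ℤ] ℤ from φ)) (g := (show N →ₗ[ℤ] ℤ from ψ)) fun n => ?_
  obtain ⟨m, rfl⟩ := hg n
  exact LinearMap.congr_fun (f := (show M →ₗ[ℤ] ℤ from dualMap g φ)) h m

theorem dualMap_exact (f : L →ₗ[MonoidAlgebra ℤ G] M) (g : M →ₗ[MonoidAlgebra ℤ G] N)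
    (hfg : Function.Exact f g) (hg : Function.Surjective g) :
    Function.Exact (dualMap g) (dualMap f) := by
  intro φ
  constructor
  · intro h
    have h' : ∀ l, (show M →ₗ[ℤ] ℤ from φ) (f l) = 0 := fun l =>
      LinearMap.congr_fun (f := (show L →ₗ[ℤ] ℤ from dualMap f φ)) h l
    have hk : ∀ m, g m = 0 → (show M →ₗ[ℤ] ℤ from φ) m = 0 := by
      intro m hm
      obtain ⟨l, rfl⟩ := (hfg m).1 hm
      exact h' l
    choose s hs using hg
    let ψ : N →+ ℤ := AddMonoidHom.mk' (fun n => (show M →ₗ[ℤ] ℤ from φ) (s n)) <| by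
      intro a b
      rw [← map_add, ← sub_eq_zero, ← map_sub]
      exact hk _ (by simp [hs])
    refine ⟨ψ.toIntLinearMap, LinearMap.ext fun m => ?_⟩
    change (show M →ₗ[ℤ] ℤ from φ) (s (g m)) = (show M →ₗ[ℤ] ℤ from φ) m
    rw [← sub_eq_zero, ← map_sub]
    exact hk _ (by simp [hs])
  · rintro ⟨ψ, rfl⟩
    refine LinearMap.ext fun l => ?_
    change (show N →ₗ[ℤ] ℤ from ψ) (g (f l)) = 0
    rw [hfg.apply_apply_eq_zero, map_zero]

theorem dualMap_surjective [Module.Free ℤ N] (f : L →ₗ[MonoidAlgebra ℤ G] M)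
    (g : M →ₗ[MonoidAlgebra ℤ G] N) (hf : Function.Injective f) (hfg : Function.Exact f g)
    (hg : Function.Surjective g) : Function.Surjective (dualMap f) := by
  intro φ
  obtain ⟨s, hs⟩ := Module.projective_lifting_property
    g.toAddMonoidHom.toIntLinearMap (LinearMap.id : N →ₗ[ℤ] N) hg
  have hs' : ∀ n, g (s n) = n := fun n => LinearMap.congr_fun hs n
  have hr : ∀ m, ∃ l, f l = m - s (g m) := fun m => (hfg _).1 (by simp [hs'])
  choose r hr using hr
  let ψ : M →+ ℤ := AddMonoidHom.mk' (fun m => (show L →ₗ[ℤ] ℤ from φ) (r m)) <| by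
    intro a b
    rw [← map_add]
    congr 1
    apply hf
    rw [map_add, hr, hr, hr, map_add, map_add]
    abel
  refine ⟨ψ.toIntLinearMap, LinearMap.ext fun l => ?_⟩
  change (show L →ₗ[ℤ] ℤ from φ) (r (f l)) = (show L →ₗ[ℤ] ℤ from φ) l
  congr 1
  apply hf
  rw [hr, hfg.apply_apply_eq_zero, map_zero, sub_zero]

end

/-- The rank of a chosen presentation `ℤ[G]ⁿ → M` of a finitely generated `ℤ[G]`-module. -/
noncomputable def presRank (M : FGModuleCat.{u} (MonoidAlgebra ℤ G)) : ℕ :=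
  (Module.Finite.exists_fin' (MonoidAlgebra ℤ G) M).choose

/-- A chosen presentation `ℤ[G]ⁿ → M` of a finitely generated `ℤ[G]`-module. -/
noncomputable def pres (M : FGModuleCat.{u} (MonoidAlgebra ℤ G)) :
    (Fin (presRank M) → MonoidAlgebra ℤ G) →ₗ[MonoidAlgebra ℤ G] M :=
  (Module.Finite.exists_fin' (MonoidAlgebra ℤ G) M).choose_spec.choose

theorem pres_surjective (M : FGModuleCat.{u} (MonoidAlgebra ℤ G)) :
    Function.Surjective (pres M) :=
  (Module.Finite.exists_fin' (MonoidAlgebra ℤ G) M).choose_spec.choose_spec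

variable [Finite G]

theorem finite_int (M : Type u) [AddCommGroup M] [Module (MonoidAlgebra ℤ G) M]
    [Module.Finite (MonoidAlgebra ℤ G) M] : Module.Finite ℤ M :=
  Module.Finite.trans (MonoidAlgebra ℤ G) M

instance (M : Type u) [AddCommGroup M] [Module (MonoidAlgebra ℤ G) M]
    [Module.Finite (MonoidAlgebra ℤ G) M] [Module.Free ℤ M] :
    Module.Finite (MonoidAlgebra ℤ G) (Dual G M) :=
  have := finite_int (G := G) M
  have : Module.Finite ℤ (Dual G M) := inferInstanceAs (Module.Finite ℤ (Module.Dual ℤ M))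
  Module.Finite.of_restrictScalars_finite ℤ (MonoidAlgebra ℤ G) (Dual G M)

instance : IsNoetherianRing (MonoidAlgebra ℤ G) :=
  have : IsNoetherian ℤ (MonoidAlgebra ℤ G) := inferInstance
  isNoetherian_of_tower ℤ this


section Presentations

variable {M P Q : Type u} [AddCommGroup M] [Module (MonoidAlgebra ℤ G) M]
  [AddCommGroup P] [Module (MonoidAlgebra ℤ G) P] [Module.Finite (MonoidAlgebra ℤ G) P]
  [Module.Free ℤ P]
  [AddCommGroup Q] [Module (MonoidAlgebra ℤ G) Q] [Module.Finite (MonoidAlgebra ℤ G) Q]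
  [Module.Free ℤ Q]

/-- Submodules of `ℤ[G]`-lattices are `ℤ[G]`-lattices. -/
instance (U : Submodule (MonoidAlgebra ℤ G) P) : Module.Free ℤ U := by
  have := finite_int (G := G) P
  have := finite_int (G := G) U
  have : Module.IsTorsionFree ℤ U :=
    Function.Injective.moduleIsTorsionFree (U.subtype : U → P) U.injective_subtype
      (fun n x => map_zsmul U.subtype n x)
  infer_instance

theorem mk_dual_eq_add {L M N : Type u}
    [AddCommGroup L] [Module (MonoidAlgebra ℤ G) L] [Module.Finite (MonoidAlgebra ℤ G) L]
    [Module.Free ℤ L]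
    [AddCommGroup M] [Module (MonoidAlgebra ℤ G) M] [Module.Finite (MonoidAlgebra ℤ G) M]
    [Module.Free ℤ M]
    [AddCommGroup N] [Module (MonoidAlgebra ℤ G) N] [Module.Finite (MonoidAlgebra ℤ G) N]
    [Module.Free ℤ N]
    (f : L →ₗ[MonoidAlgebra ℤ G] M) (g : M →ₗ[MonoidAlgebra ℤ G] N) (hf : Function.Injective f)
    (hfg : Function.Exact f g) (hg : Function.Surjective g) :
    mk (MonoidAlgebra ℤ G) (Dual G M) =
      mk (MonoidAlgebra ℤ G) (Dual G L) + mk (MonoidAlgebra ℤ G) (Dual G N) := by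
  rw [add_comm]
  exact mk_eq_add (dualMap g) (dualMap f) (dualMap_injective g hg) (dualMap_exact f g hfg hg)
    (dualMap_surjective f g hf hfg hg)

theorem mk_dual_of_subsingleton (L : Type u) [AddCommGroup L] [Module (MonoidAlgebra ℤ G) L]
    [Module.Finite (MonoidAlgebra ℤ G) L] [Module.Free ℤ L] [Subsingleton L] :
    mk (MonoidAlgebra ℤ G) (Dual G L) = 0 := by
  have h := mk_dual_eq_add (0 : L →ₗ[MonoidAlgebra ℤ G] L) (0 : L →ₗ[MonoidAlgebra ℤ G] L)
    (Function.injective_of_subsingleton _) (fun x => by simp [Subsingleton.elim x 0])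
    (fun x => ⟨0, Subsingleton.elim _ _⟩)
  simpa using h

theorem mk_dual_congr {L M : Type u}
    [AddCommGroup L] [Module (MonoidAlgebra ℤ G) L] [Module.Finite (MonoidAlgebra ℤ G) L]
    [Module.Free ℤ L]
    [AddCommGroup M] [Module (MonoidAlgebra ℤ G) M] [Module.Finite (MonoidAlgebra ℤ G) M]
    [Module.Free ℤ M] (e : L →ₗ[MonoidAlgebra ℤ G] M) (hi : Function.Injective e)
    (hs : Function.Surjective e) :
    mk (MonoidAlgebra ℤ G) (Dual G L) = mk (MonoidAlgebra ℤ G) (Dual G M) := by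
  have h := mk_dual_eq_add e (0 : M →ₗ[MonoidAlgebra ℤ G] PUnit.{u + 1}) hi
    (fun y => ⟨fun _ => hs y, fun _ => rfl⟩) (fun y => ⟨0, Subsingleton.elim _ _⟩)
  rw [h, mk_dual_of_subsingleton PUnit.{u + 1}, add_zero]

/-- `[P^*] - [(ker π)^*]`, for a map `π` from a `ℤ[G]`-lattice `P`. -/
noncomputable def dualOfPresentation (π : P →ₗ[MonoidAlgebra ℤ G] M) : G0 (MonoidAlgebra ℤ G) :=
  mk (MonoidAlgebra ℤ G) (Dual G P) - mk (MonoidAlgebra ℤ G) (Dual G (LinearMap.ker π))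

theorem dualOfPresentation_eq_aux (π : P →ₗ[MonoidAlgebra ℤ G] M) (ρ : Q →ₗ[MonoidAlgebra ℤ G] M)
    (hρ : Function.Surjective ρ) {X : Type u} [AddCommGroup X] [Module (MonoidAlgebra ℤ G) X]
    [Module.Finite (MonoidAlgebra ℤ G) X] [Module.Free ℤ X]
    (p : X →ₗ[MonoidAlgebra ℤ G] P) (q : X →ₗ[MonoidAlgebra ℤ G] Q)
    (hinj : ∀ x, p x = 0 → q x = 0 → x = 0) (hpq : ∀ x, π (p x) = ρ (q x))
    (hsurj : ∀ a b, π a = ρ b → ∃ x, p x = a ∧ q x = b) :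
    mk (MonoidAlgebra ℤ G) (Dual G X) =
      mk (MonoidAlgebra ℤ G) (Dual G (LinearMap.ker ρ)) + mk (MonoidAlgebra ℤ G) (Dual G P) := by
  have h1 : mk (MonoidAlgebra ℤ G) (Dual G X) =
      mk (MonoidAlgebra ℤ G) (Dual G (LinearMap.ker p)) + mk (MonoidAlgebra ℤ G) (Dual G P) := by
    refine mk_dual_eq_add (LinearMap.ker p).subtype p (Submodule.injective_subtype _)
      (LinearMap.exact_subtype_ker_map p) fun a => ?_
    obtain ⟨b, hb⟩ := hρ (π a)
    obtain ⟨x, hx, -⟩ := hsurj a b hb.symm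
    exact ⟨x, hx⟩
  let e : LinearMap.ker p →ₗ[MonoidAlgebra ℤ G] LinearMap.ker ρ :=
    LinearMap.codRestrict _ (q ∘ₗ (LinearMap.ker p).subtype) fun c => by
      have := hpq c
      rw [LinearMap.mem_ker.1 c.2, map_zero] at this
      exact this.symm
  have h2 : mk (MonoidAlgebra ℤ G) (Dual G (LinearMap.ker p)) =
      mk (MonoidAlgebra ℤ G) (Dual G (LinearMap.ker ρ)) := by
    refine mk_dual_congr e (fun x y hxy => ?_) (fun y => ?_)
    · rw [← sub_eq_zero]
      refine Subtype.ext (hinj _ (x - y).2 ?_)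
      have : q x = q y := congrArg Subtype.val hxy
      rw [Submodule.coe_sub, map_sub, this, sub_self]
    · obtain ⟨x, hx, hy⟩ := hsurj 0 y (by rw [map_zero, LinearMap.mem_ker.1 y.2])
      exact ⟨⟨x, hx⟩, Subtype.ext hy⟩
  rw [h1, h2]

theorem dualOfPresentation_eq (π : P →ₗ[MonoidAlgebra ℤ G] M) (ρ : Q →ₗ[MonoidAlgebra ℤ G] M)
    (hπ : Function.Surjective π) (hρ : Function.Surjective ρ) :
    dualOfPresentation π = dualOfPresentation ρ := by
  let X := LinearMap.eqLocus (π ∘ₗ LinearMap.fst _ P Q) (ρ ∘ₗ LinearMap.snd _ P Q)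
  have hX : ∀ x : X, π (x : P × Q).1 = ρ (x : P × Q).2 := fun x => x.2
  have h1 := dualOfPresentation_eq_aux π ρ hρ
    (LinearMap.fst _ P Q ∘ₗ X.subtype) (LinearMap.snd _ P Q ∘ₗ X.subtype)
    (fun x h h' => Subtype.ext (Prod.ext h h')) hX (fun a b h => ⟨⟨(a, b), h⟩, rfl, rfl⟩)
  have h2 := dualOfPresentation_eq_aux ρ π hπ
    (LinearMap.snd _ P Q ∘ₗ X.subtype) (LinearMap.fst _ P Q ∘ₗ X.subtype)
    (fun x h h' => Subtype.ext (Prod.ext h' h)) (fun x => (hX x).symm)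
    (fun a b h => ⟨⟨(b, a), h.symm⟩, rfl, rfl⟩)
  rw [h1] at h2
  rw [dualOfPresentation, dualOfPresentation, sub_eq_sub_iff_add_eq_add, add_comm, h2, add_comm]

theorem dualOfPresentation_add {L M N : Type u} [AddCommGroup L] [Module (MonoidAlgebra ℤ G) L]
    [AddCommGroup M] [Module (MonoidAlgebra ℤ G) M] [AddCommGroup N] [Module (MonoidAlgebra ℤ G) N]
    (f : L →ₗ[MonoidAlgebra ℤ G] M) (g : M →ₗ[MonoidAlgebra ℤ G] N) (hf : Function.Injective f)
    (hfg : Function.Exact f g) (π : P →ₗ[MonoidAlgebra ℤ G] M) (hπ : Function.Surjective π) :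
    ∃ ρ : LinearMap.ker (g ∘ₗ π) →ₗ[MonoidAlgebra ℤ G] L, Function.Surjective ρ ∧
      dualOfPresentation π = dualOfPresentation ρ + dualOfPresentation (g ∘ₗ π) := by
  let e := LinearEquiv.ofInjective f hf
  let r : LinearMap.ker (g ∘ₗ π) →ₗ[MonoidAlgebra ℤ G] LinearMap.range f :=
    LinearMap.codRestrict _ (π ∘ₗ (LinearMap.ker (g ∘ₗ π)).subtype) fun c => (hfg _).1 c.2
  let ρ : LinearMap.ker (g ∘ₗ π) →ₗ[MonoidAlgebra ℤ G] L := e.symm.toLinearMap ∘ₗ r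
  have hρ : ∀ x, f (ρ x) = π x := fun x => by
    have : (e (e.symm (r x)) : M) = r x := by rw [e.apply_symm_apply]
    exact this
  refine ⟨ρ, fun l => ?_, ?_⟩
  · obtain ⟨p, hp⟩ := hπ (f l)
    refine ⟨⟨p, ?_⟩, hf ?_⟩
    · rw [LinearMap.mem_ker, LinearMap.comp_apply, hp, hfg.apply_apply_eq_zero]
    · rw [hρ, hp]
  · have hle : LinearMap.ker π ≤ LinearMap.ker (g ∘ₗ π) := LinearMap.ker_le_ker_comp _ _
    have key : mk (MonoidAlgebra ℤ G) (Dual G (LinearMap.ker ρ)) =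
        mk (MonoidAlgebra ℤ G) (Dual G (LinearMap.ker π)) := by
      let i : LinearMap.ker ρ →ₗ[MonoidAlgebra ℤ G] LinearMap.ker π :=
        LinearMap.codRestrict _ ((LinearMap.ker (g ∘ₗ π)).subtype ∘ₗ (LinearMap.ker ρ).subtype)
          fun c => by
            have := hρ c
            rw [LinearMap.mem_ker.1 c.2, map_zero] at this
            exact this.symm
      refine mk_dual_congr i
        (fun a b h => Subtype.ext (Subtype.ext
          (congrArg (fun z : LinearMap.ker π => (z : P)) h)))
        (fun y => ⟨⟨⟨y, hle y.2⟩, hf ?_⟩, rfl⟩)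
      rw [hρ, map_zero]
      exact y.2
    rw [dualOfPresentation, dualOfPresentation, dualOfPresentation, key]
    abel

end Presentations


variable (G) in
/-- The endomorphism of `G₀(ℤ[G])` with `[M] ↦ [M^*]` for every `ℤ[G]`-lattice `M`. On an
arbitrary finitely generated `M` it is computed as `[P^*] - [Q^*]` from a presentation
`0 → Q → P → M → 0` by lattices; this does not depend on the presentation. -/
noncomputable def dualityHom : G0 (MonoidAlgebra ℤ G) →+ G0 (MonoidAlgebra ℤ G) :=
  lift (fun M => dualOfPresentation (pres M)) <| by
    intro L M N f g hf hfg hg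
    obtain ⟨ρ, hρ, h⟩ := dualOfPresentation_add f g hf hfg (pres M) (pres_surjective M)
    rw [h, dualOfPresentation_eq ρ (pres L) hρ (pres_surjective L),
      dualOfPresentation_eq (g ∘ₗ pres M) (pres N) (hg.comp (pres_surjective M))
        (pres_surjective N)]

/-- `σ[M] = [M^*]` for every `ℤ[G]`-lattice `M`. -/
theorem dualityHom_mk (M : Type u) [AddCommGroup M] [Module (MonoidAlgebra ℤ G) M]
    [Module.Finite (MonoidAlgebra ℤ G) M] [Module.Free ℤ M] :
    dualityHom G (mk (MonoidAlgebra ℤ G) M) = mk (MonoidAlgebra ℤ G) (Dual G M) := by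
  have : Subsingleton (LinearMap.ker (LinearMap.id : M →ₗ[MonoidAlgebra ℤ G] M)) :=
    ⟨fun a b => Subtype.ext ((LinearMap.mem_ker.1 a.2).trans (LinearMap.mem_ker.1 b.2).symm)⟩
  rw [dualityHom, lift_mk,
    dualOfPresentation_eq _ (LinearMap.id : M →ₗ[MonoidAlgebra ℤ G] M) (pres_surjective _)
      Function.surjective_id, dualOfPresentation,
    mk_dual_of_subsingleton (LinearMap.ker (LinearMap.id : M →ₗ[MonoidAlgebra ℤ G] M)), sub_zero]

/-- Homomorphisms on `G₀(ℤ[G])` are determined by their values on lattices. -/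
theorem hom_ext_lattice {A : Type*} [AddCommGroup A] {φ ψ : G0 (MonoidAlgebra ℤ G) →+ A}
    (h : ∀ (M : Type u) [AddCommGroup M] [Module (MonoidAlgebra ℤ G) M]
      [Module.Finite (MonoidAlgebra ℤ G) M] [Module.Free ℤ M],
      φ (mk (MonoidAlgebra ℤ G) M) = ψ (mk (MonoidAlgebra ℤ G) M)) : φ = ψ := by
  refine hom_ext fun M _ _ _ => ?_
  obtain ⟨n, π, hπ⟩ := Module.Finite.exists_fin' (MonoidAlgebra ℤ G) M
  have := mk_eq_add (LinearMap.ker π).subtype π (Submodule.injective_subtype _)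
    (LinearMap.exact_subtype_ker_map π) hπ
  have h' := eq_sub_of_add_eq' this.symm
  rw [h', map_sub, map_sub, h, h]

instance (M : Type u) [AddCommGroup M] [Module (MonoidAlgebra ℤ G) M]
    [Module.Finite (MonoidAlgebra ℤ G) M] [Module.Free ℤ M] : Module.Free ℤ (Dual G M) :=
  have := finite_int (G := G) M
  inferInstanceAs (Module.Free ℤ (Module.Dual ℤ M))

theorem mk_dual_dual (M : Type u) [AddCommGroup M] [Module (MonoidAlgebra ℤ G) M]
    [Module.Finite (MonoidAlgebra ℤ G) M] [Module.Free ℤ M] :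
    mk (MonoidAlgebra ℤ G) (Dual G (Dual G M)) = mk (MonoidAlgebra ℤ G) M := by
  have := finite_int (G := G) M
  let e := Module.evalEquiv ℤ M
  let f : M →ₗ[MonoidAlgebra ℤ G] Dual G (Dual G M) :=
    linearOfComm (V := M) (W := Dual G (Dual G M))
      { toFun := fun m => e m
        map_zero' := e.map_zero
        map_add' := e.map_add } <| by
      intro g m
      refine LinearMap.ext fun φ => ?_
      have h1 := single_smul_dual_apply (M := Dual G M) g (e m) φ
      have h2 := single_smul_dual_apply g⁻¹ φ m
      rw [inv_inv] at h2
      exact h2.symm.trans h1.symm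
  exact (mk_congr (LinearEquiv.ofBijective f e.bijective)).symm

variable (G) in
/-- The duality automorphism `σ` of `G₀(ℤ[G])`, characterised by `σ[M] = [M^*]` for every
`ℤ[G]`-lattice `M` (see `dualityHom_mk` and `hom_ext_lattice`). -/
noncomputable def sigma : G0 (MonoidAlgebra ℤ G) ≃+ G0 (MonoidAlgebra ℤ G) :=
  have h : (dualityHom G).comp (dualityHom G) = AddMonoidHom.id _ := hom_ext_lattice fun M _ _ _ _ => by
    rw [AddMonoidHom.comp_apply, dualityHom_mk, dualityHom_mk, mk_dual_dual, AddMonoidHom.id_apply]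
  (dualityHom G).toAddEquiv (dualityHom G) h h

theorem sigma_mk (M : Type u) [AddCommGroup M] [Module (MonoidAlgebra ℤ G) M]
    [Module.Finite (MonoidAlgebra ℤ G) M] [Module.Free ℤ M] :
    sigma G (mk (MonoidAlgebra ℤ G) M) = mk (MonoidAlgebra ℤ G) (Dual G M) :=
  dualityHom_mk M

end Duality
end G0

namespace Arakelov

open IsDedekindDomain NumberField

variable {K : Type v} {F : Type u} [Field K] [Field F] [Algebra K F]

/-! ### Galois action on places -/

section Places

/-- The Galois group acts on the primes of `𝓞 F` by `g • 𝔭 = g(𝔭)`. -/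
noncomputable instance : MulAction Gal(F/K) (HeightOneSpectrum (𝓞 F)) where
  smul g v := HeightOneSpectrum.equivOfRingEquiv (MulSemiringAction.toRingEquiv _ (𝓞 F) g) v
  one_smul v := by
    ext x
    change (1 : Gal(F/K))⁻¹ • x ∈ v.asIdeal ↔ _
    rw [inv_one, one_smul]
  mul_smul g h v := by
    ext x
    change (g * h)⁻¹ • x ∈ v.asIdeal ↔ h⁻¹ • g⁻¹ • x ∈ v.asIdeal
    rw [mul_inv_rev, mul_smul]

theorem mem_smul_asIdeal (g : Gal(F/K)) (v : HeightOneSpectrum (𝓞 F)) (x : 𝓞 F) :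
    x ∈ (g • v).asIdeal ↔ g⁻¹ • x ∈ v.asIdeal := Iff.rfl

theorem smul_asIdeal (g : Gal(F/K)) (v : HeightOneSpectrum (𝓞 F)) :
    (g • v).asIdeal = v.asIdeal.map (MulSemiringAction.toRingEquiv _ (𝓞 F) g) := by
  ext x
  rw [mem_smul_asIdeal, Ideal.mem_map_of_equiv]
  constructor
  · exact fun h => ⟨_, h, smul_inv_smul g x⟩
  · rintro ⟨y, hy, rfl⟩
    simpa using hy

variable [NumberField F]

theorem intValuation_smul (g : Gal(F/K)) (v : HeightOneSpectrum (𝓞 F)) (x : 𝓞 F) :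
    (g • v).intValuation (g • x) = v.intValuation x := by
  have key : ∀ n : ℕ, g • x ∈ (g • v).asIdeal ^ n ↔ x ∈ v.asIdeal ^ n := by
    intro n
    rw [smul_asIdeal, ← Ideal.map_pow, Ideal.mem_map_of_equiv]
    constructor
    · rintro ⟨y, hy, h⟩
      rwa [← (MulSemiringAction.toRingEquiv _ (𝓞 F) g).injective h]
    · exact fun h => ⟨x, h, rfl⟩
  by_cases hx : x = 0
  · simp [hx]
  have hgx : g • x ≠ 0 := (smul_ne_zero_iff_ne g).2 hx
  have e1 : ∀ n : ℕ, (g • v).intValuation (g • x) ≤ WithZero.exp (-(n : ℤ)) ↔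
      v.intValuation x ≤ WithZero.exp (-(n : ℤ)) := fun n => by
    rw [HeightOneSpectrum.intValuation_le_pow_iff_mem,
      HeightOneSpectrum.intValuation_le_pow_iff_mem, key]
  apply le_antisymm
  · rw [v.intValuation_if_neg hx, e1, v.intValuation_if_neg hx]
  · rw [(g • v).intValuation_if_neg hgx, ← e1, (g • v).intValuation_if_neg hgx]

theorem valuation_smul (g : Gal(F/K)) (v : HeightOneSpectrum (𝓞 F)) (x : F) :
    (g • v).valuation F (g x) = v.valuation F x := by
  obtain ⟨a, b, hb, rfl⟩ := IsFractionRing.div_surjective (A := 𝓞 F) x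
  have h : ∀ a : 𝓞 F, g (algebraMap (𝓞 F) F a) = algebraMap (𝓞 F) F (g • a) := fun _ => rfl
  rw [map_div₀ g, map_div₀, map_div₀, h, h]
  simp only [HeightOneSpectrum.valuation_of_algebraMap, intValuation_smul]

variable (F) in
/-- The places of a number field: Archimedean places and maximal ideals of the ring of
integers. -/
abbrev Place : Type u := InfinitePlace F ⊕ HeightOneSpectrum (𝓞 F)

end Places

/-! ### `S`-integers, `S`-units and the `S`-class group -/

section SInteger

variable [NumberField F] (S : SubMulAction Gal(F/K) (Place F))

/-- The ring `𝓞_{F,S}` of `S`-integers. -/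
noncomputable abbrev SIntegers : Subalgebra (𝓞 F) F :=
  Set.integer {v : HeightOneSpectrum (𝓞 F) | (Sum.inr v : Place F) ∈ S} F

theorem smul_mem_SIntegers (g : Gal(F/K)) {x : F} (hx : x ∈ SIntegers S) : g x ∈ SIntegers S := by
  intro v hv
  have h := hx (g⁻¹ • v) fun h => hv (by
    have := S.smul_mem g h
    rwa [Sum.smul_inr, smul_inv_smul] at this)
  rwa [← valuation_smul g, smul_inv_smul] at h

noncomputable instance : MulSemiringAction Gal(F/K) (SIntegers S) where
  smul g x := ⟨g x, smul_mem_SIntegers S g x.2⟩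
  one_smul _ := rfl
  mul_smul _ _ _ := rfl
  smul_zero g := Subtype.ext (map_zero g)
  smul_add g x y := Subtype.ext (map_add g (x : F) y)
  smul_one g := Subtype.ext (map_one g)
  smul_mul g x y := Subtype.ext (map_mul g (x : F) y)

/-- The action on the group `𝓞_{F,S}^×` of `S`-units. -/
noncomputable instance : MulDistribMulAction Gal(F/K) (SIntegers S)ˣ :=
  Units.mulDistribMulActionRight

end SInteger

section ClassGroup

variable {R : Type*} [CommRing R] [IsDomain R] {G : Type*} [Group G] [MulSemiringAction G R]

theorem classGroup_mulEquiv_mk {R' : Type*} [CommRing R'] [IsDomain R'] (e : R ≃+* R')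
    (I : (FractionalIdeal R⁰ (FractionRing R))ˣ) :
    ClassGroup.mulEquiv e (ClassGroup.mk (FractionRing R) I) =
      ClassGroup.mk (FractionRing R') (Units.mapEquiv (FractionalIdeal.ringEquivOfRingEquiv
        (FractionRing R) (FractionRing R') e).toMulEquiv I) := by
  rw [← (ClassGroup.equiv (FractionRing R')).injective.eq_iff, ClassGroup.equiv_mk,
    ClassGroup.mulEquiv, MulEquiv.trans_apply, MulEquiv.trans_apply, MulEquiv.apply_symm_apply,
    ClassGroup.equiv_mk]
  rw [FractionalIdeal.canonicalEquiv_self, FractionalIdeal.canonicalEquiv_self]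
  rfl

/-- A group acting on a domain `R` by ring automorphisms acts on its class group,
by `g • [I] = [g(I)]`. -/
noncomputable abbrev classGroupAction : MulDistribMulAction G (ClassGroup R) where
  smul g := ClassGroup.mulEquiv (MulSemiringAction.toRingEquiv G R g)
  one_smul c := by
    refine ClassGroup.induction (FractionRing R) (fun I => ?_) c
    have h : MulSemiringAction.toRingEquiv G R 1 = RingEquiv.refl R := by ext; simp
    refine (classGroup_mulEquiv_mk _ I).trans (congrArg _ (Units.ext ?_))
    simp [h, FractionalIdeal.ringEquivOfRingEquiv_refl]
  mul_smul g h c := by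
    refine ClassGroup.induction (FractionRing R) (fun I => ?_) c
    have hh : MulSemiringAction.toRingEquiv G R (g * h) =
        (MulSemiringAction.toRingEquiv G R h).trans (MulSemiringAction.toRingEquiv G R g) := by
      ext; simp
    refine (classGroup_mulEquiv_mk _ I).trans (Eq.trans ?_
      ((congrArg (ClassGroup.mulEquiv (MulSemiringAction.toRingEquiv G R g))
        (classGroup_mulEquiv_mk _ I)).trans (classGroup_mulEquiv_mk _ _)).symm)
    refine congrArg _ (Units.ext ?_)
    simp [hh, FractionalIdeal.ringEquivOfRingEquiv_trans_apply _ (FractionRing R)]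
  smul_one g := map_one (ClassGroup.mulEquiv (MulSemiringAction.toRingEquiv G R g))
  smul_mul g := map_mul (ClassGroup.mulEquiv (MulSemiringAction.toRingEquiv G R g))

end ClassGroup

noncomputable instance [NumberField F] (S : SubMulAction Gal(F/K) (Place F)) :
    MulDistribMulAction Gal(F/K) (ClassGroup (SIntegers S)) :=
  classGroupAction

/-! ### The oriented Arakelov class group -/

section Pic

variable (F) [NumberField F]

/-- The group of fractional ideals of `𝓞 F`, as a discrete group. -/
def FracIdeals : Type u := (FractionalIdeal (𝓞 F)⁰ F)ˣ

noncomputable instance : CommGroup (FracIdeals F) :=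
  inferInstanceAs (CommGroup (FractionalIdeal (𝓞 F)⁰ F)ˣ)

instance : TopologicalSpace (FracIdeals F) := ⊥

instance : DiscreteTopology (FracIdeals F) := ⟨rfl⟩

/-- The étale `ℝ`-algebra `F_ℝ = ℝ ⊗_ℚ F`, with its topology as a finite-dimensional real vector
space. -/
def RealAlg : Type u := ℝ ⊗[ℚ] F

noncomputable instance : CommRing (RealAlg F) := inferInstanceAs (CommRing (ℝ ⊗[ℚ] F))

noncomputable instance : Algebra ℝ (RealAlg F) := inferInstanceAs (Algebra ℝ (ℝ ⊗[ℚ] F))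

instance : Module.Finite ℝ (RealAlg F) := inferInstanceAs (Module.Finite ℝ (ℝ ⊗[ℚ] F))

noncomputable instance : TopologicalSpace (RealAlg F) := moduleTopology ℝ (RealAlg F)

instance : IsModuleTopology ℝ (RealAlg F) := ⟨rfl⟩

instance : IsTopologicalRing (RealAlg F) := IsModuleTopology.isTopologicalRing ℝ (RealAlg F)

/-- The ideal norm `Id_F → ℝ`. -/
noncomputable def idealNorm : FracIdeals F →* ℝ :=
  ((Rat.castHom ℝ : ℚ →* ℝ).comp (FractionalIdeal.absNorm : FractionalIdeal (𝓞 F)⁰ F →*₀ ℚ)).comp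
    (Units.coeHom (FractionalIdeal (𝓞 F)⁰ F))

/-- The absolute value of the `ℝ`-algebra norm `F_ℝ^× → ℝ`. -/
noncomputable def absNm : (RealAlg F)ˣ →* ℝ :=
  ((absHom : ℝ →*₀ ℝ) : ℝ →* ℝ).comp ((Algebra.norm ℝ).comp (Units.coeHom (RealAlg F)))

/-- The fibre product `Id_F ×_{ℝ_{>0}} F_ℝ^×` of the ideal norm and `|Nm|`, with the topology
induced from `Id_F × F_ℝ^×`. -/
noncomputable def fibreProduct : Subgroup (FracIdeals F × (RealAlg F)ˣ) :=
  MonoidHom.eqLocus ((idealNorm F).comp (MonoidHom.fst _ _)) ((absNm F).comp (MonoidHom.snd _ _))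

variable {F} in
theorem mem_fibreProduct (p : FracIdeals F × (RealAlg F)ˣ) :
    p ∈ fibreProduct F ↔ idealNorm F p.1 = absNm F p.2 := Iff.rfl

/-- The inclusion `F^× → F_ℝ^×`. -/
noncomputable def toRealAlg : Fˣ →* (RealAlg F)ˣ :=
  Units.map ((Algebra.TensorProduct.includeRight : F →ₐ[ℚ] ℝ ⊗[ℚ] F) : F →* ℝ ⊗[ℚ] F)

theorem idealNorm_principal (α : Fˣ) :
    idealNorm F (toPrincipalIdeal (𝓞 F) F α) = absNm F (toRealAlg F α) := by
  have h1 : idealNorm F (toPrincipalIdeal (𝓞 F) F α) = ((|Algebra.norm ℚ (α : F)| : ℚ) : ℝ) := by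
    rw [← FractionalIdeal.absNorm_span_singleton (𝓞 F), ← coe_toPrincipalIdeal]
    rfl
  have h2 : absNm F (toRealAlg F α) = |Algebra.norm ℝ ((1 : ℝ) ⊗ₜ[ℚ] (α : F))| := rfl
  have h3 : Algebra.norm ℝ ((1 : ℝ) ⊗ₜ[ℚ] (α : F)) = ((Algebra.norm ℚ (α : F) : ℚ) : ℝ) := by
    have := LinearMap.det_baseChange (A := ℝ) (LinearMap.mul ℚ F (α : F))
    rw [Algebra.norm_apply, Algebra.norm_apply]
    refine Eq.trans (congrArg LinearMap.det ?_) this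
    ext x
    simp
  rw [h1, h2, h3, Rat.cast_abs]

/-- The map `F^× → Id_F ×_{ℝ_{>0}} F_ℝ^×`, `α ↦ (α 𝓞_F, α)`. -/
noncomputable def principal : Fˣ →* fibreProduct F :=
  ((toPrincipalIdeal (𝓞 F) F).prod (toRealAlg F)).codRestrict (fibreProduct F)
    (idealNorm_principal F)

/-- The oriented Arakelov class group: the cokernel of `F^× → Id_F ×_{ℝ_{>0}} F_ℝ^×`, with the
quotient topology. -/
def PicTilde : Type u := fibreProduct F ⧸ (principal F).range

noncomputable instance : CommGroup (PicTilde F) :=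
  inferInstanceAs (CommGroup (fibreProduct F ⧸ (principal F).range))

noncomputable instance : TopologicalSpace (PicTilde F) :=
  inferInstanceAs (TopologicalSpace (fibreProduct F ⧸ (principal F).range))

instance : IsTopologicalGroup (PicTilde F) :=
  inferInstanceAs (IsTopologicalGroup (fibreProduct F ⧸ (principal F).range))

/-- The Pontryagin dual of the oriented Arakelov class group. -/
abbrev PicTildeDual : Type u := PontryaginDual (PicTilde F)

end Pic

section PicAction

variable [NumberField F]

/-- `g • I = g(I)` for fractional ideals `I`. -/
noncomputable instance : MulDistribMulAction Gal(F/K) (FracIdeals F) where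
  smul g := Units.mapEquiv (FractionalIdeal.ringEquivOfRingEquiv F F
    (MulSemiringAction.toRingEquiv _ (𝓞 F) g)).toMulEquiv
  one_smul I := by
    have h : MulSemiringAction.toRingEquiv Gal(F/K) (𝓞 F) 1 = RingEquiv.refl (𝓞 F) := by ext; simp
    refine Units.ext ?_
    change FractionalIdeal.ringEquivOfRingEquiv F F _ _ = _
    rw [h, FractionalIdeal.ringEquivOfRingEquiv_refl]
    rfl
  mul_smul g h I := by
    have hh : MulSemiringAction.toRingEquiv Gal(F/K) (𝓞 F) (g * h) =
        (MulSemiringAction.toRingEquiv _ (𝓞 F) h).trans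
          (MulSemiringAction.toRingEquiv _ (𝓞 F) g) := by
      ext; simp
    refine Units.ext ?_
    change FractionalIdeal.ringEquivOfRingEquiv F F _ _ = _
    rw [hh, FractionalIdeal.ringEquivOfRingEquiv_trans_apply F F]
    rfl
  smul_one g := map_one (Units.mapEquiv (FractionalIdeal.ringEquivOfRingEquiv F F
    (MulSemiringAction.toRingEquiv _ (𝓞 F) g)).toMulEquiv)
  smul_mul g := map_mul (Units.mapEquiv (FractionalIdeal.ringEquivOfRingEquiv F F
    (MulSemiringAction.toRingEquiv _ (𝓞 F) g)).toMulEquiv)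

theorem ringEquivOfRingEquiv_eq (g : Gal(F/K)) (x : F) :
    IsFractionRing.ringEquivOfRingEquiv (K := F) (L := F)
      (MulSemiringAction.toRingEquiv Gal(F/K) (𝓞 F) g) x = g x := by
  obtain ⟨a, b, hb, rfl⟩ := IsFractionRing.div_surjective (A := 𝓞 F) x
  rw [map_div₀, map_div₀, IsFractionRing.ringEquivOfRingEquiv_algebraMap,
    IsFractionRing.ringEquivOfRingEquiv_algebraMap]
  rfl

theorem mem_smul_fracIdeal (g : Gal(F/K)) (I : FracIdeals F) (x : F) :
    x ∈ (show (FractionalIdeal (𝓞 F)⁰ F)ˣ from g • I).val ↔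
      ∃ y ∈ (show (FractionalIdeal (𝓞 F)⁰ F)ˣ from I).val, g y = x := by
  constructor
  · rintro ⟨y, hy, rfl⟩
    exact ⟨y, hy, (ringEquivOfRingEquiv_eq g y).symm⟩
  · rintro ⟨y, hy, rfl⟩
    exact ⟨y, hy, ringEquivOfRingEquiv_eq g y⟩

/-- The automorphism of `F_ℝ = ℝ ⊗_ℚ F` induced by an automorphism of `F`. -/
noncomputable def realAut (g : Gal(F/K)) : RealAlg F ≃ₐ[ℝ] RealAlg F :=
  show (ℝ ⊗[ℚ] F) ≃ₐ[ℝ] (ℝ ⊗[ℚ] F) from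
    Algebra.TensorProduct.congr AlgEquiv.refl
      (AlgEquiv.ofRingEquiv (f := g.toRingEquiv) fun q => map_ratCast g q)

theorem realAut_tmul (g : Gal(F/K)) (r : ℝ) (x : F) :
    realAut g (show RealAlg F from r ⊗ₜ[ℚ] x) = (show RealAlg F from r ⊗ₜ[ℚ] (g x)) := rfl

theorem realAut_one : realAut (1 : Gal(F/K)) = AlgEquiv.refl := by
  refine AlgEquiv.ext fun x => ?_
  induction x using TensorProduct.induction_on with
  | zero => exact map_zero _
  | tmul r x => rfl
  | add x y hx hy => exact (map_add _ _ _).trans (congrArg₂ _ hx hy)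

theorem realAut_mul (g h : Gal(F/K)) : realAut (g * h) = (realAut h).trans (realAut g) := by
  refine AlgEquiv.ext fun x => ?_
  induction x using TensorProduct.induction_on with
  | zero => exact (map_zero _).trans (map_zero _).symm
  | tmul r x => rfl
  | add x y hx hy =>
    exact (map_add _ _ _).trans ((congrArg₂ _ hx hy).trans (map_add _ _ _).symm)

/-- The action on `F_ℝ^×`. -/
noncomputable instance : MulDistribMulAction Gal(F/K) (RealAlg F)ˣ where
  smul g := Units.map (realAut g : RealAlg F →* RealAlg F)
  one_smul x := Units.ext (by
    change realAut (1 : Gal(F/K)) (x : RealAlg F) = x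
    rw [realAut_one]; rfl)
  mul_smul g h x := Units.ext (by
    change realAut (g * h) (x : RealAlg F) = realAut g (realAut h x)
    rw [realAut_mul]; rfl)
  smul_one g := map_one (Units.map (realAut g : RealAlg F →* RealAlg F))
  smul_mul g := map_mul (Units.map (realAut g : RealAlg F →* RealAlg F))

theorem absNorm_map_ringEquiv (e : 𝓞 F ≃+* 𝓞 F) (J : Ideal (𝓞 F)) :
    Ideal.absNorm (J.map e) = Ideal.absNorm J :=
  (Nat.card_congr (Ideal.quotientEquiv J (J.map (e : 𝓞 F →+* 𝓞 F)) e rfl).toEquiv).symm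

open scoped Pointwise in
theorem idealNorm_smul (g : Gal(F/K)) (I : FracIdeals F) :
    idealNorm F (g • I) = idealNorm F I := by
  let e := MulSemiringAction.toRingEquiv Gal(F/K) (𝓞 F) g
  let J : FractionalIdeal (𝓞 F)⁰ F := (show (FractionalIdeal (𝓞 F)⁰ F)ˣ from I).val
  let J' : FractionalIdeal (𝓞 F)⁰ F := (show (FractionalIdeal (𝓞 F)⁰ F)ˣ from g • I).val
  have hden : e (J.den : 𝓞 F) ∈ (𝓞 F)⁰ := by
    rw [mem_nonZeroDivisors_iff_ne_zero, ne_eq, map_eq_zero_iff e e.injective]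
    exact nonZeroDivisors.ne_zero J.den.2
  have hnorm : |Algebra.norm ℤ (e (J.den : 𝓞 F))| = |Algebra.norm ℤ (J.den : 𝓞 F)| := by
    rw [Int.abs_eq_natAbs, Int.abs_eq_natAbs, ← Ideal.absNorm_span_singleton,
      ← Ideal.absNorm_span_singleton, ← absNorm_map_ringEquiv e (Ideal.span {(J.den : 𝓞 F)}),
      Ideal.map_span, Set.image_singleton]
  have hJ := FractionalIdeal.den_mul_self_eq_num J
  have hg : ∀ a : 𝓞 F, g (algebraMap (𝓞 F) F a) = algebraMap (𝓞 F) F (e a) := fun _ => rfl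
  have key : FractionalIdeal.absNorm J' = FractionalIdeal.absNorm J := by
    rw [FractionalIdeal.absNorm_eq' (I := J') ⟨e J.den, hden⟩ (J.num.map e),
      FractionalIdeal.absNorm_eq J, absNorm_map_ringEquiv, hnorm]
    ext x
    refine Iff.trans (Submodule.mem_smul_pointwise_iff_exists _ _ _) ?_
    simp only [Submodule.mem_map, Algebra.linearMap_apply]
    constructor
    · rintro ⟨y, hy, rfl⟩
      obtain ⟨z, hz, rfl⟩ := (mem_smul_fracIdeal g I y).1 hy
      have : (J.den : 𝓞 F) • z ∈ J.den • (J : Submodule (𝓞 F) F) :=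
        Submodule.smul_mem_pointwise_smul _ _ _ hz
      rw [hJ] at this
      obtain ⟨w, hw, hwz⟩ := this
      refine ⟨e w, Ideal.mem_map_of_mem e hw, ?_⟩
      rw [← hg, ← Algebra.linearMap_apply, hwz, Algebra.smul_def, map_mul, hg]
      exact (Algebra.smul_def (e (J.den : 𝓞 F)) (g z)).symm
    · rintro ⟨w', hw', rfl⟩
      obtain ⟨w, hw, rfl⟩ := (Ideal.mem_map_of_equiv e w').1 hw'
      have : algebraMap (𝓞 F) F w ∈ J.den • (J : Submodule (𝓞 F) F) := by
        rw [hJ]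
        exact ⟨w, hw, rfl⟩
      obtain ⟨z, hz, hzw⟩ := this
      refine ⟨g z, (mem_smul_fracIdeal g I _).2 ⟨z, hz, rfl⟩, ?_⟩
      rw [← hg, ← hzw]
      change e (J.den : 𝓞 F) • g z = g ((J.den : 𝓞 F) • z)
      rw [Algebra.smul_def, Algebra.smul_def, map_mul, hg]
  exact congrArg (fun q : ℚ => (q : ℝ)) key

theorem absNm_smul (g : Gal(F/K)) (x : (RealAlg F)ˣ) : absNm F (g • x) = absNm F x :=
  congrArg abs (Algebra.norm_eq_of_algEquiv (realAut g) (x : RealAlg F))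

theorem smul_principalIdeal (g : Gal(F/K)) (α : Fˣ) :
    g • (show FracIdeals F from toPrincipalIdeal (𝓞 F) F α) =
      toPrincipalIdeal (𝓞 F) F (g • α) := by
  refine Units.ext ?_
  have h := FractionalIdeal.ringEquivOfRingEquiv_spanSingleton F F
    (MulSemiringAction.toRingEquiv Gal(F/K) (𝓞 F) g) (α : F)
  rw [ringEquivOfRingEquiv_eq, ← coe_toPrincipalIdeal] at h
  exact h.trans (coe_toPrincipalIdeal (R := 𝓞 F) (g • α)).symm

theorem smul_toRealAlg (g : Gal(F/K)) (α : Fˣ) : g • toRealAlg F α = toRealAlg F (g • α) := rfl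

noncomputable instance : MulDistribMulAction Gal(F/K) (fibreProduct F) where
  smul g p := ⟨g • p.1, by
    rw [mem_fibreProduct, Prod.smul_fst, Prod.smul_snd, idealNorm_smul, absNm_smul]
    exact p.2⟩
  one_smul p := Subtype.ext (one_smul _ p.1)
  mul_smul g h p := Subtype.ext (mul_smul g h p.1)
  smul_one g := Subtype.ext (smul_one g)
  smul_mul g p q := Subtype.ext (smul_mul' g p.1 q.1)

theorem smul_principal (g : Gal(F/K)) (α : Fˣ) : g • principal F α = principal F (g • α) :=
  Subtype.ext (Prod.ext (smul_principalIdeal g α) (smul_toRealAlg g α))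

/-- The endomorphism of `PicTilde F` induced by `g`. -/
noncomputable def picMap (g : Gal(F/K)) : PicTilde F →* PicTilde F :=
  QuotientGroup.map (principal F).range (principal F).range
    (MulDistribMulAction.toMonoidHom (fibreProduct F) g) <| by
    rintro _ ⟨α, rfl⟩
    exact ⟨g • α, (smul_principal g α).symm⟩

/-- The action on the oriented Arakelov class group. -/
noncomputable instance : MulDistribMulAction Gal(F/K) (PicTilde F) where
  smul g := picMap g
  one_smul x := by
    induction x using QuotientGroup.induction_on with
    | H p => exact congrArg _ (one_smul _ p)
  mul_smul g h x := by
    induction x using QuotientGroup.induction_on with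
    | H p => exact congrArg _ (mul_smul g h p)
  smul_one g := map_one (picMap g)
  smul_mul g := map_mul (picMap g)

instance : ContinuousConstSMul Gal(F/K) (RealAlg F)ˣ where
  continuous_const_smul g := Continuous.units_map _
    (IsModuleTopology.continuous_of_linearMap (realAut g).toLinearMap)

instance : ContinuousConstSMul Gal(F/K) (FracIdeals F) where
  continuous_const_smul _ := continuous_of_discreteTopology

instance : ContinuousConstSMul Gal(F/K) (fibreProduct F) where
  continuous_const_smul g :=
    ((continuous_const_smul g).comp continuous_subtype_val).subtype_mk _

instance : ContinuousConstSMul Gal(F/K) (PicTilde F) where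
  continuous_const_smul g :=
    Continuous.quotient_map' (continuous_const_smul (T := fibreProduct F) g) fun a b h => by
      rw [QuotientGroup.leftRel_apply] at h ⊢
      obtain ⟨α, hα⟩ := h
      exact ⟨g • α, by rw [← smul_principal, hα, smul_mul', smul_inv']⟩

end PicAction

section PontryaginDual

variable {G A : Type*} [Group G] [CommGroup A] [TopologicalSpace A] [MulDistribMulAction G A]
  [ContinuousConstSMul G A]

/-- The action on the Pontryagin dual, `(g χ)(a) = χ (g⁻¹ a)`. -/
noncomputable instance : MulDistribMulAction G (PontryaginDual A) where
  smul g χ := PontryaginDual.map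
    ⟨MulDistribMulAction.toMonoidHom A g⁻¹, continuous_const_smul g⁻¹⟩ χ
  one_smul χ := by
    ext a
    change (χ ((1 : G)⁻¹ • a) : ℂ) = χ a
    rw [inv_one, one_smul]
  mul_smul g h χ := by
    ext a
    change (χ ((g * h)⁻¹ • a) : ℂ) = χ (h⁻¹ • g⁻¹ • a)
    rw [mul_inv_rev, mul_smul]
  smul_one _ := rfl
  smul_mul _ _ _ := rfl

theorem smul_pontryaginDual_apply (g : G) (χ : PontryaginDual A) (a : A) :
    (g • χ) a = χ (g⁻¹ • a) := rfl

end PontryaginDual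

/-! ### The modules in the theorem -/

section Modules

/-- A multiplicative abelian group with an action of `G` by automorphisms, as a
(left) `ℤ[G]`-module (written additively). -/
abbrev GModule (G : Type*) (A : Type*) [Group G] [CommGroup A] [MulDistribMulAction G A] :=
  (Representation.ofMulDistribMulAction G A).asModule

/-- The permutation module `ℤ[X]` of a `G`-set `X`, with basis `X`. -/
abbrev PermModule (G : Type*) (X : Type*) [Group G] [MulAction G X] :=
  (Representation.ofMulAction ℤ G X).asModule

instance {G X : Type*} [Group G] [MulAction G X] [Finite X] :
    Module.Finite (MonoidAlgebra ℤ G) (PermModule G X) :=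
  have : Module.Finite ℤ (PermModule G X) :=
    inferInstanceAs (Module.Finite ℤ (MonoidAlgebra ℤ X))
  Module.Finite.of_restrictScalars_finite ℤ (MonoidAlgebra ℤ G) (PermModule G X)

end Modules

end Arakelov

/-! For an equivariant map `f` with finitely generated kernel and cokernel, call `[coker f] - [ker
f]` in `G₀(ℤ[G])` its index. The index is additive under composition, by the six-term
kernel-cokernel sequence, and makes sense for modules that are far from finitely generated, such as
`F^×`, `Id_F` or a real vector space.

The topological half is `Arakelov.mk_pontryaginDual`. Let `e : H → P` be the exponential map of a
compact abelian Lie group: continuous, open at the identity, its kernel a full lattice and its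
cokernel of finite exponent. Choose a free module `N` and a lift `N → P` of a surjection `N → coker
e`. Then `s : H × N → P` is onto, and `Λ = ker s` is a lattice in an exact sequence `0 → ker e → Λ →
N → coker e → 0`. Integral forms on `Λ` extend uniquely to real forms on `H × N`, and their
exponentials descend to characters of `P`. This gives `0 → N^* → Λ^* → P^∨ → 0`, hence `[P^∨] = σ[Λ]
- σ[N] = -σ(index e)`.

The arithmetic half is the index of the exponential map to the Arakelov class group, which factors
into three maps. The Lie algebra lies in a larger group of logarithms in `∏_φ ℂ` that satisfy the
conjugation symmetry only after exponentiation; the quotient records winding numbers and is `ℤ[S_∞]`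
(`hasIndex_inclusion`). The exponential maps this larger group onto the elements of `F_ℝ^×` of norm
`±1`, with kernel the permutation module on the complex embeddings, which is free of rank `d`
(`hasIndex_expKer`). Finally, the elements of norm `±1` and `F^×` are two submodules of the fibre
product with quotients `Id_F` and the Arakelov class group, so by `HasIndex.swap` the remaining map
has the index of `F^× → Id_F`. Dividing `Id_F` by the ideals supported in `S` turns that map into
one with kernel the `S`-units and cokernel the `S`-class group, so its index is `[Cl_S] - [O_S^×] +
[ℤ[S_f]]` with `S_f` the finite part of `S` (`hasIndex_principalIdealMap`).

Applying `-σ` to the total, and using that `σ` fixes permutation modules, gives the formula. -/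

set_option linter.unusedSectionVars false

namespace LinearMap

variable {T : Type*} [Ring T] {A B C : Type*} [AddCommGroup A] [Module T A]
  [AddCommGroup B] [Module T B] [AddCommGroup C] [Module T C]

/-- A linear map that vanishes on the kernel of a surjection factors through it. -/
theorem exists_comp_eq_of_ker_le (q : A →ₗ[T] B) (hq : Function.Surjective q) (f : A →ₗ[T] C)
    (h : ker q ≤ ker f) : ∃ f' : B →ₗ[T] C, ∀ a, f' (q a) = f a :=
  ⟨(ker q).liftQ f h ∘ₗ (q.quotKerEquivOfSurjective hq).symm.toLinearMap, fun a => by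
    have : (q.quotKerEquivOfSurjective hq).symm (q a) = (ker q).mkQ a :=
      (LinearEquiv.symm_apply_eq _).2 rfl
    simp [this]⟩

/-- A linear map with values in the range of an injection factors through it. -/
theorem exists_comp_eq_of_range_le (i : A →ₗ[T] B) (hi : Function.Injective i) (f : C →ₗ[T] B)
    (h : ∀ c, ∃ a, i a = f c) : ∃ f' : C →ₗ[T] A, ∀ c, i (f' c) = f c :=
  ⟨(LinearEquiv.ofInjective i hi).symm.toLinearMap ∘ₗ f.codRestrict (range i) h, fun c =>
    congrArg Subtype.val
      ((LinearEquiv.ofInjective i hi).apply_symm_apply (f.codRestrict (range i) h c))⟩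

end LinearMap

/-! ### Index calculus in the Grothendieck group. -/

namespace G0

section Index

variable {T : Type u} [Ring T]

theorem mk_eq_zero (M : Type u) [AddCommGroup M] [Module T M] [Module.Finite T M]
    [Subsingleton M] : mk T M = 0 := by
  have h := mk_eq_add (T := T) (0 : M →ₗ[T] M) (0 : M →ₗ[T] M)
    (Function.injective_of_subsingleton _) (fun x => by simp [Subsingleton.elim x 0])
    (fun x => ⟨0, Subsingleton.elim _ _⟩)
  simpa using h

variable {A B C D : Type u} [AddCommGroup A] [Module T A]
  [AddCommGroup B] [Module T B] [AddCommGroup C] [Module T C] [AddCommGroup D] [Module T D]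

/-- Splits each term of a long exact sequence into two ranges, so that alternating sums telescope.
-/
theorem mk_eq_of_exact [Module.Finite T A] [Module.Finite T B] [Module.Finite T C]
    (f : A →ₗ[T] B) (g : B →ₗ[T] C) (h : Function.Exact f g) :
    mk T B = mk T (LinearMap.range f) + mk T (LinearMap.range g) := by
  refine mk_eq_add (LinearMap.range f).subtype g.rangeRestrict (Submodule.injective_subtype _)
    (fun x => ?_) g.surjective_rangeRestrict
  rw [Submodule.coe_subtype, Subtype.range_coe]
  exact Iff.trans (by simp [LinearMap.rangeRestrict, Subtype.ext_iff]) (h x)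

/-- A linear map whose kernel and cokernel are finitely generated has index `x` if
`[coker f] - [ker f] = x`. -/
def HasIndex (f : A →ₗ[T] B) (x : G0 T) : Prop :=
  ∃ (_ : Module.Finite T (LinearMap.ker f)) (_ : Module.Finite T (B ⧸ LinearMap.range f)),
    mk T (B ⧸ LinearMap.range f) - mk T (LinearMap.ker f) = x

/-- Formulas in `G₀` are obtained below by computing the index of one map in two ways and comparing.
-/
theorem HasIndex.unique {f : A →ₗ[T] B} {x y : G0 T} (hx : HasIndex f x) (hy : HasIndex f y) :
    x = y := by
  obtain ⟨_, _, rfl⟩ := hx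
  obtain ⟨_, _, rfl⟩ := hy
  rfl

theorem HasIndex.of_exact [Module.Finite T C] [Module.Finite T D] {i : C →ₗ[T] A}
    {f : A →ₗ[T] B} {p : B →ₗ[T] D} (hi : Function.Injective i) (hif : Function.Exact i f)
    (hfp : Function.Exact f p) (hp : Function.Surjective p) :
    HasIndex f (mk T D - mk T C) := by
  let e₁ : C ≃ₗ[T] LinearMap.ker f :=
    (LinearEquiv.ofInjective i hi).trans (LinearEquiv.ofEq _ _ hif.linearMap_ker_eq.symm)
  let e₂ : (B ⧸ LinearMap.range f) ≃ₗ[T] D :=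
    (Submodule.quotEquivOfEq _ _ hfp.linearMap_ker_eq.symm).trans
      (p.quotKerEquivOfSurjective hp)
  have h₁ := Module.Finite.equiv e₁
  have h₂ := Module.Finite.equiv e₂.symm
  exact ⟨h₁, h₂, by rw [mk_congr e₁, mk_congr e₂]⟩

/-- Once a map is known to have an index, finite generation passes to any model of its kernel, and
by `HasIndex.finite_right` to any model of its cokernel. The `S`-units and the `S`-class group get
their finite generation this way. -/
theorem HasIndex.finite_left {f : A →ₗ[T] B} {x : G0 T} (h : HasIndex f x) {i : C →ₗ[T] A}
    (hi : Function.Injective i) (hif : Function.Exact i f) : Module.Finite T C :=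
  have := h.1
  Module.Finite.equiv ((LinearEquiv.ofInjective i hi).trans
    (LinearEquiv.ofEq _ _ hif.linearMap_ker_eq.symm)).symm

theorem HasIndex.finite_right {f : A →ₗ[T] B} {x : G0 T} (h : HasIndex f x) {p : B →ₗ[T] D}
    (hfp : Function.Exact f p) (hp : Function.Surjective p) : Module.Finite T D :=
  have := h.2.1
  Module.Finite.equiv ((Submodule.quotEquivOfEq _ _ hfp.linearMap_ker_eq.symm).trans
      (p.quotKerEquivOfSurjective hp))

theorem HasIndex.of_injective [Module.Finite T D]
    {f : A →ₗ[T] B} {p : B →ₗ[T] D} (hf : Function.Injective f)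
    (hfp : Function.Exact f p) (hp : Function.Surjective p) : HasIndex f (mk T D) := by
  have := HasIndex.of_exact (C := PUnit.{u + 1}) (i := (0 : _ →ₗ[T] A)) (f := f) (p := p)
    (Function.injective_of_subsingleton _)
    (fun x => by simp [eq_comm (a := (0 : A)), map_eq_zero_iff f hf]) hfp hp
  rwa [mk_eq_zero PUnit.{u + 1}, sub_zero] at this

theorem HasIndex.of_surjective [Module.Finite T C] {i : C →ₗ[T] A}
    {f : A →ₗ[T] B} (hi : Function.Injective i) (hif : Function.Exact i f)
    (hf : Function.Surjective f) : HasIndex f (-mk T C) := by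
  have := HasIndex.of_exact (D := PUnit.{u + 1}) (p := (0 : B →ₗ[T] _)) hi hif
    (fun x => by simpa using hf x) (fun x => ⟨0, Subsingleton.elim _ _⟩)
  rwa [mk_eq_zero PUnit.{u + 1}, zero_sub] at this

/-- The sequence `0 → ker f → ker (g ∘ f) → ker g → coker f → coker (g ∘ f) → coker g → 0` is exact.
The two terms not assumed finitely generated are extensions of finitely generated ones over a
Noetherian ring, and the alternating sum of all six classes vanishes. -/
theorem HasIndex.comp [IsNoetherianRing T] {f : A →ₗ[T] B} {g : B →ₗ[T] C} {x y : G0 T} (hf : HasIndex f x)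
    (hg : HasIndex g y) : HasIndex (g ∘ₗ f) (x + y) := by
  obtain ⟨_, _, rfl⟩ := hf
  obtain ⟨_, _, rfl⟩ := hg
  let k : LinearMap.ker f →ₗ[T] LinearMap.ker (g ∘ₗ f) :=
    Submodule.inclusion (LinearMap.ker_le_ker_comp f g)
  let u : LinearMap.ker (g ∘ₗ f) →ₗ[T] LinearMap.ker g :=
    (f ∘ₗ Submodule.subtype _).codRestrict _ fun a => a.2
  let w : LinearMap.ker g →ₗ[T] B ⧸ LinearMap.range f :=
    (LinearMap.range f).mkQ ∘ₗ Submodule.subtype _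
  let v : (B ⧸ LinearMap.range f) →ₗ[T] C ⧸ LinearMap.range (g ∘ₗ f) :=
    Submodule.mapQ _ _ g (by rintro _ ⟨a, rfl⟩; exact ⟨a, rfl⟩)
  let c : (C ⧸ LinearMap.range (g ∘ₗ f)) →ₗ[T] C ⧸ LinearMap.range g :=
    Submodule.factor (LinearMap.range_comp_le_range f g)
  have hku : Function.Exact k u := by
    rintro ⟨a, ha⟩
    constructor
    · exact fun h => ⟨⟨a, congrArg Subtype.val h⟩, rfl⟩
    · rintro ⟨b, hb⟩
      refine Subtype.ext ?_
      have := congrArg Subtype.val hb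
      change (b : A) = a at this
      change f a = 0
      rw [← this]
      exact b.2
  have huw : Function.Exact u w := by
    rintro ⟨b, hb⟩
    constructor
    · intro h
      obtain ⟨a, ha⟩ := (Submodule.Quotient.mk_eq_zero _).1 h
      exact ⟨⟨a, by rwa [LinearMap.mem_ker, LinearMap.comp_apply, ha]⟩, Subtype.ext ha⟩
    · rintro ⟨a, ha⟩
      exact (Submodule.Quotient.mk_eq_zero _).2 ⟨a, congrArg Subtype.val ha⟩
  have hwv : Function.Exact w v := by
    intro b
    obtain ⟨b, rfl⟩ := Submodule.Quotient.mk_surjective _ b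
    constructor
    · intro h
      obtain ⟨a, ha⟩ := (Submodule.Quotient.mk_eq_zero _).1 h
      refine ⟨⟨b - f a, ?_⟩, ?_⟩
      · rw [LinearMap.mem_ker, map_sub, sub_eq_zero]
        exact ha.symm
      · refine (Submodule.Quotient.eq _).2 ⟨-a, ?_⟩
        simp
    · rintro ⟨b', hb'⟩
      rw [← hb']
      refine (Submodule.Quotient.mk_eq_zero _).2 ?_
      have h : g b' = 0 := b'.2
      exact h ▸ zero_mem _
  have hvc : Function.Exact v c := by
    intro z
    obtain ⟨z, rfl⟩ := Submodule.Quotient.mk_surjective _ z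
    constructor
    · intro h
      obtain ⟨b, hb⟩ := (Submodule.Quotient.mk_eq_zero _).1 h
      exact ⟨Submodule.Quotient.mk b, congrArg _ hb⟩
    · rintro ⟨b, hb⟩
      obtain ⟨b, rfl⟩ := Submodule.Quotient.mk_surjective _ b
      rw [← hb]
      exact (Submodule.Quotient.mk_eq_zero _).2 ⟨b, rfl⟩
  have hk : Function.Injective k := Submodule.inclusion_injective _
  have hc : Function.Surjective c := Submodule.factor_surjective _
  have h₁ : IsNoetherian T (LinearMap.ker (g ∘ₗ f)) :=
    isNoetherian_of_range_eq_ker k u hku.linearMap_ker_eq.symm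
  have h₂ : IsNoetherian T (C ⧸ LinearMap.range (g ∘ₗ f)) :=
    isNoetherian_of_range_eq_ker v c hvc.linearMap_ker_eq.symm
  refine ⟨inferInstance, inferInstance, ?_⟩
  have e₁ := mk_eq_of_exact k u hku
  have e₂ := mk_eq_of_exact u w huw
  have e₃ := mk_eq_of_exact w v hwv
  have e₄ := mk_eq_of_exact v c hvc
  rw [← mk_congr (LinearEquiv.ofInjective k hk)] at e₁
  rw [mk_congr (LinearEquiv.ofTop _ (LinearMap.range_eq_top.2 hc))] at e₄
  rw [e₁, e₂, e₃, e₄]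
  abel

/-- Between finitely generated modules the index does not depend on the map. -/
theorem HasIndex.of_finite [IsNoetherianRing T] [Module.Finite T A] [Module.Finite T B]
    (f : A →ₗ[T] B) : HasIndex f (mk T B - mk T A) := by
  refine ⟨inferInstance, inferInstance, ?_⟩
  have e₁ := mk_eq_add (LinearMap.ker f).subtype f.rangeRestrict
    (Submodule.injective_subtype _)
    (fun x => by
      rw [Submodule.coe_subtype, Subtype.range_coe]
      simp [LinearMap.rangeRestrict, Subtype.ext_iff])
    f.surjective_rangeRestrict
  have e₂ := mk_eq_add (LinearMap.range f).subtype (LinearMap.range f).mkQ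
    (Submodule.injective_subtype _) (LinearMap.exact_subtype_mkQ _)
    (Submodule.mkQ_surjective _)
  rw [e₁, e₂]
  abel

/-- If `A, B` are submodules of `M`, then `A → M / B` and `B → M / A` have the same index. -/
theorem HasIndex.swap {M : Type u} [AddCommGroup M] [Module T M] {a : A →ₗ[T] M} {p : M →ₗ[T] C}
    {b : B →ₗ[T] M} {q : M →ₗ[T] D} (ha : Function.Injective a) (hap : Function.Exact a p)
    (hp : Function.Surjective p) (hb : Function.Injective b) (hbq : Function.Exact b q)
    (hq : Function.Surjective q) {x : G0 T} (h : HasIndex (p ∘ₗ b) x) :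
    HasIndex (q ∘ₗ a) x := by
  obtain ⟨_, _, rfl⟩ := h
  -- Both kernels are `A ∩ B` and both cokernels are `M / (A + B)`: `i` embeds the kernel of `p ∘ b`
  -- in `A`, and `r` maps `M / B` onto the cokernel of `p ∘ b`.
  obtain ⟨i, hi⟩ := LinearMap.exists_comp_eq_of_range_le a ha
    (b ∘ₗ (LinearMap.ker (p ∘ₗ b)).subtype) fun c => (hap _).1 c.2
  obtain ⟨r, hr⟩ := LinearMap.exists_comp_eq_of_ker_le q hq
    ((LinearMap.range (p ∘ₗ b)).mkQ ∘ₗ p) fun m hm => by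
      obtain ⟨y, rfl⟩ := (hbq m).1 hm
      exact (Submodule.Quotient.mk_eq_zero _).2 ⟨y, rfl⟩
  refine HasIndex.of_exact (i := i) (p := r) (fun y z hyz => ?_) (fun y => ?_) (fun z => ?_) ?_
  · have := congrArg a hyz
    rw [hi, hi] at this
    exact Subtype.ext (hb this)
  · constructor
    · intro hy
      obtain ⟨z, hz⟩ := (hbq _).1 hy
      refine ⟨⟨z, ?_⟩, ha ?_⟩
      · rw [LinearMap.mem_ker, LinearMap.comp_apply, hz, hap.apply_apply_eq_zero]
      · rw [hi]
        exact hz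
    · rintro ⟨z, rfl⟩
      rw [LinearMap.comp_apply, hi]
      exact hbq.apply_apply_eq_zero _
  · obtain ⟨m, rfl⟩ := hq z
    rw [hr]
    constructor
    · intro hm
      obtain ⟨y, hy⟩ := (Submodule.Quotient.mk_eq_zero _).1 hm
      obtain ⟨w, hw⟩ := (hap (m - b y)).1 (by rw [map_sub, sub_eq_zero]; exact hy.symm)
      refine ⟨w, ?_⟩
      rw [LinearMap.comp_apply, hw, map_sub, hbq.apply_apply_eq_zero, sub_zero]
    · rintro ⟨w, hw⟩
      obtain ⟨y, hy⟩ := (hbq (m - a w)).1 (by rw [map_sub, sub_eq_zero]; exact hw.symm)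
      refine (Submodule.Quotient.mk_eq_zero _).2 ⟨y, ?_⟩
      rw [LinearMap.comp_apply, hy, map_sub, hap.apply_apply_eq_zero, sub_zero]
  · intro z
    obtain ⟨z, rfl⟩ := Submodule.Quotient.mk_surjective _ z
    obtain ⟨m, rfl⟩ := hp z
    exact ⟨q m, hr m⟩

theorem mk_fin_fun (M : Type u) [AddCommGroup M] [Module T M] [Module.Finite T M] (n : ℕ) :
    mk T (Fin n → M) = n • mk T M := by
  induction n with
  | zero => rw [mk_eq_zero, zero_smul]
  | succ n ih =>
    rw [mk_congr (Fin.consLinearEquiv T fun _ : Fin (n + 1) => M).symm, succ_nsmul, ← ih, add_comm]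
    exact mk_eq_add (LinearMap.inl T M (Fin n → M)) (LinearMap.snd T M (Fin n → M))
      LinearMap.inl_injective (fun x => ⟨fun h => ⟨x.1, Prod.ext rfl h.symm⟩, by
        rintro ⟨y, rfl⟩; rfl⟩) LinearMap.snd_surjective

end Index

end G0

/-! ### Modules with a permuted basis. -/

namespace G0

variable {G : Type u} [Group G]

theorem mk_prod {T : Type u} [Ring T] (M N : Type u) [AddCommGroup M] [Module T M]
    [Module.Finite T M] [AddCommGroup N] [Module T N] [Module.Finite T N] :
    mk T (M × N) = mk T M + mk T N :=
  mk_eq_add (LinearMap.inl T M N) (LinearMap.snd T M N)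
    LinearMap.inl_injective (fun x => ⟨fun h => ⟨x.1, Prod.ext rfl h.symm⟩, by
      rintro ⟨y, rfl⟩; rfl⟩) LinearMap.snd_surjective

/-- Modules with a `ℤ`-basis that is permuted by `G` are determined in `G₀(ℤ[G])` by the
`G`-set of basis elements. -/
theorem mk_eq_mk_of_basis {X Y : Type*} [MulAction G X] [MulAction G Y] {M N : Type u}
    [AddCommGroup M] [Module (MonoidAlgebra ℤ G) M] [Module.Finite (MonoidAlgebra ℤ G) M]
    [AddCommGroup N] [Module (MonoidAlgebra ℤ G) N] [Module.Finite (MonoidAlgebra ℤ G) N]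
    (b : Module.Basis X ℤ M) (c : Module.Basis Y ℤ N) (e : X ≃ Y)
    (hb : ∀ (g : G) x, MonoidAlgebra.single g (1 : ℤ) • b x = b (g • x))
    (hc : ∀ (g : G) y, MonoidAlgebra.single g (1 : ℤ) • c y = c (g • y))
    (he : ∀ (g : G) x, e (g • x) = g • e x) :
    mk (MonoidAlgebra ℤ G) M = mk (MonoidAlgebra ℤ G) N := by
  let f := b.equiv c e
  refine mk_congr (LinearEquiv.ofBijective
    (linearOfComm (G := G) (f : M →+ N) fun g m => ?_) f.bijective)
  change f _ = _ • f m
  have key : f.toLinearMap ∘ₗ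
      (DistribSMul.toAddMonoidHom M (MonoidAlgebra.single g (1 : ℤ))).toIntLinearMap =
      (DistribSMul.toAddMonoidHom N (MonoidAlgebra.single g (1 : ℤ))).toIntLinearMap ∘ₗ
        f.toLinearMap := b.ext fun x => by
    simp [f, hb, hc, he]
  exact LinearMap.congr_fun key m

/-- The duality automorphism fixes the classes of permutation modules. -/
theorem sigma_mk_of_basis [Finite G] {X : Type*} [Finite X] [MulAction G X] {M : Type u}
    [AddCommGroup M] [Module (MonoidAlgebra ℤ G) M] [Module.Finite (MonoidAlgebra ℤ G) M]
    (b : Module.Basis X ℤ M)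
    (hb : ∀ (g : G) x, MonoidAlgebra.single g (1 : ℤ) • b x = b (g • x)) :
    sigma G (mk (MonoidAlgebra ℤ G) M) = mk (MonoidAlgebra ℤ G) M := by
  classical
  have := Module.Free.of_basis b
  rw [sigma_mk]
  refine mk_eq_mk_of_basis (M := Dual G M)
    (b.dualBasis : Module.Basis X ℤ (Module.Dual ℤ M)) b (Equiv.refl X) (fun g x => ?_) hb
    (fun _ _ => rfl)
  -- The dual basis is permuted like the basis itself: at `b y`, the translate by `g` of the form
  -- dual to `b x` takes the value of that form at `b (g⁻¹ • y)`, which is `1` exactly when `y = g •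
  -- x`.
  refine b.ext fun y => ?_
  refine (single_smul_dual_apply g (b.dualBasis x) (b y)).trans ?_
  change b.dualBasis x _ = b.dualBasis (g • x) (b y)
  rw [hb, b.dualBasis_apply_self, b.dualBasis_apply_self]
  simp only [inv_smul_eq_iff]

/-- The `ℤ`-basis `G` of `ℤ[G]`. -/
noncomputable def groupBasis (G : Type*) : Module.Basis G ℤ (MonoidAlgebra ℤ G) :=
  .ofRepr (MonoidAlgebra.coeffLinearEquiv ℤ)

theorem groupBasis_apply (G : Type*) (g : G) : groupBasis G g = MonoidAlgebra.single g 1 := by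
  classical
  apply (groupBasis G).repr.injective
  rw [Module.Basis.repr_self]
  rfl

theorem single_smul_groupBasis (g x : G) :
    MonoidAlgebra.single g (1 : ℤ) • groupBasis G x = groupBasis G (g • x) := by
  simp [groupBasis_apply]

end G0

namespace Arakelov

open G0

/-! ### Modules over group rings from actions -/

section GModule

variable {G A B : Type*} [Group G] [CommGroup A] [MulDistribMulAction G A]
  [CommGroup B] [MulDistribMulAction G B]

variable (G A) in
/-- The identification of `A` with the module `GModule G A`. -/
def gmodEquiv : Additive A ≃+ GModule G A := (Representation.asModuleEquiv _).symm.toAddEquiv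

variable (G) in
/-- The element of `GModule G A` given by `a : A`. -/
def gmk (a : A) : GModule G A := gmodEquiv G A (Additive.ofMul a)

/-- The element of `A` given by an element of `GModule G A`. -/
def gval (x : GModule G A) : A := Additive.toMul ((gmodEquiv G A).symm x)

@[simp] theorem gval_gmk (a : A) : gval (gmk G a) = a := rfl
@[simp] theorem gmk_gval (x : GModule G A) : gmk G (gval x) = x := rfl
@[simp] theorem gval_zero : gval (0 : GModule G A) = 1 := rfl
@[simp] theorem gval_add (x y : GModule G A) : gval (x + y) = gval x * gval y := rfl
@[simp] theorem gval_neg (x : GModule G A) : gval (-x) = (gval x)⁻¹ := rfl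
@[simp] theorem gmk_one : gmk G (1 : A) = 0 := rfl
@[simp] theorem gmk_mul (a b : A) : gmk G (a * b) = gmk G a + gmk G b := rfl

theorem gval_injective : Function.Injective (gval : GModule G A → A) := fun _ _ h => h

theorem gval_smul (g : G) (x : GModule G A) :
    gval (MonoidAlgebra.single g (1 : ℤ) • x) = g • gval x := by
  rw [Representation.single_smul, one_smul]
  rfl

theorem gval_nsmul (n : ℕ) (x : GModule G A) : gval (n • x) = gval x ^ n :=
  toMul_nsmul n ((gmodEquiv G A).symm x)

theorem gval_eq_one {x : GModule G A} : gval x = 1 ↔ x = 0 := Iff.rfl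

/-- The linear map given by an equivariant homomorphism. -/
noncomputable def gmap (f : A →* B) (h : ∀ (g : G) a, f (g • a) = g • f a) :
    GModule G A →ₗ[MonoidAlgebra ℤ G] GModule G B :=
  linearOfComm (V := GModule G A) (W := GModule G B)
    ((gmodEquiv G B).toAddMonoidHom.comp
      ((MonoidHom.toAdditive f).comp (gmodEquiv G A).symm.toAddMonoidHom)) <| by
    intro g x
    apply gval_injective
    rw [gval_smul]
    refine Eq.trans ?_ (h g (gval x))
    exact congrArg f (gval_smul g x)

theorem gmap_surjective {f : A →* B} {h : ∀ (g : G) a, f (g • a) = g • f a}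
    (hf : Function.Surjective f) : Function.Surjective (gmap f h) := hf

end GModule

/-! ### Functions on a `G`-set. -/

section FunModule

/-- The functions on a `G`-set `X`, with the `ℤ[G]`-module structure `(g f)(x) = f (g⁻¹ x)`. -/
def FunModule (_G X R : Type*) := X → R

variable {G X R : Type*}

instance [AddCommGroup R] : AddCommGroup (FunModule G X R) :=
  inferInstanceAs (AddCommGroup (X → R))

noncomputable instance [Fintype X] [NormedAddCommGroup R] :
    NormedAddCommGroup (FunModule G X R) :=
  inferInstanceAs (NormedAddCommGroup (X → R))

variable [Group G] [MulAction G X] [AddCommGroup R]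

variable (G X R) in
/-- The representation of `G` on functions. -/
def funRep : Representation ℤ G (X → R) where
  toFun g := (AddMonoidHom.mk' (fun f x => f (g⁻¹ • x)) fun _ _ => rfl).toIntLinearMap
  map_one' := by ext; simp
  map_mul' g h := by ext; simp [mul_smul]

noncomputable instance : Module (MonoidAlgebra ℤ G) (FunModule G X R) :=
  inferInstanceAs (Module (MonoidAlgebra ℤ G) (funRep G X R).asModule)

theorem single_smul_fun (g : G) (f : FunModule G X R) (x : X) :
    (MonoidAlgebra.single g (1 : ℤ) • f) x = f (g⁻¹ • x) := by
  have : (MonoidAlgebra.single g (1 : ℤ) • (show (funRep G X R).asModule from f)) =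
      funRep G X R g f := by
    rw [Representation.single_smul, one_smul]
    rfl
  exact congrFun this x

instance [Finite X] : Module.Finite (MonoidAlgebra ℤ G) (FunModule G X ℤ) :=
  have : Module.Finite ℤ (FunModule G X ℤ) := inferInstanceAs (Module.Finite ℤ (X → ℤ))
  Module.Finite.of_restrictScalars_finite ℤ (MonoidAlgebra ℤ G) (FunModule G X ℤ)

variable (G X) in
/-- The basis of `FunModule G X ℤ` given by the indicator functions of points. -/
noncomputable def funBasis [Finite X] : Module.Basis X ℤ (FunModule G X ℤ) :=
  (Pi.basisFun ℤ X : Module.Basis X ℤ (X → ℤ))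

open Classical in
theorem funBasis_apply [Finite X] (x y : X) : funBasis G X x y = if y = x then 1 else 0 := by
  refine (congrFun (Pi.basisFun_apply ℤ X x) y).trans ?_
  rw [Pi.single_apply]

theorem single_smul_funBasis [Finite X] (g : G) (x : X) :
    MonoidAlgebra.single g (1 : ℤ) • funBasis G X x = funBasis G X (g • x) := by
  funext y
  rw [single_smul_fun, funBasis_apply, funBasis_apply]
  congr 1
  exact propext inv_smul_eq_iff

theorem single_smul_permBasis (g : G) (x : X) :
    MonoidAlgebra.single g (1 : ℤ) • (show PermModule G X from groupBasis X x) =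
      (show PermModule G X from groupBasis X (g • x)) := by
  rw [Representation.single_smul, one_smul]
  change Representation.ofMulAction ℤ G X g (groupBasis X x) = _
  rw [groupBasis_apply, groupBasis_apply, Representation.ofMulAction_single]

end FunModule

/-- Explicit maps are easier to write pointwise on functions, so permutation modules enter the index
computations in this guise. -/
theorem mk_funModule {G X : Type u} [Group G] [MulAction G X] [Finite X] :
    mk (MonoidAlgebra ℤ G) (FunModule G X ℤ) = mk (MonoidAlgebra ℤ G) (PermModule G X) :=
  mk_eq_mk_of_basis (funBasis G X)
    (show Module.Basis X ℤ (PermModule G X) from groupBasis X) (Equiv.refl X)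
    single_smul_funBasis single_smul_permBasis (fun _ _ => rfl)

theorem sigma_mk_permModule {G X : Type u} [Group G] [Finite G] [MulAction G X] [Finite X] :
    sigma G (mk (MonoidAlgebra ℤ G) (PermModule G X)) =
      mk (MonoidAlgebra ℤ G) (PermModule G X) :=
  sigma_mk_of_basis (show Module.Basis X ℤ (PermModule G X) from groupBasis X)
    single_smul_permBasis

theorem sigma_mk_groupRing {G : Type u} [Group G] [Finite G] :
    sigma G (mk (MonoidAlgebra ℤ G) (MonoidAlgebra ℤ G)) =
      mk (MonoidAlgebra ℤ G) (MonoidAlgebra ℤ G) :=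
  sigma_mk_of_basis (groupBasis G) single_smul_groupBasis

theorem mk_permModule_of_equiv_sum {G X Y Z : Type u} [Group G] [MulAction G X] [Finite X]
    [MulAction G Y] [Finite Y] [MulAction G Z] [Finite Z] (e : X ⊕ Y ≃ Z)
    (he : ∀ (g : G) x, e (g • x) = g • e x) :
    mk (MonoidAlgebra ℤ G) (PermModule G Z) =
      mk (MonoidAlgebra ℤ G) (PermModule G X) + mk (MonoidAlgebra ℤ G) (PermModule G Y) := by
  rw [← mk_funModule (X := X), ← mk_funModule (X := Y), ← mk_prod, eq_comm]
  refine mk_eq_mk_of_basis ((funBasis G X).prod (funBasis G Y))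
    (show Module.Basis Z ℤ (PermModule G Z) from groupBasis Z) e (fun g x => ?_)
    single_smul_permBasis he
  rcases x with x | x
  · refine Prod.ext ?_ ?_
    · simp [single_smul_funBasis, Sum.smul_inl]
    · simp [Sum.smul_inl]
  · refine Prod.ext ?_ ?_
    · simp [Sum.smul_inr]
    · simp [single_smul_funBasis, Sum.smul_inr]

/-- If `G` acts freely on `X` with `n` orbits, then `ℤ[X]` is free of rank `n` over `ℤ[G]`. -/
theorem mk_permModule_of_free {G X : Type u} [Group G] [Finite G] [MulAction G X] [Finite X]
    {n : ℕ} (r : Fin n → X) (hr : Function.Bijective fun p : (_ : Fin n) × G => p.2 • r p.1) :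
    mk (MonoidAlgebra ℤ G) (PermModule G X) =
      n • mk (MonoidAlgebra ℤ G) (MonoidAlgebra ℤ G) := by
  rw [← mk_fin_fun, eq_comm]
  refine mk_eq_mk_of_basis (Pi.basis fun _ => groupBasis G)
    (show Module.Basis X ℤ (PermModule G X) from groupBasis X) (Equiv.ofBijective _ hr)
    (fun g p => ?_) single_smul_permBasis (fun g p => mul_smul g p.2 (r p.1))
  obtain ⟨i, h⟩ := p
  classical
  rw [Sigma.smul_mk, Pi.basis_apply, Pi.basis_apply,
    ← Pi.single_smul]
  exact congrArg (Pi.single i) (single_smul_groupBasis g h)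

end Arakelov

/-! ### Characters and lattices of real vector spaces. -/

namespace Arakelov

open G0 Topology

section Characters

/-- Continuous characters of a real vector space are of the form `x ↦ exp (2πi ℓ(x))`. -/
theorem exists_linearMap_fourierChar {V : Type*} [NormedAddCommGroup V] [NormedSpace ℝ V]
    (f : V → Circle) (hf : Continuous f) (hadd : ∀ x y, f (x + y) = f x * f y) :
    ∃ ℓ : V →ₗ[ℝ] ℝ, ∀ x, f x = Real.fourierChar (ℓ x) := by
  have h0 : f 0 = 1 := by simpa using hadd 0 0
  -- A real vector space is simply connected, so `f` lifts through the covering `ℝ → Circle`,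
  -- uniquely once the value at `0` is fixed.
  obtain ⟨F, ⟨hF0, hF⟩, hu⟩ := Circle.isCoveringMap_exp.existsUnique_continuousMap_lifts
    ⟨f, hf⟩ 0 0 (by simp [h0])
  have hF' : ∀ x, Circle.exp (F x) = f x := congrFun hF
  have hFadd : ∀ x y, F (x + y) = F x + F y := by
    intro x y
    -- For fixed `y` this is another lift of `f` vanishing at `0`; uniqueness of the lift is
    -- additivity of `F`.
    have := hu (⟨fun z => F (z + y) - F y, by fun_prop⟩ : C(V, ℝ)) ⟨by simp, by
      funext z
      simp [Circle.exp_sub, hF', hadd]⟩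
    have := DFunLike.congr_fun this x
    exact sub_eq_iff_eq_add.1 this
  let L : V →ₗ[ℝ] ℝ := ((AddMonoidHom.mk' F hFadd).toRealLinearMap F.continuous).toLinearMap
  refine ⟨(2 * Real.pi)⁻¹ • L, fun x => ?_⟩
  rw [Real.fourierChar_apply', ← hF']
  congr 1
  change F x = 2 * Real.pi * ((2 * Real.pi)⁻¹ * F x)
  field_simp

/-- A free abelian group is projective, so the character lifts along the surjection `ℝ → Circle`.
The lift is not unique. -/
theorem exists_addMonoidHom_fourierChar {N : Type*} [AddCommGroup N] [Module.Free ℤ N]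
    (f : N → Circle) (hadd : ∀ x y, f (x + y) = f x * f y) :
    ∃ ν : N →+ ℝ, ∀ x, f x = Real.fourierChar (ν x) := by
  let f' : N →+ Additive Circle := AddMonoidHom.mk' (fun x => Additive.ofMul (f x)) hadd
  let c : ℝ →+ Additive Circle := Real.fourierChar.toAddMonoidHom
  have hc : Function.Surjective c := fun z => by
    obtain ⟨t, ht⟩ := Circle.exp_surjective (Additive.toMul z)
    refine ⟨(2 * Real.pi)⁻¹ * t, ?_⟩
    refine Eq.trans (Real.fourierChar_apply' _) ?_
    rw [← mul_assoc, mul_inv_cancel₀ (by positivity), one_mul]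
    exact ht
  obtain ⟨ν, hν⟩ := Module.projective_lifting_property c.toIntLinearMap f'.toIntLinearMap hc
  exact ⟨ν.toAddMonoidHom, fun x => (LinearMap.congr_fun hν x).symm⟩

theorem fourierChar_eq_one_iff {x : ℝ} : Real.fourierChar x = 1 ↔ ∃ n : ℤ, (n : ℝ) = x := by
  rw [Real.fourierChar_apply', Circle.exp_eq_one]
  have := Real.pi_pos
  refine exists_congr fun n => ⟨fun h => ?_, fun h => ?_⟩
  · field_simp at h
    exact h.symm
  · rw [← h]; ring

theorem linearMap_eq_zero_of_fourierChar_eq_one {V : Type*} [AddCommGroup V] [Module ℝ V]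
    (ℓ : V →ₗ[ℝ] ℝ) (h : ∀ x, Real.fourierChar (ℓ x) = 1) : ℓ = 0 := by
  ext x
  by_contra hx
  change ℓ x ≠ 0 at hx
  -- At this multiple of `x` the form takes the value `1 / 2`, which is not an integer.
  obtain ⟨n, hn⟩ := fourierChar_eq_one_iff.1 (h ((2 * ℓ x)⁻¹ • x))
  rw [map_smul, smul_eq_mul, mul_inv, mul_assoc, inv_mul_cancel₀ hx, mul_one] at hn
  have : (2 * n : ℝ) = 1 := by rw [hn]; norm_num
  norm_cast at this
  omega

end Characters

section Lattice

/-- An additive map on a lattice extends to a real linear form. -/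
theorem exists_linearMap_extension {V : Type*} [NormedAddCommGroup V] [NormedSpace ℝ V]
    [FiniteDimensional ℝ V] (L : AddSubgroup V) (hd : ∃ U ∈ 𝓝 (0 : V), ∀ x ∈ U, x ∈ L → x = 0)
    (hs : Submodule.span ℝ (L : Set V) = ⊤) (φ : L →+ ℝ) :
    ∃ ℓ : V →ₗ[ℝ] ℝ, ∀ x : L, ℓ x = φ x := by
  let L' : Submodule ℤ V := L.toIntSubmodule
  have : DiscreteTopology L' := by
    obtain ⟨U, hU, h⟩ := hd
    obtain ⟨W, hWU, hW, h0⟩ := mem_nhds_iff.1 hU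
    refine discreteTopology_of_isOpen_singleton_zero (isOpen_induced_iff.2 ⟨W, hW, ?_⟩)
    ext x
    exact ⟨fun hx => Subtype.ext (h x (hWU hx) x.2), fun hx => by
      rw [Set.mem_singleton_iff.1 hx]; exact h0⟩
  have : IsZLattice ℝ L' := ⟨hs⟩
  have := ZLattice.module_free ℝ L'
  -- A `ℤ`-basis of a full lattice is an `ℝ`-basis of the space, so `φ` may be prescribed on it.
  let b := Module.Free.chooseBasis ℤ L'
  let ℓ : V →ₗ[ℝ] ℝ := (b.ofZLatticeBasis ℝ L').constr ℝ fun i => φ (b i)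
  refine ⟨ℓ, fun x => ?_⟩
  have key : ℓ.toAddMonoidHom.toIntLinearMap ∘ₗ L'.subtype = (φ : L' →+ ℝ).toIntLinearMap := by
    refine b.ext fun i => ?_
    have : ℓ (b.ofZLatticeBasis ℝ L' i) = φ (b i) := Module.Basis.constr_basis _ _ _ _
    rw [Module.Basis.ofZLatticeBasis_apply] at this
    exact this
  exact LinearMap.congr_fun key x

end Lattice

/-! ### Real extensions of integral forms, and the characters they define. -/

section PontryaginDual

variable {G : Type u} [Group G] [Finite G]

/-- The value of an element of the dual module. -/
def dualEval {M : Type u} [AddCommGroup M] [Module (MonoidAlgebra ℤ G) M] (φ : Dual G M) :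
    M →+ ℤ := LinearMap.toAddMonoidHom (show M →ₗ[ℤ] ℤ from φ)

theorem dualEval_ext {M : Type u} [AddCommGroup M] [Module (MonoidAlgebra ℤ G) M]
    {φ ψ : Dual G M} (h : ∀ m, dualEval φ m = dualEval ψ m) : φ = ψ :=
  LinearMap.ext (f := (show M →ₗ[ℤ] ℤ from φ)) (g := (show M →ₗ[ℤ] ℤ from ψ)) h

theorem dualEval_smul {M : Type u} [AddCommGroup M] [Module (MonoidAlgebra ℤ G) M]
    (g : G) (φ : Dual G M) (m : M) :
    dualEval (MonoidAlgebra.single g (1 : ℤ) • φ) m =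
      dualEval φ (MonoidAlgebra.single g⁻¹ (1 : ℤ) • m) :=
  single_smul_dual_apply g φ m

theorem exists_dualEval_eq {M : Type u} [AddCommGroup M] [Module (MonoidAlgebra ℤ G) M]
    (f : M →+ ℤ) : ∃ φ : Dual G M, ∀ m, dualEval φ m = f m :=
  ⟨(f.toIntLinearMap : M →ₗ[ℤ] ℤ), fun _ => rfl⟩

variable {P : Type u} [CommGroup P] [TopologicalSpace P] [IsTopologicalGroup P]
  [MulDistribMulAction G P]
  {H : Type u} [NormedAddCommGroup H] [NormedSpace ℝ H] [FiniteDimensional ℝ H]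
  [Module (MonoidAlgebra ℤ G) H]
  {N : Type u} [AddCommGroup N] [Module (MonoidAlgebra ℤ G) N]
  [Module.Finite (MonoidAlgebra ℤ G) N] [Module.Free ℤ N]
  {e : H →ₗ[MonoidAlgebra ℤ G] GModule G P}
  {s : (H × N) →ₗ[MonoidAlgebra ℤ G] GModule G P}

/-- The pair `(ℓ, ν)` is a real extension of the integral form `φ` on `ker s`, and induces the
character `χ`. -/
structure IsRealExtension (s : (H × N) →ₗ[MonoidAlgebra ℤ G] GModule G P)
    (φ : Dual G (LinearMap.ker s)) (χ : PontryaginDual P) (ℓ : H →ₗ[ℝ] ℝ) (ν : N →+ ℝ) :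
    Prop where
  eval : ∀ z : LinearMap.ker s, ℓ z.1.1 + ν z.1.2 = dualEval φ z
  char : ∀ z, χ (gval (s z)) = Real.fourierChar (ℓ z.1 + ν z.2)

/-- The cokernel of `e` is killed by `k`, so `k • N` lies in the projection of `ker s`. Together
with the lattice `ker e` this says that `ker s` has full rank in `H × N`, which is what makes real
extensions exist and be unique. -/
theorem exists_mem_ker_of_torsion (hse : ∀ h, s (h, 0) = e h) {k : ℕ}
    (hk : ∀ p : P, ∃ h, gval (e h) = p ^ k) (n : N) : ∃ h, s (h, k • n) = 0 := by
  obtain ⟨h, hh⟩ := hk (gval (s (0, n)))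
  refine ⟨-h, ?_⟩
  have h₁ : s (h, 0) = k • s (0, n) := by
    rw [hse]
    exact gval_injective (hh.trans (gval_nsmul k _).symm)
  have h₂ : ((-h, k • n) : H × N) = k • (0, n) - (h, 0) := by simp
  rw [h₂, map_sub, map_nsmul, h₁, sub_self]

/-- Integral forms on `ker s` extend to real forms. -/
theorem exists_extension (hse : ∀ h, s (h, 0) = e h) {k : ℕ} (hk0 : k ≠ 0)
    (hk : ∀ p : P, ∃ h, gval (e h) = p ^ k)
    (hd : ∃ U ∈ 𝓝 (0 : H), ∀ h ∈ U, e h = 0 → h = 0)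
    (hspan : Submodule.span ℝ {h | e h = 0} = ⊤) (φ : LinearMap.ker s →+ ℝ) :
    ∃ (ℓ : H →ₗ[ℝ] ℝ) (ν : N →+ ℝ), ∀ z : LinearMap.ker s, ℓ z.1.1 + ν z.1.2 = φ z := by
  let ι : e.toAddMonoidHom.ker →+ LinearMap.ker s :=
    { toFun := fun x => ⟨(x, 0), (hse _).trans x.2⟩
      map_zero' := rfl
      map_add' := fun x y => Subtype.ext (by simp) }
  -- The lattice `ker e` determines `ℓ`. Then `φ - ℓ` on `ker s` depends only on the `N`-component,
  -- and `ν` is found by evaluating it above `k • n` and dividing by `k`.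
  obtain ⟨ℓ, hℓ⟩ := exists_linearMap_extension e.toAddMonoidHom.ker hd hspan (φ.comp ι)
  have key : ∀ z w : LinearMap.ker s, z.1.2 = w.1.2 → φ z - ℓ z.1.1 = φ w - ℓ w.1.1 := by
    intro z w hzw
    have hmem : e (z.1.1 - w.1.1) = 0 := by
      rw [← hse, ← (z - w).2]
      congr 1
      exact Prod.ext rfl (by simp [hzw])
    have h₁ := hℓ ⟨z.1.1 - w.1.1, hmem⟩
    have h₂ : ι ⟨z.1.1 - w.1.1, hmem⟩ = z - w :=
      Subtype.ext (Prod.ext rfl (by simp [ι, hzw]))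
    rw [AddMonoidHom.comp_apply, h₂, map_sub, map_sub] at h₁
    linarith
  choose t ht using fun n => exists_mem_ker_of_torsion (N := N) hse hk n
  let ψ : N → ℝ := fun n => φ ⟨(t n, k • n), ht n⟩ - ℓ (t n)
  have hk' : (k : ℝ) ≠ 0 := Nat.cast_ne_zero.2 hk0
  refine ⟨ℓ, AddMonoidHom.mk' (fun n => (k : ℝ)⁻¹ * ψ n) fun a b => ?_, fun z => ?_⟩
  · have := key ⟨(t (a + b), k • (a + b)), ht _⟩
      (⟨(t a, k • a), ht a⟩ + ⟨(t b, k • b), ht b⟩) (by simp)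
    rw [map_add] at this
    change φ _ - ℓ (t (a + b)) = φ _ + φ _ - ℓ (t a + t b) at this
    rw [map_add] at this
    rw [← mul_add]
    congr 1
    simp only [ψ]
    linarith
  · have := key ⟨(t z.1.2, k • z.1.2), ht _⟩ (k • z) rfl
    rw [map_nsmul] at this
    change φ _ - ℓ (t z.1.2) = k • φ z - ℓ (k • z.1.1) at this
    rw [map_nsmul] at this
    change ℓ z.1.1 + (k : ℝ)⁻¹ * ψ z.1.2 = φ z
    have h : ψ z.1.2 = k * (φ z - ℓ z.1.1) := by
      simp only [ψ]
      rw [this, nsmul_eq_mul, nsmul_eq_mul]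
      ring
    rw [h, inv_mul_cancel_left₀ hk']
    ring

/-- Uniqueness of real extensions: `ℓ` vanishes on a spanning set, then `k • ν = 0`, and `ℝ` has no
torsion. -/
theorem eq_zero_of_vanish_on_ker (hse : ∀ h, s (h, 0) = e h) {k : ℕ} (hk0 : k ≠ 0)
    (hk : ∀ p : P, ∃ h, gval (e h) = p ^ k)
    (hspan : Submodule.span ℝ {h | e h = 0} = ⊤) {ℓ : H →ₗ[ℝ] ℝ} {ν : N →+ ℝ}
    (h : ∀ z : LinearMap.ker s, ℓ z.1.1 + ν z.1.2 = 0) : ℓ = 0 ∧ ν = 0 := by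
  have hℓ : ℓ = 0 := LinearMap.ext_on hspan fun x hx => by
    have := h ⟨(x, 0), (hse x).trans hx⟩
    simpa using this
  refine ⟨hℓ, AddMonoidHom.ext fun n => ?_⟩
  obtain ⟨x, hx⟩ := exists_mem_ker_of_torsion hse hk n
  have := h ⟨(x, k • n), hx⟩
  rw [hℓ] at this
  simpa [hk0] using this

theorem exists_char_of_extension (hse : ∀ h, s (h, 0) = e h) (hs : Function.Surjective s)
    (hopen : ∀ U ∈ 𝓝 (0 : H), (fun h => gval (e h)) '' U ∈ 𝓝 (1 : P))
    (ℓ : H →ₗ[ℝ] ℝ) (ν : N →+ ℝ) (h : ∀ z : LinearMap.ker s, ∃ m : ℤ, m = ℓ z.1.1 + ν z.1.2) :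
    ∃ χ : PontryaginDual P, ∀ z, χ (gval (s z)) = Real.fourierChar (ℓ z.1 + ν z.2) := by
  let c : H × N → Circle := fun z => Real.fourierChar (ℓ z.1 + ν z.2)
  have hadd : ∀ z w, c (z + w) = c z * c w := fun z w => by
    simp only [c, Prod.fst_add, Prod.snd_add, map_add, ← AddChar.map_add_eq_mul]
    congr 1
    ring
  -- Integrality on `ker s` makes `c` trivial there, so it descends along `s`.
  have hker : ∀ z w, s z = s w → c z = c w := fun z w hzw => by
    have h₁ : c (z - w) = 1 :=
      fourierChar_eq_one_iff.2 (h ⟨z - w, by rw [LinearMap.mem_ker, map_sub, hzw, sub_self]⟩)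
    rw [← sub_add_cancel z w, hadd, h₁, one_mul]
  choose r hr using hs
  let χ₀ : P →* Circle := MonoidHom.mk' (fun p => c (r (gmk G p))) fun p q => by
    rw [← hadd]
    exact hker _ _ (by rw [map_add, hr, hr, hr, gmk_mul])
  have hχ : ∀ z, χ₀ (gval (s z)) = c z := fun z => hker _ _ (by rw [hr, gmk_gval])
  have hcont : Continuous χ₀ := by
    -- Continuity need only be checked at the identity, where images under `e` of neighbourhoods of
    -- `0` are neighbourhoods and `χ₀ ∘ e` is a continuous function on `H`.
    refine continuous_of_continuousAt_one χ₀ ?_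
    rw [ContinuousAt, map_one]
    intro W hW
    have hc : Continuous fun x : H => c (x, 0) :=
      Real.continuous_fourierChar.comp
        ((ℓ.continuous_of_finiteDimensional).add (continuous_const (y := ν 0)))
    have hc0 : c (0, 0) = 1 := by simp [c]
    have hU : (fun x : H => c (x, 0)) ⁻¹' W ∈ 𝓝 (0 : H) :=
      hc.continuousAt.preimage_mem_nhds (by rwa [hc0])
    refine Filter.mem_map.2 (Filter.mem_of_superset (hopen _ hU) ?_)
    rintro _ ⟨x, hx, rfl⟩
    change χ₀ (gval (e x)) ∈ W
    rw [← hse, hχ]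
    exact hx
  exact ⟨⟨χ₀, hcont⟩, hχ⟩

/-- The two factors are treated separately: continuity produces the linear form on `H`, and freeness
of `N` the additive map on `N`. -/
theorem exists_extension_of_char (hse : ∀ h, s (h, 0) = e h)
    (hcont : Continuous fun h => gval (e h)) (χ : PontryaginDual P) :
    ∃ (ℓ : H →ₗ[ℝ] ℝ) (ν : N →+ ℝ),
      ∀ z, χ (gval (s z)) = Real.fourierChar (ℓ z.1 + ν z.2) := by
  obtain ⟨ℓ, hℓ⟩ := exists_linearMap_fourierChar (fun h => χ (gval (e h)))
    (χ.continuous_toFun.comp hcont) fun x y => by rw [map_add, gval_add, map_mul]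
  obtain ⟨ν, hν⟩ := exists_addMonoidHom_fourierChar (fun n : N => χ (gval (s (0, n))))
    fun x y => by rw [← map_mul, ← gval_add, ← map_add]; simp
  refine ⟨ℓ, ν, fun z => ?_⟩
  rw [AddChar.map_add_eq_mul, ← hℓ, ← hν, ← hse, ← map_mul, ← gval_add, ← map_add]
  simp

end PontryaginDual

end Arakelov

namespace Arakelov

open G0 Topology

section PontryaginDual

variable {G : Type u} [Group G] [Finite G]
  {P : Type u} [CommGroup P] [TopologicalSpace P] [IsTopologicalGroup P]
  [MulDistribMulAction G P] [ContinuousConstSMul G P]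
  {H : Type u} [NormedAddCommGroup H] [NormedSpace ℝ H] [FiniteDimensional ℝ H]
  [Module (MonoidAlgebra ℤ G) H]

/-- Precomposing with `g⁻¹` gives a real extension for the translated data. With uniqueness of
extensions this makes the passage from forms to characters equivariant. -/
theorem IsRealExtension.smul {N : Type u} [AddCommGroup N] [Module (MonoidAlgebra ℤ G) N]
    {s : (H × N) →ₗ[MonoidAlgebra ℤ G] GModule G P}
    (hG : ∀ g : G, ∃ L : H →ₗ[ℝ] H, ∀ h, MonoidAlgebra.single g (1 : ℤ) • h = L h)
    {φ : Dual G (LinearMap.ker s)} {χ : PontryaginDual P} {ℓ : H →ₗ[ℝ] ℝ} {ν : N →+ ℝ}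
    (h : IsRealExtension s φ χ ℓ ν) (g : G) :
    ∃ ℓ' ν', IsRealExtension s (MonoidAlgebra.single g (1 : ℤ) • φ) (g • χ) ℓ' ν' := by
  obtain ⟨L, hL⟩ := hG g⁻¹
  refine ⟨ℓ ∘ₗ L, ν.comp (DistribSMul.toAddMonoidHom N (MonoidAlgebra.single g⁻¹ (1 : ℤ))),
    ⟨fun z => ?_, fun z => ?_⟩⟩
  · rw [dualEval_smul, ← h.eval, LinearMap.comp_apply, ← hL]
    rfl
  · rw [smul_pontryaginDual_apply, ← gval_smul, ← map_smul, h.char, LinearMap.comp_apply, ← hL]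
    rfl

/-- If a compact abelian Lie group `P` with an action of `G` is given by a homomorphism
`e : H → P` from a real vector space, then the class of its Pontryagin dual is determined by the
index of `e`. -/
theorem mk_pontryaginDual
    (hG : ∀ g : G, ∃ L : H →ₗ[ℝ] H, ∀ h, MonoidAlgebra.single g (1 : ℤ) • h = L h)
    (e : H →ₗ[MonoidAlgebra ℤ G] GModule G P) (hcont : Continuous fun h => gval (e h))
    (hopen : ∀ U ∈ 𝓝 (0 : H), (fun h => gval (e h)) '' U ∈ 𝓝 (1 : P))
    (hd : ∃ U ∈ 𝓝 (0 : H), ∀ h ∈ U, e h = 0 → h = 0)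
    (hspan : Submodule.span ℝ {h | e h = 0} = ⊤) {k : ℕ} (hk0 : k ≠ 0)
    (hk : ∀ p : P, ∃ h, gval (e h) = p ^ k) {x : G0 (MonoidAlgebra ℤ G)} (hx : HasIndex e x) :
    ∃ _ : Module.Finite (MonoidAlgebra ℤ G) (GModule G (PontryaginDual P)),
      mk (MonoidAlgebra ℤ G) (GModule G (PontryaginDual P)) = -sigma G x := by
  obtain ⟨hK, hC, rfl⟩ := hx
  -- The group `P` need not be connected: a free module mapping onto `coker e` supplies the missing
  -- components.
  obtain ⟨m, π, hπ⟩ := Module.Finite.exists_fin' (MonoidAlgebra ℤ G)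
    (GModule G P ⧸ LinearMap.range e)
  obtain ⟨c, hc⟩ := Module.projective_lifting_property (LinearMap.range e).mkQ π
    (Submodule.mkQ_surjective _)
  have hc' : ∀ n, Submodule.Quotient.mk (c n) = π n := fun n => LinearMap.congr_fun hc n
  let N := Fin m → MonoidAlgebra ℤ G
  let s : (H × N) →ₗ[MonoidAlgebra ℤ G] GModule G P := e.coprod c
  have hse : ∀ h, s (h, 0) = e h := fun h => by simp [s]
  have hs : Function.Surjective s := by
    intro p
    obtain ⟨n, hn⟩ := hπ (Submodule.Quotient.mk p)
    rw [← hc'] at hn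
    obtain ⟨h, hh⟩ := (Submodule.Quotient.eq _).1 hn
    refine ⟨(-h, n), ?_⟩
    simp [s, hh]
  let snd : LinearMap.ker s →ₗ[MonoidAlgebra ℤ G] N :=
    LinearMap.snd _ _ _ ∘ₗ (LinearMap.ker s).subtype
  let fst : LinearMap.ker e →ₗ[MonoidAlgebra ℤ G] LinearMap.ker s :=
    (LinearMap.inl _ _ _ ∘ₗ (LinearMap.ker e).subtype).codRestrict _ fun h => (hse _).trans h.2
  have hfst : Function.Injective fst := fun a b h =>
    Subtype.ext (congrArg (fun z : LinearMap.ker s => z.1.1) h)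
  have hfs : Function.Exact fst snd := by
    rintro ⟨⟨h, n⟩, hz⟩
    constructor
    · intro hn
      obtain rfl : n = 0 := hn
      exact ⟨⟨h, (hse h).symm.trans hz⟩, rfl⟩
    · rintro ⟨h', hh'⟩
      rw [← hh']
      rfl
  have hsπ : Function.Exact snd π := by
    intro n
    rw [← hc']
    constructor
    · intro hn
      obtain ⟨h, hh⟩ := (Submodule.Quotient.mk_eq_zero _).1 hn
      exact ⟨⟨(-h, n), by simp [s, hh]⟩, rfl⟩
    · rintro ⟨⟨⟨h, n⟩, hz⟩, rfl⟩
      refine (Submodule.Quotient.mk_eq_zero _).2 ⟨-h, ?_⟩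
      have : e h + c n = 0 := by simpa [s] using hz
      rw [map_neg]
      exact neg_eq_of_add_eq_zero_right this
  have hfin : IsNoetherian (MonoidAlgebra ℤ G) (LinearMap.ker s) :=
    isNoetherian_of_range_eq_ker fst snd hfs.linearMap_ker_eq.symm
  have hZ := finite_int (G := G) (LinearMap.ker s)
  -- The module `ker s` is finitely generated, being an extension of a submodule of `N` by `ker e`,
  -- and torsion-free as a submodule of `H × N`. It is therefore a lattice, and `σ` is computed on
  -- it by the honest dual.
  have : IsAddTorsionFree H := .of_isTorsionFree ℝ H
  have : Module.IsTorsionFree ℤ (H × N) := inferInstance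
  have : Module.IsTorsionFree ℤ (LinearMap.ker s) :=
    Function.Injective.moduleIsTorsionFree ((LinearMap.ker s).subtype) Subtype.val_injective
      (fun n x => map_zsmul _ n x)
  have hfree : Module.Free ℤ (LinearMap.ker s) := inferInstance
  have hex : ∀ φ : Dual G (LinearMap.ker s), ∃ χ ℓ ν, IsRealExtension s φ χ ℓ ν := by
    intro φ
    obtain ⟨ℓ, ν, h⟩ := exists_extension hse hk0 hk hd hspan
      ((Int.castAddHom ℝ).comp (dualEval φ))
    obtain ⟨χ, hχ⟩ := exists_char_of_extension hse hs hopen ℓ ν fun z => ⟨_, (h z).symm⟩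
    exact ⟨χ, ℓ, ν, h, hχ⟩
  have huniq : ∀ {φ χ χ' ℓ ℓ' ν ν'}, IsRealExtension s φ χ ℓ ν → IsRealExtension s φ χ' ℓ' ν' →
      χ = χ' ∧ ℓ = ℓ' ∧ ν = ν' := by
    intro φ χ χ' ℓ ℓ' ν ν' h h'
    obtain ⟨h₁, h₂⟩ := eq_zero_of_vanish_on_ker (ℓ := ℓ - ℓ') (ν := ν - ν') hse hk0 hk hspan
      fun z => by
        have h₁ := h.eval z
        have h₂ := h'.eval z
        rw [LinearMap.sub_apply, AddMonoidHom.sub_apply]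
        linarith
    rw [sub_eq_zero] at h₁ h₂
    refine ⟨?_, h₁, h₂⟩
    ext p
    obtain ⟨z, hz⟩ := hs (gmk G p)
    have := (h.char z).trans ((h₁ ▸ h₂ ▸ h'.char z :) : _).symm
    rw [hz] at this
    exact congrArg _ this
  choose χ ℓ ν hχ using hex
  have hadd : ∀ {φ φ' χ χ' ℓ ℓ' ν ν'}, IsRealExtension s φ χ ℓ ν →
      IsRealExtension s φ' χ' ℓ' ν' → IsRealExtension s (φ + φ') (χ * χ') (ℓ + ℓ') (ν + ν') := by
    intro φ φ' χ χ' ℓ ℓ' ν ν' h h'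
    refine ⟨fun z => ?_, fun z => ?_⟩
    · have h₁ := h.eval z
      have h₂ := h'.eval z
      have h₃ : dualEval (φ + φ') z = dualEval φ z + dualEval φ' z := rfl
      rw [LinearMap.add_apply, AddMonoidHom.add_apply, h₃, Int.cast_add]
      linarith
    · have : (χ * χ') (gval (s z)) = χ (gval (s z)) * χ' (gval (s z)) := rfl
      rw [this, h.char, h'.char, ← AddChar.map_add_eq_mul, LinearMap.add_apply,
        AddMonoidHom.add_apply]
      congr 1
      ring
  -- The chosen character depends only on `φ`, since real extensions are unique and `s` is onto;
  -- this yields additivity and equivariance at once.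
  let τ : Dual G (LinearMap.ker s) →ₗ[MonoidAlgebra ℤ G] GModule G (PontryaginDual P) :=
    linearOfComm (V := Dual G (LinearMap.ker s)) (W := GModule G (PontryaginDual P))
      (AddMonoidHom.mk' (fun φ => gmk G (χ φ)) fun φ φ' => by
        rw [← gmk_mul, (huniq (hadd (hχ φ) (hχ φ')) (hχ (φ + φ'))).1]) <| by
      intro g φ
      obtain ⟨ℓ', ν', h⟩ := (hχ φ).smul hG g
      apply gval_injective
      rw [gval_smul]
      exact (huniq (hχ _) h).1
  have hτ : ∀ φ, gval (τ φ) = χ φ := fun φ => rfl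
  have hτs : Function.Surjective τ := by
    intro ξ
    obtain ⟨ℓ', ν', h⟩ := exists_extension_of_char hse hcont (gval ξ)
    -- The pulled-back character is trivial on `ker s`, so its real form is integral there and comes
    -- from some `φ`.
    have hint : ∀ z : LinearMap.ker s, ∃ n : ℤ, (n : ℝ) = ℓ' z.1.1 + ν' z.1.2 := fun z => by
      refine fourierChar_eq_one_iff.1 ?_
      rw [← h, z.2, gval_zero, map_one]
    choose f hf using hint
    obtain ⟨φ, hφ⟩ := exists_dualEval_eq (G := G) (M := LinearMap.ker s)
      (AddMonoidHom.mk' f fun a b => by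
        have h₁ := hf (a + b)
        have h₂ := hf a
        have h₃ := hf b
        rw [Submodule.coe_add, Prod.fst_add, Prod.snd_add, map_add, map_add] at h₁
        have : (f (a + b) : ℝ) = ((f a + f b : ℤ) : ℝ) := by push_cast; linarith
        exact_mod_cast this)
    refine ⟨φ, gval_injective ?_⟩
    rw [hτ]
    exact (huniq (hχ φ) ⟨fun z => by rw [hφ, ← hf]; rfl, h⟩).1
  -- The projection of `ker s` contains `k • N`, and a form on `N` is determined by its values
  -- there.
  have hδi : Function.Injective (dualMap snd) := by
    intro φ φ' h
    refine dualEval_ext fun n => ?_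
    obtain ⟨x, hx⟩ := exists_mem_ker_of_torsion hse hk n
    have h₁ : dualEval φ (k • n) = dualEval φ' (k • n) :=
      DFunLike.congr_fun (congrArg dualEval h) (⟨(x, k • n), hx⟩ : LinearMap.ker s)
    rw [map_nsmul, map_nsmul] at h₁
    exact smul_right_injective ℤ hk0 h₁
  -- The character is trivial exactly when `ℓ = 0` and `ν` is integer-valued, that is, when `φ`
  -- factors through the projection to `N`.
  have hδτ : Function.Exact (dualMap snd) τ := by
    intro φ
    have hφ := hχ φ
    constructor
    · intro h
      have h' : χ φ = 1 := h
      rw [h'] at hφ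
      have hchar : ∀ z : H × N, Real.fourierChar ((ℓ φ) z.1 + (ν φ) z.2) = 1 := fun z =>
        (hφ.char z).symm
      have hℓ : ℓ φ = 0 := linearMap_eq_zero_of_fourierChar_eq_one _ fun h => by
        simpa using hchar (h, 0)
      have hint : ∀ n : N, ∃ a : ℤ, (a : ℝ) = ν φ n := fun n =>
        fourierChar_eq_one_iff.1 (by simpa using hchar (0, n))
      choose f hf using hint
      obtain ⟨ψ, hψ⟩ := exists_dualEval_eq (G := G) (M := N)
        (AddMonoidHom.mk' f fun a b => by
          have : (f (a + b) : ℝ) = ((f a + f b : ℤ) : ℝ) := by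
            push_cast
            rw [hf, hf, hf, map_add]
          exact_mod_cast this)
      refine ⟨ψ, dualEval_ext fun z => ?_⟩
      have h₁ : dualEval (dualMap snd ψ) z = f z.1.2 := hψ _
      have h₂ := hφ.eval z
      rw [hℓ, LinearMap.zero_apply, zero_add, ← hf] at h₂
      rw [h₁]
      exact_mod_cast h₂
    · rintro ⟨ψ, rfl⟩
      refine gval_eq_one.1 ?_
      rw [hτ]
      refine (huniq hφ (ℓ' := 0) (ν' := (Int.castAddHom ℝ).comp (dualEval ψ)) (χ' := 1)
        ⟨fun z => ?_, fun z => ?_⟩).1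
      · rw [LinearMap.zero_apply, zero_add]
        rfl
      · rw [LinearMap.zero_apply, zero_add]
        exact (fourierChar_eq_one_iff.2 ⟨_, rfl⟩).symm
  have hfinD : Module.Finite (MonoidAlgebra ℤ G) (GModule G (PontryaginDual P)) :=
    Module.Finite.of_surjective τ hτs
  refine ⟨hfinD, ?_⟩
  have e₁ := mk_eq_add (dualMap snd) τ hδi hδτ hτs
  rw [← sigma_mk, ← sigma_mk] at e₁
  -- The index of `ker s → N` is computed twice: from its kernel and cokernel, which are those of
  -- `e`, and from its finitely generated source and target.
  have e₂ := (HasIndex.of_exact hfst hfs hsπ hπ)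
  rw [e₂.unique (HasIndex.of_finite snd), map_sub, e₁]
  abel

end PontryaginDual

end Arakelov

/-! ### Extending fractional ideals to a ring of `T`-integers. -/

namespace FractionalIdeal

open IsDedekindDomain

section Extended

variable {R K B : Type*} [CommRing R] [IsDomain R] [Field K] [Algebra R K] [IsFractionRing R K]
  [CommRing B] [IsDomain B] [Algebra R B] [Module.IsTorsionFree R B] [Algebra B K]
  [IsFractionRing B K] [IsScalarTower R B K]

/-- Both rings have the same fraction field, so the map `K → K` induced by `R → B` is the identity
and no twist remains. -/
theorem coe_extendedHom_overring (I : FractionalIdeal R⁰ K) :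
    (extendedHom K B I : Submodule B K) = Submodule.span B (I : Set K) := by
  rw [extendedHom'_apply, coe_extended_eq_span]
  congr 1
  rw [← Set.image_id (I : Set K), Set.image_image]
  refine Set.image_congr fun x _ => ?_
  have : IsLocalization.map K (algebraMap R B)
      (nonZeroDivisors_le_comap_nonZeroDivisors_of_injective _
        (FaithfulSMul.algebraMap_injective R B)) = RingHom.id K :=
    IsLocalization.ringHom_ext R⁰ (by
      ext r
      simp [← IsScalarTower.algebraMap_apply])
  exact RingHom.congr_fun this x

theorem mem_extendedHom_overring {I : FractionalIdeal R⁰ K} {x : K} (hx : x ∈ I) :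
    x ∈ extendedHom K B I := by
  rw [← mem_coe, coe_extendedHom_overring]
  exact Submodule.subset_span hx

theorem extendedHom_overring_le {I : FractionalIdeal R⁰ K} {J : FractionalIdeal B⁰ K}
    (h : ∀ x ∈ I, x ∈ J) : extendedHom K B I ≤ J := by
  rw [← coe_le_coe, coe_extendedHom_overring, Submodule.span_le]
  exact h

theorem extendedHom_overring_spanSingleton (x : K) :
    extendedHom K B (spanSingleton R⁰ x) = spanSingleton B⁰ x := by
  refine le_antisymm (extendedHom_overring_le fun y hy => ?_) ?_
  · obtain ⟨r, rfl⟩ := (mem_spanSingleton _).1 hy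
    exact (mem_spanSingleton _).2 ⟨algebraMap R B r, by rw [algebraMap_smul]⟩
  · exact spanSingleton_le_iff_mem.2 (mem_extendedHom_overring (mem_spanSingleton_self _ x))

theorem mem_one_overring {x : K} : x ∈ (1 : FractionalIdeal B⁰ K) ↔ x ∈ (algebraMap B K).range :=
  mem_one_iff _

end Extended

section Count

variable {R K : Type*} [CommRing R] [IsDedekindDomain R] [Field K] [Algebra R K]
  [IsFractionRing R K]

/-- Write `I = a⁻¹ J` with `J` integral, and let `m` be the exponent of `v` in `a`. The valuation
bound forces every element of `J` into the `m`-th power of `v`, so the exponent of `v` in `J` is at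
least `m`. -/
theorem count_nonneg_of_valuation_le_one (v : HeightOneSpectrum R) {I : FractionalIdeal R⁰ K}
    (hI : I ≠ 0) (h : ∀ x ∈ I, v.valuation K x ≤ 1) : 0 ≤ count K v I := by
  classical
  obtain ⟨a, J, ha, hJ⟩ := exists_eq_spanSingleton_mul I
  have ha' : algebraMap R K a ≠ 0 := (map_ne_zero_iff _ (IsFractionRing.injective R K)).2 ha
  have hJ0 : J ≠ 0 := by
    rintro rfl
    exact hI (by rw [hJ]; simp)
  set m := (Associates.mk v.asIdeal).count (Associates.mk (Ideal.span {a})).factors with hm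
  have hle : J ≤ v.asIdeal ^ m := by
    intro b hb
    rw [← HeightOneSpectrum.intValuation_le_pow_iff_mem]
    have hx : (algebraMap R K a)⁻¹ * algebraMap R K b ∈ I := by
      rw [hJ]
      exact mul_mem_mul (mem_spanSingleton_self _ _) (mem_coeIdeal_of_mem _ hb)
    have := h _ hx
    rw [map_mul, map_inv₀, HeightOneSpectrum.valuation_of_algebraMap,
      HeightOneSpectrum.valuation_of_algebraMap, v.intValuation_if_neg ha, ← hm,
      inv_mul_le_iff₀ (by simp), mul_one] at this
    exact this
  have h₁ := count_mono K v (I := (J : FractionalIdeal R⁰ K)) (J := (v.asIdeal ^ m : Ideal R))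
    (by simpa using hJ0) (by simpa using hle)
  rw [coeIdeal_pow, count_pow_self, count_coe K v hJ0] at h₁
  rw [count_well_defined K v hI hJ, ← hm]
  omega

theorem eq_one_of_count_eq_zero {I : FractionalIdeal R⁰ K} (hI : I ≠ 0)
    (h : ∀ v, count K v I = 0) : I = 1 := by
  rw [← finprod_heightOneSpectrum_factorization' K hI]
  simp [h]

/-- Take `b` in `v` but not in `w`: then `b x` is integral and `b` is a unit at `w`. -/
theorem valuation_le_one_of_mem_inv {v w : HeightOneSpectrum R} (hvw : w ≠ v) {x : K}
    (hx : x ∈ (v.asIdeal : FractionalIdeal R⁰ K)⁻¹) : w.valuation K x ≤ 1 := by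
  obtain ⟨b, hbv, hbw⟩ : ∃ b ∈ v.asIdeal, b ∉ w.asIdeal := by
    by_contra! h
    exact hvw (HeightOneSpectrum.ext
      ((v.isMaximal.eq_of_le w.isPrime.ne_top h).symm))
  have h₁ := (mem_inv_iff (coeIdeal_ne_zero.2 v.ne_bot)).1 hx (algebraMap R K b)
    (mem_coeIdeal_of_mem _ hbv)
  obtain ⟨r, hr⟩ := (mem_one_iff _).1 h₁
  have h₂ : w.valuation K (algebraMap R K r) ≤ 1 := w.valuation_le_one r
  have h₃ : w.valuation K (algebraMap R K b) = 1 := by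
    rw [HeightOneSpectrum.valuation_of_algebraMap]
    exact (HeightOneSpectrum.intValuation_eq_one_iff).2 hbw
  rwa [hr, map_mul, h₃, mul_one] at h₂

variable {B : Type*} [CommRing B] [IsDomain B] [Algebra R B] [Module.IsTorsionFree R B]
  [Algebra B K] [IsFractionRing B K] [IsScalarTower R B K]

/-- A finite set of generators of the ideal over `B` already generates a fractional ideal over `R`,
whose extension is the given one. -/
theorem units_map_extendedHom_surjective :
    Function.Surjective (Units.map
      (extendedHom K B : FractionalIdeal R⁰ K →+* FractionalIdeal B⁰ K).toMonoidHom) := by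
  intro J
  obtain ⟨t, ht⟩ := fg_unit J
  let I : FractionalIdeal R⁰ K := ⟨Submodule.span R (t : Set K),
    isFractional_of_fg ⟨t, rfl⟩⟩
  have hI : extendedHom K B I = J := by
    refine le_antisymm (extendedHom_overring_le fun x hx => ?_) ?_
    · have : Submodule.span R (t : Set K) ≤ ((J : FractionalIdeal B⁰ K) : Submodule B K).restrictScalars R := by
        rw [Submodule.span_le, ← ht]
        exact Submodule.subset_span
      exact this hx
    · rw [← coe_le_coe, ← ht, Submodule.span_le]
      intro x hx
      exact mem_extendedHom_overring (Submodule.subset_span hx : x ∈ Submodule.span R (t : Set K))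
  have hI0 : I ≠ 0 := by
    rintro h
    rw [h, map_zero] at hI
    exact J.ne_zero hI.symm
  exact ⟨Units.mk0 I hI0, Units.ext hI⟩

/-- The primes outside `T` do not divide a fractional ideal that generates the unit ideal of the
ring of `T`-integers. -/
theorem count_eq_zero_of_extendedHom_eq_one {T : Set (HeightOneSpectrum R)}
    (hB : ∀ x : K, x ∈ (algebraMap B K).range ↔ ∀ v ∉ T, v.valuation K x ≤ 1)
    {I : FractionalIdeal R⁰ K} (h : extendedHom K B I = 1) {v : HeightOneSpectrum R}
    (hv : v ∉ T) : count K v I = 0 := by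
  have hI : I ≠ 0 := by
    rintro rfl
    simp at h
  -- The elements of such an ideal are `T`-integers, so its exponent at `v` is nonnegative. The
  -- condition is stable under inversion, so the exponent is also nonpositive.
  have key : ∀ J : FractionalIdeal R⁰ K, J ≠ 0 → extendedHom K B J = 1 → 0 ≤ count K v J := by
    intro J hJ0 hJ
    refine count_nonneg_of_valuation_le_one v hJ0 fun x hx => ?_
    refine (hB x).1 (mem_one_overring.1 ?_) v hv
    rw [← hJ]
    exact mem_extendedHom_overring hx
  have h₁ := key I hI h
  have h₂ := key I⁻¹ (inv_ne_zero hI) (by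
    have := congrArg (extendedHom K B) (mul_inv_cancel₀ hI)
    rwa [map_mul, h, one_mul, map_one] at this)
  rw [count_inv] at h₂
  omega

/-- The elements of `v` and of `v⁻¹` are all `T`-integers, so both extensions are contained in `1`;
their product is `1`, which forces equality. -/
theorem extendedHom_eq_one_of_mem {T : Set (HeightOneSpectrum R)}
    (hB : ∀ x : K, x ∈ (algebraMap B K).range ↔ ∀ v ∉ T, v.valuation K x ≤ 1)
    {v : HeightOneSpectrum R} (hv : v ∈ T) :
    extendedHom K B (v.asIdeal : FractionalIdeal R⁰ K) = 1 := by
  have h₀ : (v.asIdeal : FractionalIdeal R⁰ K) ≠ 0 := coeIdeal_ne_zero.2 v.ne_bot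
  have h₁ : extendedHom K B (v.asIdeal : FractionalIdeal R⁰ K) ≤ 1 := by
    refine extendedHom_overring_le fun x hx => mem_one_overring.2 ?_
    obtain ⟨r, -, rfl⟩ := (mem_coeIdeal _).1 hx
    exact ⟨algebraMap R B r, (IsScalarTower.algebraMap_apply R B K r).symm⟩
  have h₂ : extendedHom K B (v.asIdeal : FractionalIdeal R⁰ K)⁻¹ ≤ 1 :=
    extendedHom_overring_le fun x hx => mem_one_overring.2 ((hB x).2 fun w hw =>
      valuation_le_one_of_mem_inv (fun h : w = v => hw (h.symm ▸ hv)) hx)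
  refine le_antisymm h₁ ?_
  have := congrArg (extendedHom K B) (mul_inv_cancel₀ h₀)
  rw [map_mul, map_one] at this
  rw [← this]
  exact (mul_le_mul_right h₂ _).trans (mul_one _).le

end Count

end FractionalIdeal

namespace FractionalIdeal

section MapEquiv

variable {R R' K K' : Type*} [CommRing R] [IsDomain R] [CommRing R'] [IsDomain R'] [Field K]
  [Field K'] [Algebra R K] [Algebra R' K'] [IsFractionRing R K] [IsFractionRing R' K']

theorem mem_ringEquivOfRingEquiv (e : R ≃+* R') (I : FractionalIdeal R⁰ K) (x : K') :
    x ∈ ringEquivOfRingEquiv K K' e I ↔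
      ∃ y ∈ I, IsFractionRing.ringEquivOfRingEquiv (K := K) (L := K') e y = x :=
  Iff.rfl

theorem canonicalEquiv_eq_ringEquivOfRingEquiv (K₂ : Type*) [Field K₂] [Algebra R K₂]
    [IsFractionRing R K₂] (I : FractionalIdeal R⁰ K) :
    canonicalEquiv R⁰ K K₂ I = ringEquivOfRingEquiv K K₂ (RingEquiv.refl R) I := by
  ext x
  rw [mem_canonicalEquiv_apply, mem_ringEquivOfRingEquiv]
  have key : ∀ (h : R⁰ ≤ Submonoid.comap (RingHom.id R) R⁰) (y : K),
      IsLocalization.map K₂ (RingHom.id R) h y =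
        IsFractionRing.ringEquivOfRingEquiv (K := K) (L := K₂) (RingEquiv.refl R) y := by
    intro h y
    refine RingHom.congr_fun (g := (IsFractionRing.ringEquivOfRingEquiv (K := K) (L := K₂)
      (RingEquiv.refl R)).toRingHom) (IsLocalization.ringHom_ext R⁰ (RingHom.ext fun r => ?_)) y
    refine (IsLocalization.map_eq h r).trans ?_
    exact (IsFractionRing.ringEquivOfRingEquiv_algebraMap (RingEquiv.refl R) r).symm
  exact exists_congr fun y => and_congr_right fun _ => Iff.of_eq (congrArg (· = x) (key _ y))

/-- The action on the class group is defined through `FractionRing`, while the ideals here live in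
`F`; this moves the formula to arbitrary fraction fields. -/
theorem classGroup_mulEquiv_mk (e : R ≃+* R') (I : (FractionalIdeal R⁰ K)ˣ) :
    ClassGroup.mulEquiv e (ClassGroup.mk K I) =
      ClassGroup.mk K' (Units.mapEquiv (ringEquivOfRingEquiv K K' e).toMulEquiv I) := by
  rw [← ClassGroup.mk_canonicalEquiv (K' := FractionRing R) (I := I),
    Arakelov.classGroup_mulEquiv_mk, ← ClassGroup.mk_canonicalEquiv (K := K') (K' := FractionRing R')]
  refine congrArg _ (Units.ext ?_)
  change ringEquivOfRingEquiv _ _ e (canonicalEquiv R⁰ K (FractionRing R) I) =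
    canonicalEquiv R'⁰ K' (FractionRing R') (ringEquivOfRingEquiv K K' e I)
  rw [canonicalEquiv_eq_ringEquivOfRingEquiv, canonicalEquiv_eq_ringEquivOfRingEquiv,
    ← ringEquivOfRingEquiv_trans_apply, ← ringEquivOfRingEquiv_trans_apply]
  rfl

end MapEquiv

end FractionalIdeal

/-! ### Fractional ideals supported in `S`, and the `S`-class group. -/

namespace Arakelov

open IsDedekindDomain NumberField G0 FractionalIdeal

variable {K : Type v} {F : Type u} [Field K] [Field F] [Algebra K F] [NumberField F]

section FracIdeals

/-- The subset of primes in a `G`-stable set of places. -/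
def finPart (S : SubMulAction Gal(F/K) (Place F)) :
    SubMulAction Gal(F/K) (HeightOneSpectrum (𝓞 F)) where
  carrier := {v | (Sum.inr v : Place F) ∈ S}
  smul_mem' g _ hv := S.smul_mem g hv

instance (S : SubMulAction Gal(F/K) (Place F)) [Finite S] : Finite (finPart S) :=
  Finite.of_injective (fun v => (⟨Sum.inr v.1, v.2⟩ : S)) fun _ _ h =>
    Subtype.ext (Sum.inr_injective (congrArg Subtype.val h))

/-- A prime as a fractional ideal. -/
noncomputable def primeIdeal (v : HeightOneSpectrum (𝓞 F)) : FracIdeals F :=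
  Units.mk0 (v.asIdeal : FractionalIdeal (𝓞 F)⁰ F) (coeIdeal_ne_zero.2 v.ne_bot)

theorem smul_primeIdeal (g : Gal(F/K)) (v : HeightOneSpectrum (𝓞 F)) :
    g • primeIdeal v = primeIdeal (g • v) := by
  refine Units.ext (FractionalIdeal.ext fun x => ?_)
  refine (mem_smul_fracIdeal g (primeIdeal v) x).trans ?_
  change (∃ y ∈ (v.asIdeal : FractionalIdeal (𝓞 F)⁰ F), g y = x) ↔
    x ∈ ((g • v).asIdeal : FractionalIdeal (𝓞 F)⁰ F)
  simp only [mem_coeIdeal]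
  constructor
  · rintro ⟨_, ⟨a, ha, rfl⟩, rfl⟩
    exact ⟨g • a, by rwa [mem_smul_asIdeal, inv_smul_smul], rfl⟩
  · rintro ⟨a, ha, rfl⟩
    refine ⟨_, ⟨g⁻¹ • a, ha, rfl⟩, ?_⟩
    change algebraMap (𝓞 F) F (g • g⁻¹ • a) = _
    rw [smul_inv_smul]

variable (S : SubMulAction Gal(F/K) (Place F))

/-- The fractional ideals supported in `S`. -/
noncomputable def supportedHom [Fintype (finPart S)] :
    FunModule Gal(F/K) (finPart S) ℤ →ₗ[MonoidAlgebra ℤ Gal(F/K)]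
      GModule Gal(F/K) (FracIdeals F) :=
  linearOfComm (AddMonoidHom.mk' (fun n => gmk _ (∏ v : finPart S, primeIdeal v.1 ^ n v))
    fun a b => by
      rw [← gmk_mul, ← Finset.prod_mul_distrib]
      congr 1
      exact Finset.prod_congr rfl fun v _ => zpow_add _ (a v) (b v)) <| by
    intro g n
    apply gval_injective
    rw [gval_smul]
    change ∏ v : finPart S, primeIdeal v.1 ^ (MonoidAlgebra.single g (1 : ℤ) • n) v =
      g • ∏ v : finPart S, primeIdeal v.1 ^ n v
    rw [Finset.smul_prod']
    refine (Fintype.prod_equiv (MulAction.toPerm g) _ _ fun v => ?_).symm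
    rw [single_smul_fun, MulAction.toPerm_apply, inv_smul_smul, smul_zpow', smul_primeIdeal]
    rfl

theorem gval_supportedHom [Fintype (finPart S)] (n : FunModule Gal(F/K) (finPart S) ℤ) :
    gval (supportedHom S n) = ∏ v : finPart S, primeIdeal v.1 ^ n v := rfl

/-- Extension of fractional ideals to the ring of `S`-integers. -/
noncomputable def extHom : FracIdeals F →* (FractionalIdeal (SIntegers S)⁰ F)ˣ :=
  Units.map (extendedHom F (SIntegers S) : FractionalIdeal (𝓞 F)⁰ F →+*
    FractionalIdeal (SIntegers S)⁰ F).toMonoidHom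

/-- The underlying fractional ideal. -/
def FracIdeals.val (I : FracIdeals F) : FractionalIdeal (𝓞 F)⁰ F := Units.val I

theorem mem_range_SIntegers (x : F) : x ∈ (algebraMap (SIntegers S) F).range ↔
    ∀ v ∉ {v : HeightOneSpectrum (𝓞 F) | (Sum.inr v : Place F) ∈ S}, v.valuation F x ≤ 1 :=
  ⟨by rintro ⟨y, rfl⟩; exact y.2, fun h => ⟨⟨x, h⟩, rfl⟩⟩

theorem count_supported [Fintype (finPart S)] (n : FunModule Gal(F/K) (finPart S) ℤ)
    (w : HeightOneSpectrum (𝓞 F)) [Decidable (w ∈ finPart S)] :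
    count F w (gval (supportedHom S n)).val = if h : w ∈ finPart S then n ⟨w, h⟩ else 0 := by
  classical
  have h₁ : (gval (supportedHom S n)).val =
      ∏ v : finPart S, (v.1.asIdeal : FractionalIdeal (𝓞 F)⁰ F) ^ n v := by
    refine (map_prod (Units.coeHom (FractionalIdeal (𝓞 F)⁰ F)) _ _).trans ?_
    exact Finset.prod_congr rfl fun v _ => Units.val_zpow_eq_zpow_val _ _
  rw [h₁, count_prod _ _ _ _ fun v _ => zpow_ne_zero _ (coeIdeal_ne_zero.2 v.1.ne_bot)]
  simp only [count_zpow, count_maximal]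
  split_ifs with h
  · rw [Finset.sum_eq_single ⟨w, h⟩]
    · simp
    · intro v _ hv
      rw [if_neg fun h' => hv (Subtype.ext h'), mul_zero]
    · simp
  · refine Finset.sum_eq_zero fun v _ => ?_
    rw [if_neg fun h' : v.1 = w => h (h' ▸ v.2), mul_zero]

theorem supportedHom_injective [Fintype (finPart S)] : Function.Injective (supportedHom S) := by
  classical
  intro a b h
  funext v
  have h₁ := count_supported S a v.1
  have h₂ := count_supported S b v.1
  rw [h, dif_pos v.2] at *
  exact h₁.symm.trans h₂

/-- The kernel of extension to the `S`-integers is the group of ideals supported in `S`: primes in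
`S` become trivial, other primes cannot occur, and an ideal is determined by its exponents. -/
theorem extHom_eq_one_iff [Fintype (finPart S)] (x : GModule Gal(F/K) (FracIdeals F)) :
    extHom S (gval x) = 1 ↔ ∃ n, supportedHom S n = x := by
  classical
  constructor
  · intro h
    have h' : extendedHom F (SIntegers S) (gval x).val = 1 := congrArg Units.val h
    let n : FunModule Gal(F/K) (finPart S) ℤ := fun v => count F v.1 (gval x).val
    refine ⟨n, ?_⟩
    rw [← sub_eq_zero]
    refine gval_eq_one.1 (Units.ext ?_)
    change (gval (supportedHom S n - x)).val = 1
    refine eq_one_of_count_eq_zero (Units.ne_zero _) fun w => ?_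
    have hdiv : (gval (supportedHom S n - x)).val =
        (gval (supportedHom S n)).val * ((gval x).val)⁻¹ := by
      rw [sub_eq_add_neg]
      exact congrArg ((gval (supportedHom S n)).val * ·) (Units.val_inv_eq_inv_val _)
    rw [hdiv, count_mul _ _ (Units.ne_zero _) (inv_ne_zero (Units.ne_zero _)), count_inv,
      count_supported]
    split_ifs with hw
    · exact add_neg_cancel _
    · rw [count_eq_zero_of_extendedHom_eq_one (mem_range_SIntegers S) h' hw, neg_zero, zero_add]
  · rintro ⟨n, rfl⟩
    rw [gval_supportedHom, map_prod]
    refine Finset.prod_eq_one fun v _ => ?_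
    rw [map_zpow]
    have : extHom S (primeIdeal v.1) = 1 :=
      Units.ext (extendedHom_eq_one_of_mem (mem_range_SIntegers S) v.2)
    rw [this, one_zpow]

theorem extHom_smul (g : Gal(F/K)) (I : FracIdeals F) :
    extHom S (g • I) = Units.mapEquiv (ringEquivOfRingEquiv F F
      (MulSemiringAction.toRingEquiv Gal(F/K) (SIntegers S) g)).toMulEquiv (extHom S I) := by
  have hg : ∀ x : F, IsFractionRing.ringEquivOfRingEquiv (K := F) (L := F)
      (MulSemiringAction.toRingEquiv Gal(F/K) (SIntegers S) g) x = g x := by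
    intro x
    obtain ⟨a, b, hb, rfl⟩ := IsFractionRing.div_surjective (A := SIntegers S) x
    rw [map_div₀, map_div₀, IsFractionRing.ringEquivOfRingEquiv_algebraMap,
      IsFractionRing.ringEquivOfRingEquiv_algebraMap]
    rfl
  refine Units.ext ?_
  change extendedHom F (SIntegers S) (g • I).val =
    ringEquivOfRingEquiv F F _ (extendedHom F (SIntegers S) I.val)
  refine le_antisymm (extendedHom_overring_le fun x hx => ?_) fun x hx => ?_
  · obtain ⟨y, hy, rfl⟩ := (mem_smul_fracIdeal g I x).1 hx
    exact (mem_ringEquivOfRingEquiv _ _ _).2 ⟨y, mem_extendedHom_overring hy, hg y⟩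
  · obtain ⟨y, hy, rfl⟩ := (mem_ringEquivOfRingEquiv _ _ _).1 hx
    rw [hg]
    clear hx
    rw [← mem_coe, coe_extendedHom_overring] at hy
    induction hy using Submodule.span_induction with
    | mem z hz =>
      exact mem_extendedHom_overring ((mem_smul_fracIdeal g I _).2 ⟨z, hz, rfl⟩)
    | zero => rw [map_zero]; exact zero_mem _
    | add z w _ _ hz hw => rw [map_add]; exact Submodule.add_mem _ hz hw
    | smul r z _ hz =>
      have : g (r • z) = (g • r) • g z := by
        rw [Algebra.smul_def, map_mul, Algebra.smul_def]
        rfl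
      rw [this]
      exact Submodule.smul_mem _ _ hz

/-- The class of a fractional ideal in the `S`-class group. -/
noncomputable def classHom : FracIdeals F →* ClassGroup (SIntegers S) :=
  (ClassGroup.mk F).comp (extHom S)

theorem classHom_smul (g : Gal(F/K)) (I : FracIdeals F) :
    classHom S (g • I) = g • classHom S I := by
  change ClassGroup.mk F (extHom S (g • I)) = ClassGroup.mulEquiv _ (ClassGroup.mk F (extHom S I))
  rw [extHom_smul, FractionalIdeal.classGroup_mulEquiv_mk (K' := F)]

theorem classHom_surjective : Function.Surjective (classHom S) := by
  intro c
  obtain ⟨J, rfl⟩ : ∃ J : (FractionalIdeal (SIntegers S)⁰ F)ˣ, ClassGroup.mk F J = c :=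
    ClassGroup.induction F (fun J => ⟨J, rfl⟩) c
  obtain ⟨I, hI⟩ := units_map_extendedHom_surjective (R := 𝓞 F) J
  exact ⟨I, congrArg (ClassGroup.mk F) hI⟩

theorem classHom_eq_one_iff (I : FracIdeals F) :
    classHom S I = 1 ↔ ∃ α : Fˣ, extHom S (toPrincipalIdeal (𝓞 F) F α) = extHom S I := by
  have key : ∀ α : Fˣ, (extHom S (toPrincipalIdeal (𝓞 F) F α) :
      FractionalIdeal (SIntegers S)⁰ F) = spanSingleton (SIntegers S)⁰ (α : F) := fun α => by
    refine Eq.trans ?_ (extendedHom_overring_spanSingleton (R := 𝓞 F) (α : F))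
    exact congrArg (extendedHom F (SIntegers S)) (coe_toPrincipalIdeal (R := 𝓞 F) α)
  refine (ClassGroup.mk_eq_one_iff (I := extHom S I)).trans ⟨fun ⟨⟨x, hx⟩⟩ => ?_, ?_⟩
  · have h : (extHom S I : FractionalIdeal (SIntegers S)⁰ F) =
        spanSingleton (SIntegers S)⁰ x :=
      coeToSubmodule_injective (hx.trans (coe_spanSingleton _ x).symm)
    have hx0 : x ≠ 0 := by
      rintro rfl
      exact (extHom S I).ne_zero (by rw [h, spanSingleton_zero])
    exact ⟨Units.mk0 x hx0, Units.ext ((key _).trans h.symm)⟩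
  · rintro ⟨α, hα⟩
    exact ⟨⟨(α : F), by rw [← hα, key, coe_spanSingleton]⟩⟩

theorem extHom_principal_eq_one_iff (α : Fˣ) :
    extHom S (toPrincipalIdeal (𝓞 F) F α) = 1 ↔
      ∃ u : (SIntegers S)ˣ, Units.map (algebraMap (SIntegers S) F : SIntegers S →* F) u = α := by
  have key : (extHom S (toPrincipalIdeal (𝓞 F) F α) :
      FractionalIdeal (SIntegers S)⁰ F) = spanSingleton (SIntegers S)⁰ (α : F) := by
    refine Eq.trans ?_ (extendedHom_overring_spanSingleton (R := 𝓞 F) (α : F))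
    exact congrArg (extendedHom F (SIntegers S)) (coe_toPrincipalIdeal (R := 𝓞 F) α)
  rw [Units.ext_iff, key, Units.val_one]
  constructor
  · intro h
    obtain ⟨a, ha⟩ := (mem_one_iff _).1 (h ▸ mem_spanSingleton_self (SIntegers S)⁰ (α : F))
    obtain ⟨b, hb⟩ := (mem_spanSingleton _).1
      (h ▸ (one_mem_one _) : (1 : F) ∈ spanSingleton (SIntegers S)⁰ (α : F))
    have hba : b * a = 1 := by
      refine IsFractionRing.injective (SIntegers S) F ?_
      rw [map_mul, ha, map_one, ← hb, Algebra.smul_def]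
    exact ⟨⟨a, b, by rw [mul_comm, hba], hba⟩, Units.ext ha⟩
  · rintro ⟨u, rfl⟩
    refine le_antisymm (spanSingleton_le_iff_mem.2 ((mem_one_iff _).2 ⟨u, rfl⟩)) ?_
    rw [← spanSingleton_one]
    refine spanSingleton_le_iff_mem.2 ((mem_spanSingleton _).2 ⟨(u⁻¹ : (SIntegers S)ˣ), ?_⟩)
    rw [Algebra.smul_def]
    change algebraMap (SIntegers S) F _ * algebraMap (SIntegers S) F u = 1
    rw [← map_mul, Units.inv_mul, map_one]

end FracIdeals

end Arakelov

/-! ### The index of `F^× → Id_F`. -/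

namespace Arakelov

open IsDedekindDomain NumberField G0 FractionalIdeal

variable {K : Type v} {F : Type u} [Field K] [Field F] [Algebra K F] [NumberField F]

section PrincipalIndex

variable (K F) in
/-- The map `F^× → Id_F`. -/
noncomputable def principalIdealMap :
    GModule Gal(F/K) Fˣ →ₗ[MonoidAlgebra ℤ Gal(F/K)] GModule Gal(F/K) (FracIdeals F) :=
  gmap (toPrincipalIdeal (𝓞 F) F) fun g α => (smul_principalIdeal g α).symm

theorem toPrincipalIdeal_eq_one_iff (α : Fˣ) : toPrincipalIdeal (𝓞 F) F α = 1 ↔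
    ∃ u : (𝓞 F)ˣ, Units.map (algebraMap (𝓞 F) F : 𝓞 F →* F) u = α := by
  rw [Units.ext_iff, coe_toPrincipalIdeal, Units.val_one]
  constructor
  · intro h
    obtain ⟨a, ha⟩ := (mem_one_iff _).1 (h ▸ mem_spanSingleton_self (𝓞 F)⁰ (α : F))
    obtain ⟨b, hb⟩ := (mem_spanSingleton _).1
      (h ▸ (one_mem_one _) : (1 : F) ∈ spanSingleton (𝓞 F)⁰ (α : F))
    have hba : b * a = 1 := by
      refine IsFractionRing.injective (𝓞 F) F ?_
      rw [map_mul, ha, map_one, ← hb, Algebra.smul_def]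
    exact ⟨⟨a, b, by rw [mul_comm, hba], hba⟩, Units.ext ha⟩
  · rintro ⟨u, rfl⟩
    refine le_antisymm (spanSingleton_le_iff_mem.2 ((mem_one_iff _).2 ⟨u, rfl⟩)) ?_
    rw [← spanSingleton_one]
    refine spanSingleton_le_iff_mem.2 ((mem_spanSingleton _).2 ⟨(u⁻¹ : (𝓞 F)ˣ), ?_⟩)
    rw [Algebra.smul_def]
    change algebraMap (𝓞 F) F _ * algebraMap (𝓞 F) F u = 1
    rw [← map_mul, Units.inv_mul, map_one]

/-- The kernel is the image of the unit group of `𝓞 F`, finitely generated by Dirichlet, and the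
cokernel injects into the finite class group. Only the existence of an index is needed; its value is
found afterwards in terms of `S`. -/
theorem exists_hasIndex_principalIdealMap : ∃ x, HasIndex (principalIdealMap K F) x := by
  have h₁ : Module.Finite (MonoidAlgebra ℤ Gal(F/K)) (LinearMap.ker (principalIdealMap K F)) := by
    let f : Additive (𝓞 F)ˣ →+ LinearMap.ker (principalIdealMap K F) :=
      { toFun := fun u => ⟨gmk _ (Units.map (algebraMap (𝓞 F) F : 𝓞 F →* F) u.toMul),
          gval_eq_one (A := FracIdeals F).1 ((toPrincipalIdeal_eq_one_iff _).2 ⟨_, rfl⟩)⟩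
        map_zero' := Subtype.ext (by simp)
        map_add' := fun a b => Subtype.ext (by simp) }
    have hf : Function.Surjective f := by
      rintro ⟨x, hx⟩
      obtain ⟨u, hu⟩ := (toPrincipalIdeal_eq_one_iff (gval x)).1
        (gval_eq_one (A := FracIdeals F).2 hx)
      exact ⟨Additive.ofMul u, Subtype.ext (gval_injective hu)⟩
    have : Module.Finite ℤ (LinearMap.ker (principalIdealMap K F)) :=
      Module.Finite.of_surjective f.toIntLinearMap hf
    exact Module.Finite.of_restrictScalars_finite ℤ _ _
  have h₂ : Finite (GModule Gal(F/K) (FracIdeals F) ⧸ LinearMap.range (principalIdealMap K F)) := by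
    let c : FracIdeals F →* ClassGroup (𝓞 F) :=
      (ClassGroup.mk F : (FractionalIdeal (𝓞 F)⁰ F)ˣ →* ClassGroup (𝓞 F))
    refine Finite.of_injective
      (fun q : GModule Gal(F/K) (FracIdeals F) ⧸ LinearMap.range (principalIdealMap K F) =>
        c (gval q.out)) fun p q h => ?_
    rw [← Submodule.Quotient.mk_out p, ← Submodule.Quotient.mk_out q, Submodule.Quotient.eq]
    have h' : c (gval (p.out - q.out)) = 1 := by
      rw [sub_eq_add_neg, gval_add, gval_neg, map_mul, map_inv, mul_inv_eq_one]
      exact h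
    obtain ⟨⟨x, hx⟩⟩ := ClassGroup.mk_eq_one_iff.1 h'
    have hx' : (gval (p.out - q.out)).val = spanSingleton (𝓞 F)⁰ x :=
      coeToSubmodule_injective (hx.trans (coe_spanSingleton (𝓞 F)⁰ x).symm)
    have hx0 : x ≠ 0 := by
      rintro rfl
      have : (gval (p.out - q.out)).val ≠ 0 := Units.ne_zero _
      exact this (by rw [hx', spanSingleton_zero])
    refine ⟨gmk _ (Units.mk0 x hx0), gval_injective (Units.ext ?_)⟩
    exact (coe_toPrincipalIdeal (R := 𝓞 F) (Units.mk0 x hx0)).trans hx'.symm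
  have h₃ : Module.Finite (MonoidAlgebra ℤ Gal(F/K))
    (GModule Gal(F/K) (FracIdeals F) ⧸ LinearMap.range (principalIdealMap K F)) := inferInstance
  exact ⟨_, h₁, h₃, rfl⟩

/-- The index of `F^× → Id_F` in terms of `S`-units and the `S`-class group. -/
theorem hasIndex_principalIdealMap [FiniteDimensional K F] (S : SubMulAction Gal(F/K) (Place F)) [Finite S] :
    ∃ (_ : Module.Finite (MonoidAlgebra ℤ Gal(F/K)) (GModule Gal(F/K) (SIntegers S)ˣ))
      (_ : Module.Finite (MonoidAlgebra ℤ Gal(F/K)) (GModule Gal(F/K) (ClassGroup (SIntegers S)))),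
      HasIndex (principalIdealMap K F)
        (mk (MonoidAlgebra ℤ Gal(F/K)) (GModule Gal(F/K) (ClassGroup (SIntegers S))) -
          mk (MonoidAlgebra ℤ Gal(F/K)) (GModule Gal(F/K) (SIntegers S)ˣ) +
          mk (MonoidAlgebra ℤ Gal(F/K)) (PermModule Gal(F/K) (finPart S))) := by
  have := Fintype.ofFinite (finPart S)
  obtain ⟨x, hx⟩ := exists_hasIndex_principalIdealMap (K := K) (F := F)
  -- Modulo ideals supported in `S`, the map from `F^×` has kernel the `S`-units and cokernel the
  -- `S`-class group. Since `q` has index `-[ℤ[S_f]]`, additivity determines the index sought.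
  let q := (LinearMap.range (supportedHom S)).mkQ
  have hq : HasIndex q (-mk (MonoidAlgebra ℤ Gal(F/K)) (PermModule Gal(F/K) (finPart S))) := by
    rw [← mk_funModule]
    refine HasIndex.of_surjective (supportedHom_injective S) (fun y => ?_)
      (Submodule.mkQ_surjective _)
    exact (Submodule.Quotient.mk_eq_zero _).trans Iff.rfl
  have hcomp := hx.comp hq
  let i : GModule Gal(F/K) (SIntegers S)ˣ →ₗ[MonoidAlgebra ℤ Gal(F/K)] GModule Gal(F/K) Fˣ :=
    gmap (Units.map (algebraMap (SIntegers S) F : SIntegers S →* F)) fun g u => Units.ext rfl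
  have hi : Function.Injective i := Units.map_injective (IsFractionRing.injective (SIntegers S) F)
  let c : GModule Gal(F/K) (FracIdeals F) →ₗ[MonoidAlgebra ℤ Gal(F/K)]
      GModule Gal(F/K) (ClassGroup (SIntegers S)) := gmap (classHom S) (classHom_smul S)
  obtain ⟨p, hp⟩ := LinearMap.exists_comp_eq_of_ker_le q (Submodule.mkQ_surjective _) c (by
    rw [Submodule.ker_mkQ]
    rintro _ ⟨n, rfl⟩
    refine gval_eq_one.1 ((classHom_eq_one_iff S _).2 ⟨1, ?_⟩)
    refine Eq.trans ?_ ((extHom_eq_one_iff S _).2 ⟨n, rfl⟩).symm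
    refine (congrArg (extHom S) (map_one (toPrincipalIdeal (𝓞 F) F))).trans (map_one _))
  have hps : Function.Surjective p := fun y => by
    obtain ⟨I, hI⟩ := classHom_surjective S (gval y)
    exact ⟨q (gmk _ I), (hp _).trans (gval_injective hI)⟩
  have hiq : Function.Exact i (q ∘ₗ principalIdealMap K F) := by
    intro α
    refine (Submodule.Quotient.mk_eq_zero _).trans ?_
    refine Iff.trans (extHom_eq_one_iff S _).symm ?_
    exact extHom_principal_eq_one_iff S (gval α)
  have hqp : Function.Exact (q ∘ₗ principalIdealMap K F) p := by
    intro y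
    obtain ⟨I, rfl⟩ := Submodule.Quotient.mk_surjective _ y
    refine Iff.trans (Iff.of_eq (congrArg (· = 0) (hp I))) ?_
    refine Iff.trans (classHom_eq_one_iff S (gval I)) ?_
    refine Iff.trans ?_ (Set.mem_range).symm
    have key : ∀ α : GModule Gal(F/K) Fˣ,
        extHom S (gval (principalIdealMap K F α)) = extHom S (gval I) ↔
          (q ∘ₗ principalIdealMap K F) α = q I := by
      intro α
      rw [LinearMap.comp_apply]
      refine Iff.trans ?_ (Submodule.Quotient.eq _).symm
      refine Iff.trans ?_ (extHom_eq_one_iff S _)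
      rw [sub_eq_add_neg, gval_add, gval_neg, map_mul, map_inv, mul_inv_eq_one]
    exact ⟨fun ⟨α, hα⟩ => ⟨gmk _ α, (key _).1 hα⟩, fun ⟨α, hα⟩ => ⟨gval α, (key _).2 hα⟩⟩
  have hfi := hcomp.finite_left hi hiq
  have hfp := hcomp.finite_right hqp hps
  refine ⟨hfi, hfp, ?_⟩
  have e := hcomp.unique (HasIndex.of_exact hi hiq hqp hps)
  rw [← sub_eq_add_neg, sub_eq_iff_eq_add] at e
  rwa [← e]

end PrincipalIndex

end Arakelov

/-! ### Complex embeddings, and `F_ℝ` inside `∏_φ ℂ`. -/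

namespace Arakelov

open NumberField ComplexConjugate

section Embeddings

variable {K : Type v} {F : Type u} [Field K] [Field F] [Algebra K F]

/-- The Galois group acts on the complex embeddings of `F` by `g • φ = φ ∘ g⁻¹`. -/
instance : MulAction Gal(F/K) (F →+* ℂ) where
  smul g φ := φ.comp ((g⁻¹ : Gal(F/K)) : F →+* F)
  one_smul _ := rfl
  mul_smul g h φ := by
    refine RingHom.ext fun x => ?_
    change φ ((g * h)⁻¹ x) = φ (h⁻¹ (g⁻¹ x))
    rw [mul_inv_rev]
    rfl

theorem smul_emb_apply (g : Gal(F/K)) (φ : F →+* ℂ) (x : F) : (g • φ) x = φ (g⁻¹ x) := rfl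

theorem conjugate_smul (g : Gal(F/K)) (φ : F →+* ℂ) :
    ComplexEmbedding.conjugate (g • φ) = g • ComplexEmbedding.conjugate φ := rfl

/-- The Galois group acts simply transitively on the extensions to `F` of each of the `d` embeddings
of `K`; one lift of each serves as orbit representative. -/
theorem mk_permModule_embeddings [NumberField K] [NumberField F] [IsGalois K F] :
    G0.mk (MonoidAlgebra ℤ Gal(F/K)) (PermModule Gal(F/K) (F →+* ℂ)) =
      Module.finrank ℚ K • G0.mk (MonoidAlgebra ℤ Gal(F/K)) (MonoidAlgebra ℤ Gal(F/K)) := by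
  let e : Fin (Module.finrank ℚ K) ≃ (K →+* ℂ) :=
    (Fintype.equivFinOfCardEq (Embeddings.card K ℂ)).symm
  refine mk_permModule_of_free (fun i => ComplexEmbedding.lift F (e i)) ⟨?_, fun φ => ?_⟩
  · rintro ⟨i, g⟩ ⟨i', g'⟩ h
    have hK : ∀ (i) (g : Gal(F/K)),
        (g • ComplexEmbedding.lift F (e i)).comp (algebraMap K F) = e i := by
      intro i g
      refine RingHom.ext fun x => ?_
      rw [RingHom.comp_apply, smul_emb_apply, AlgEquiv.commutes]
      exact RingHom.congr_fun (ComplexEmbedding.lift_comp_algebraMap F (e i)) x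
    have hi : i = i' := e.injective (by rw [← hK i g, ← hK i' g']; exact congrArg (fun ψ : F →+* ℂ => ψ.comp (algebraMap K F)) h)
    subst hi
    have hg : g⁻¹ = g'⁻¹ := AlgEquiv.ext fun x =>
      (ComplexEmbedding.lift F (e i)).injective (RingHom.congr_fun h x)
    rw [inv_injective hg]
  · obtain ⟨i, hi⟩ := e.surjective (φ.comp (algebraMap K F))
    obtain ⟨g, hg⟩ := ComplexEmbedding.exists_comp_symm_eq_of_comp_eq
      (ComplexEmbedding.lift F (e i)) φ
      ((ComplexEmbedding.lift_comp_algebraMap F (e i)).trans hi)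
    exact ⟨⟨i, g⟩, hg⟩

end Embeddings

section RealAlg

variable {F : Type u} [Field F] [NumberField F]

variable (F) in
/-- The embedding `F_ℝ → ∏_φ ℂ` given by the complex embeddings `φ` of `F`. -/
noncomputable def realEmb : RealAlg F →ₐ[ℝ] ((F →+* ℂ) → ℂ) :=
  show (ℝ ⊗[ℚ] F) →ₐ[ℝ] ((F →+* ℂ) → ℂ) from
    Algebra.TensorProduct.lift (Algebra.ofId ℝ _) ((canonicalEmbedding F).toRatAlgHom)
      fun _ _ => Commute.all _ _

theorem realEmb_tmul (r : ℝ) (x : F) (φ : F →+* ℂ) :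
    realEmb F (show RealAlg F from r ⊗ₜ[ℚ] x) φ = r * φ x := rfl

theorem realEmb_toRealAlg (α : Fˣ) (φ : F →+* ℂ) :
    realEmb F (toRealAlg F α) φ = φ α := by
  refine (realEmb_tmul 1 (α : F) φ).trans ?_
  simp

theorem realEmb_conjugate (x : RealAlg F) (φ : F →+* ℂ) :
    realEmb F x (ComplexEmbedding.conjugate φ) = conj (realEmb F x φ) := by
  induction x using TensorProduct.induction_on with
  | zero => simp [show realEmb F (0 : ℝ ⊗[ℚ] F) = 0 from map_zero _]
  | tmul r x =>
    refine (realEmb_tmul r x _).trans ?_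
    refine Eq.trans ?_ (congrArg conj (realEmb_tmul r x φ)).symm
    simp [ComplexEmbedding.conjugate_coe_eq]
  | add x y hx hy =>
    have h := (map_add (realEmb F) x y)
    refine (congrFun h _).trans ?_
    refine Eq.trans ?_ (congrArg conj (congrFun h φ)).symm
    rw [Pi.add_apply, Pi.add_apply, map_add]
    exact congrArg₂ (· + ·) hx hy

theorem realEmb_realAut {K : Type v} [Field K] [Algebra K F] (g : Gal(F/K)) (x : RealAlg F)
    (φ : F →+* ℂ) : realEmb F (realAut g x) φ = realEmb F x (g⁻¹ • φ) := by
  induction x using TensorProduct.induction_on with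
  | zero =>
    have : realAut g (0 : RealAlg F) = 0 := map_zero _
    exact (congrFun (congrArg (realEmb F) this) φ).trans
      (by rw [map_zero]; exact (congrFun (map_zero (realEmb F)) _).symm)
  | tmul r x =>
    refine (realEmb_tmul r (g x) _).trans ?_
    refine Eq.trans ?_ (realEmb_tmul r x _).symm
    rw [smul_emb_apply, inv_inv]
  | add x y hx hy =>
    have h := map_add (realAut g) (show RealAlg F from x) y
    refine (congrFun ((congrArg (realEmb F) h).trans (map_add (realEmb F) _ _)) φ).trans ?_
    refine Eq.trans ?_ (congrFun (map_add (realEmb F) x y) _).symm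
    exact congrArg₂ (· + ·) hx hy

variable (F) in
/-- The real basis of `F_ℝ` given by the integral basis of `F`. -/
noncomputable def realBasis : Module.Basis (Module.Free.ChooseBasisIndex ℤ (𝓞 F)) ℝ (RealAlg F) :=
  show Module.Basis _ ℝ (ℝ ⊗[ℚ] F) from Algebra.TensorProduct.basis ℝ (integralBasis F)

theorem realEmb_realBasis (i) :
    realEmb F (realBasis F i) = canonicalEmbedding.latticeBasis F i := by
  rw [canonicalEmbedding.latticeBasis_apply]
  have : realBasis F i = (show RealAlg F from (1 : ℝ) ⊗ₜ[ℚ] integralBasis F i) :=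
    Algebra.TensorProduct.basis_apply _ _
  rw [this]
  funext φ
  refine (realEmb_tmul _ _ _).trans ?_
  simp

/-- An integral basis of `F` is at once a real basis of `F_ℝ` and a complex basis of `∏_φ ℂ`, with
the same coordinates. Injectivity, the description of the image and the norm formula all reduce to
this. -/
theorem repr_realEmb (x : RealAlg F) (i) :
    (canonicalEmbedding.latticeBasis F).repr (realEmb F x) i = ((realBasis F).repr x i : ℂ) := by
  have h : realEmb F x =
      ∑ i, ((realBasis F).repr x i : ℂ) • canonicalEmbedding.latticeBasis F i := by
    conv_lhs => rw [← (realBasis F).sum_repr x, map_sum]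
    refine Finset.sum_congr rfl fun i _ => ?_
    rw [map_smul, realEmb_realBasis, Complex.coe_smul]
  rw [h, Module.Basis.repr_sum_self]

theorem realEmb_injective : Function.Injective (realEmb F) := by
  intro x y h
  refine (realBasis F).ext_elem fun i => ?_
  have := repr_realEmb x i
  rw [h, repr_realEmb y i] at this
  exact_mod_cast this.symm

/-- The basis vectors have the conjugation symmetry, so conjugating the expansion of a symmetric
vector shows that its coordinates equal their own conjugates, hence are real. -/
theorem exists_realEmb_eq (z : (F →+* ℂ) → ℂ)
    (hz : ∀ φ, z (ComplexEmbedding.conjugate φ) = conj (z φ)) : ∃ x, realEmb F x = z := by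
  let B := canonicalEmbedding.latticeBasis F
  have hB : ∀ i φ, B i (ComplexEmbedding.conjugate φ) = conj (B i φ) := fun i φ => by
    rw [canonicalEmbedding.latticeBasis_apply]
    rfl
  have h₁ : z = ∑ i, conj (B.repr z i) • B i := by
    funext φ
    have h := congrArg conj (congrFun (B.sum_repr z) (ComplexEmbedding.conjugate φ))
    rw [hz, Complex.conj_conj] at h
    rw [← h, Finset.sum_apply, Finset.sum_apply, map_sum]
    refine Finset.sum_congr rfl fun i _ => ?_
    rw [Pi.smul_apply, Pi.smul_apply, smul_eq_mul, smul_eq_mul, map_mul, hB, Complex.conj_conj]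
  have h₂ : ∀ i, conj (B.repr z i) = B.repr z i := fun i => by
    conv_rhs => rw [h₁]
    rw [Module.Basis.repr_sum_self]
  refine ⟨∑ i, (B.repr z i).re • realBasis F i, ?_⟩
  rw [map_sum]
  refine Eq.trans (Finset.sum_congr rfl fun i _ => ?_) (B.sum_repr z)
  rw [map_smul, realEmb_realBasis, ← Complex.coe_smul, Complex.conj_eq_iff_re.1 (h₂ i)]

/-- Multiplication by `x` has the same matrix over `ℝ` and over `ℂ` in the common basis, and in the
standard basis of `∏_φ ℂ` it is diagonal. -/
theorem norm_eq_prod_realEmb (x : RealAlg F) :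
    ((Algebra.norm ℝ x : ℝ) : ℂ) = ∏ φ, realEmb F x φ := by
  classical
  have h₁ : Algebra.norm ℂ (realEmb F x) = ∏ φ, realEmb F x φ := by
    rw [Algebra.norm_eq_matrix_det (Pi.basisFun ℂ (F →+* ℂ)), ← Matrix.det_diagonal]
    congr 1
    ext φ ψ
    rw [Algebra.leftMulMatrix_eq_repr_mul, Pi.basisFun_repr, Pi.mul_apply, Pi.basisFun_apply,
      Matrix.diagonal_apply, Pi.single_apply]
    split_ifs <;> simp
  rw [← h₁, Algebra.norm_eq_matrix_det (realBasis F),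
    Algebra.norm_eq_matrix_det (canonicalEmbedding.latticeBasis F)]
  refine (RingHom.map_det Complex.ofRealHom _).trans (congrArg Matrix.det ?_)
  ext i k
  rw [RingHom.mapMatrix_apply, Matrix.map_apply, Algebra.leftMulMatrix_eq_repr_mul,
    Algebra.leftMulMatrix_eq_repr_mul, ← realEmb_realBasis, ← map_mul, repr_realEmb]
  rfl

theorem absNm_eq_prod (x : (RealAlg F)ˣ) : absNm F x = ∏ φ, ‖realEmb F x φ‖ := by
  rw [← norm_prod, ← norm_eq_prod_realEmb, Complex.norm_real]
  rfl

variable (F) in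
/-- The image of `F_ℝ` in `∏_φ ℂ`. -/
def conjFixed : Submodule ℝ ((F →+* ℂ) → ℂ) where
  carrier := {z | ∀ φ, z (ComplexEmbedding.conjugate φ) = conj (z φ)}
  zero_mem' _ := by simp
  add_mem' h h' φ := by simp [h φ, h' φ]
  smul_mem' r z h φ := by simp [h φ]

variable (F) in
/-- The isomorphism of `F_ℝ` with its image in `∏_φ ℂ`. -/
noncomputable def realEmbEquiv : RealAlg F ≃ₗ[ℝ] conjFixed F :=
  LinearEquiv.ofBijective ((realEmb F).toLinearMap.codRestrict (conjFixed F) realEmb_conjugate)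
    ⟨fun _ _ h => realEmb_injective (congrArg Subtype.val h), fun z => by
      obtain ⟨x, hx⟩ := exists_realEmb_eq z.1 z.2
      exact ⟨x, Subtype.ext hx⟩⟩

theorem realEmb_realEmbEquiv_symm (z : conjFixed F) :
    realEmb F ((realEmbEquiv F).symm z) = z :=
  congrArg Subtype.val ((realEmbEquiv F).apply_symm_apply z)

instance : ContinuousSMul ℝ (RealAlg F) := IsModuleTopology.toContinuousSMul ℝ (RealAlg F)

theorem continuous_realEmbEquiv_symm : Continuous (realEmbEquiv F).symm :=
  (realEmbEquiv F).symm.toLinearMap.continuous_of_finiteDimensional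

theorem continuous_realEmb : Continuous (realEmb F) :=
  IsModuleTopology.continuous_of_linearMap (realEmb F).toLinearMap

end RealAlg

end Arakelov

/-! ### Logarithms, winding numbers and the exponential map. -/

namespace Arakelov

open NumberField ComplexConjugate G0

/-- An additive subgroup that is stable under the action of the group elements is a
`ℤ[G]`-submodule. -/
def submoduleOfComm {G M : Type*} [Group G] [AddCommGroup M] [Module (MonoidAlgebra ℤ G) M]
    (A : AddSubgroup M) (h : ∀ (g : G), ∀ x ∈ A, MonoidAlgebra.single g (1 : ℤ) • x ∈ A) :
    Submodule (MonoidAlgebra ℤ G) M :=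
  { A with
    smul_mem' := fun r x hx => by
      induction r using MonoidAlgebra.induction_on with
      | of g => exact h g x hx
      | add a b ha hb => rw [add_smul]; exact A.add_mem ha hb
      | smul n a ha => rw [smul_assoc]; exact A.zsmul_mem ha n }

section LogModule

variable (K : Type v) (F : Type u) [Field K] [Field F] [Algebra K F] [NumberField F]

/-- The logarithms in `∏_φ ℂ` of the elements of `F_ℝ^×` of norm `±1`. -/
noncomputable def logModule : Submodule (MonoidAlgebra ℤ Gal(F/K)) (FunModule Gal(F/K) (F →+* ℂ) ℂ) :=
  submoduleOfComm
    { carrier := {z | (∀ φ, Complex.exp (z (ComplexEmbedding.conjugate φ)) =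
        conj (Complex.exp (z φ))) ∧ ∑ φ, (z φ).re = 0}
      zero_mem' := ⟨fun φ => by
        change Complex.exp 0 = conj (Complex.exp 0)
        simp, Finset.sum_eq_zero fun φ _ => rfl⟩
      add_mem' := fun {y z} hy hz => ⟨fun φ => by
        change Complex.exp (y _ + z _) = conj (Complex.exp (y _ + z _))
        rw [Complex.exp_add, Complex.exp_add, map_mul, hy.1, hz.1], by
        refine (Finset.sum_add_distrib (f := fun φ => (y φ).re) (g := fun φ => (z φ).re)).trans ?_
        rw [hy.2, hz.2, add_zero]⟩
      neg_mem' := fun {z} hz => ⟨fun φ => by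
        change Complex.exp (-z _) = conj (Complex.exp (-z _))
        rw [Complex.exp_neg, Complex.exp_neg, map_inv₀, hz.1], by
        refine (Finset.sum_neg_distrib (f := fun φ => (z φ).re)).trans ?_
        rw [hz.2, neg_zero]⟩ }
    fun g z hz => ⟨fun φ => by
      rw [single_smul_fun, single_smul_fun, ← conjugate_smul]
      exact hz.1 _, by
      simp_rw [single_smul_fun]
      exact (Equiv.sum_comp (MulAction.toPerm g⁻¹) fun φ => (z φ).re).trans hz.2⟩

/-- The Lie algebra of the group of elements of `F_ℝ^×` of norm `±1`. -/
noncomputable def lieModule : Submodule (MonoidAlgebra ℤ Gal(F/K)) (FunModule Gal(F/K) (F →+* ℂ) ℂ) :=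
  submoduleOfComm
    { carrier := {z | (∀ φ, z (ComplexEmbedding.conjugate φ) = conj (z φ)) ∧ ∑ φ, (z φ).re = 0}
      zero_mem' := ⟨fun φ => (map_zero conj).symm, Finset.sum_eq_zero fun φ _ => rfl⟩
      add_mem' := fun {y z} hy hz => ⟨fun φ => by
        change y _ + z _ = conj (y _ + z _)
        rw [map_add, hy.1, hz.1], by
        refine (Finset.sum_add_distrib (f := fun φ => (y φ).re) (g := fun φ => (z φ).re)).trans ?_
        rw [hy.2, hz.2, add_zero]⟩
      neg_mem' := fun {z} hz => ⟨fun φ => by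
        change -z _ = conj (-z _)
        rw [map_neg, hz.1], by
        refine (Finset.sum_neg_distrib (f := fun φ => (z φ).re)).trans ?_
        rw [hz.2, neg_zero]⟩ }
    fun g z hz => ⟨fun φ => by
      rw [single_smul_fun, single_smul_fun, ← conjugate_smul]
      exact hz.1 _, by
      simp_rw [single_smul_fun]
      exact (Equiv.sum_comp (MulAction.toPerm g⁻¹) fun φ => (z φ).re).trans hz.2⟩

variable {K F}

theorem lieModule_le_logModule : lieModule K F ≤ logModule K F := fun z hz =>
  ⟨fun φ => by rw [hz.1, Complex.exp_conj], hz.2⟩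

theorem exp_conjugate_of_eq {a b : ℂ} {n : ℤ} (h : b = conj a + n * (2 * Real.pi * Complex.I)) :
    Complex.exp b = conj (Complex.exp a) := by
  rw [← Complex.exp_conj, Complex.exp_eq_exp_iff_exists_int]
  exact ⟨n, h⟩

theorem intCast_mul_two_pi_I_injective :
    Function.Injective fun n : ℤ => (n : ℂ) * (2 * Real.pi * Complex.I) := fun _ _ h =>
  Int.cast_injective (mul_right_cancel₀ Complex.two_pi_I_ne_zero h)

theorem exists_winding {z : FunModule Gal(F/K) (F →+* ℂ) ℂ} (hz : z ∈ logModule K F) :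
    ∃ n : FunModule Gal(F/K) (InfinitePlace F) ℤ, ∀ φ, z (ComplexEmbedding.conjugate φ) =
      conj (z φ) + n (InfinitePlace.mk φ) * (2 * Real.pi * Complex.I) := by
  have h : ∀ φ, ∃ n : ℤ, z (ComplexEmbedding.conjugate φ) =
      conj (z φ) + n * (2 * Real.pi * Complex.I) := fun φ => by
    rw [← Complex.exp_eq_exp_iff_exists_int, Complex.exp_conj]
    exact hz.1 φ
  choose m hm using h
  -- Conjugating the defining relation changes the sign twice, once from `I` and once from
  -- exchanging the two sides. The integer therefore depends only on the place, without a sign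
  -- twist.
  have hc : ∀ φ, m (ComplexEmbedding.conjugate φ) = m φ := fun φ => by
    have h₁ := hm (ComplexEmbedding.conjugate φ)
    have h₂ : ComplexEmbedding.conjugate (ComplexEmbedding.conjugate φ) = φ := star_star φ
    rw [h₂, hm φ, map_add, Complex.conj_conj, map_mul, map_mul, map_mul, Complex.conj_I,
      Complex.conj_ofReal, map_intCast, map_ofNat] at h₁
    refine intCast_mul_two_pi_I_injective ?_
    linear_combination -h₁
  refine ⟨fun w => m w.embedding, fun φ => ?_⟩
  have h : m (InfinitePlace.mk φ).embedding = m φ := by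
    obtain h | h := InfinitePlace.embedding_mk_eq φ
    · rw [h]
    · rw [h, hc]
  exact (hm φ).trans (congrArg (fun k : ℤ => conj (z φ) + k * (2 * Real.pi * Complex.I)) h.symm)

theorem winding_unique {z : FunModule Gal(F/K) (F →+* ℂ) ℂ}
    {n n' : FunModule Gal(F/K) (InfinitePlace F) ℤ}
    (h : ∀ φ, z (ComplexEmbedding.conjugate φ) =
      conj (z φ) + n (InfinitePlace.mk φ) * (2 * Real.pi * Complex.I))
    (h' : ∀ φ, z (ComplexEmbedding.conjugate φ) =
      conj (z φ) + n' (InfinitePlace.mk φ) * (2 * Real.pi * Complex.I)) : n = n' := by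
  funext w
  refine intCast_mul_two_pi_I_injective ?_
  have := (h w.embedding).symm.trans (h' w.embedding)
  rw [InfinitePlace.mk_embedding] at this
  exact add_left_cancel this

variable (K F) in
/-- The obstruction for an element of `logModule K F` to be in `lieModule K F`. -/
noncomputable def winding :
    logModule K F →ₗ[MonoidAlgebra ℤ Gal(F/K)] FunModule Gal(F/K) (InfinitePlace F) ℤ :=
  linearOfComm (V := logModule K F) (W := FunModule Gal(F/K) (InfinitePlace F) ℤ)
    (AddMonoidHom.mk' (fun z : logModule K F => (exists_winding z.2).choose) fun y z =>
    winding_unique (exists_winding (y + z).2).choose_spec fun φ => by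
      have hy := (exists_winding y.2).choose_spec φ
      have hz := (exists_winding z.2).choose_spec φ
      change y.1 _ + z.1 _ = conj (y.1 φ + z.1 φ) + ((_ + _ : ℤ) : ℂ) * _
      rw [hy, hz, map_add, Int.cast_add]
      ring) fun g z =>
    winding_unique (exists_winding (MonoidAlgebra.single g (1 : ℤ) • z).2).choose_spec fun φ => by
      have hz := (exists_winding z.2).choose_spec (g⁻¹ • φ)
      rw [Submodule.coe_smul, single_smul_fun, single_smul_fun, ← conjugate_smul, hz]
      exact congrArg (fun k : ℤ => conj (z.1 (g⁻¹ • φ)) + k * (2 * Real.pi * Complex.I))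
        (single_smul_fun g (exists_winding z.2).choose (InfinitePlace.mk φ)).symm

theorem winding_spec (z : logModule K F) (φ : F →+* ℂ) :
    z.1 (ComplexEmbedding.conjugate φ) =
      conj (z.1 φ) + winding K F z (InfinitePlace.mk φ) * (2 * Real.pi * Complex.I) :=
  (exists_winding z.2).choose_spec φ

theorem winding_eq {z : logModule K F} {n : FunModule Gal(F/K) (InfinitePlace F) ℤ}
    (h : ∀ φ, z.1 (ComplexEmbedding.conjugate φ) =
      conj (z.1 φ) + n (InfinitePlace.mk φ) * (2 * Real.pi * Complex.I)) : winding K F z = n :=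
  winding_unique (winding_spec z) h

theorem winding_surjective : Function.Surjective (winding K F) := by
  intro n
  -- Half of the period is used: conjugation negates it, and the two values differ by a full period.
  let z : FunModule Gal(F/K) (F →+* ℂ) ℂ := fun φ =>
    n (InfinitePlace.mk φ) * (Real.pi * Complex.I)
  have hz : ∀ φ, z (ComplexEmbedding.conjugate φ) =
      conj (z φ) + n (InfinitePlace.mk φ) * (2 * Real.pi * Complex.I) := fun φ => by
    simp only [z, InfinitePlace.mk_conjugate_eq, map_mul, Complex.conj_I, Complex.conj_ofReal,
      map_intCast]
    ring
  exact ⟨⟨z, fun φ => exp_conjugate_of_eq (hz φ), Finset.sum_eq_zero fun φ _ => by simp [z]⟩,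
    winding_eq hz⟩

theorem hasIndex_inclusion : HasIndex (Submodule.inclusion (lieModule_le_logModule (K := K) (F := F)))
    (mk (MonoidAlgebra ℤ Gal(F/K)) (PermModule Gal(F/K) (InfinitePlace F))) := by
  rw [← mk_funModule]
  refine HasIndex.of_injective (Submodule.inclusion_injective _) (fun z => ?_) winding_surjective
  constructor
  · intro h
    refine ⟨⟨z.1, fun φ => ?_, z.2.2⟩, rfl⟩
    have := winding_spec z φ
    rw [h] at this
    change _ = _ + ((0 : ℤ) : ℂ) * _ at this
    rwa [Int.cast_zero, zero_mul, add_zero] at this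
  · rintro ⟨y, rfl⟩
    refine winding_eq fun φ => ?_
    change _ = _ + ((0 : ℤ) : ℂ) * _
    rw [Int.cast_zero, zero_mul, add_zero]
    exact y.2.1 φ

end LogModule

section ExpMap

variable {K : Type v} {F : Type u} [Field K] [Field F] [Algebra K F] [NumberField F]

theorem units_ext_realEmb {x y : (RealAlg F)ˣ} (h : ∀ φ, realEmb F x φ = realEmb F y φ) : x = y :=
  Units.ext (realEmb_injective (funext h))

/-- The image of `z` under the exponential map. -/
noncomputable def expAlg (z : logModule K F) : RealAlg F :=
  (realEmbEquiv F).symm ⟨fun φ => Complex.exp (z.1 φ), z.2.1⟩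

theorem realEmb_expAlg (z : logModule K F) (φ : F →+* ℂ) :
    realEmb F (expAlg z) φ = Complex.exp (z.1 φ) :=
  congrFun (realEmb_realEmbEquiv_symm _) φ

theorem expAlg_mul (y z : logModule K F) : expAlg y * expAlg z = expAlg (y + z) := by
  refine realEmb_injective (funext fun φ => ?_)
  rw [map_mul, Pi.mul_apply, realEmb_expAlg, realEmb_expAlg, realEmb_expAlg, ← Complex.exp_add]
  rfl

theorem expAlg_zero : expAlg (0 : logModule K F) = 1 := by
  refine realEmb_injective (funext fun φ => ?_)
  rw [realEmb_expAlg, map_one]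
  exact Complex.exp_zero

/-- The exponential map to `F_ℝ^×`. -/
noncomputable def expUnit (z : logModule K F) : (RealAlg F)ˣ where
  val := expAlg z
  inv := expAlg (-z)
  val_inv := by rw [expAlg_mul, add_neg_cancel, expAlg_zero]
  inv_val := by rw [expAlg_mul, neg_add_cancel, expAlg_zero]

theorem realEmb_expUnit (z : logModule K F) (φ : F →+* ℂ) :
    realEmb F (expUnit z) φ = Complex.exp (z.1 φ) := realEmb_expAlg z φ

theorem absNm_expUnit (z : logModule K F) : absNm F (expUnit z) = 1 := by
  rw [absNm_eq_prod]
  simp_rw [realEmb_expUnit, Complex.norm_exp]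
  rw [← Real.exp_sum, z.2.2, Real.exp_zero]

variable (K F) in
/-- The exponential map to `Id_F ×_{ℝ_{>0}} F_ℝ^×`. -/
noncomputable def expMap :
    logModule K F →ₗ[MonoidAlgebra ℤ Gal(F/K)] GModule Gal(F/K) (fibreProduct F) :=
  linearOfComm (W := GModule Gal(F/K) (fibreProduct F))
    (AddMonoidHom.mk' (fun z => gmk Gal(F/K) ⟨(1, expUnit z), by
      rw [mem_fibreProduct, map_one, absNm_expUnit]⟩) fun y z => gval_injective (Subtype.ext
        (Prod.ext (one_mul _).symm (Units.ext (expAlg_mul y z).symm)))) fun g z => by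
    refine gval_injective ?_
    rw [gval_smul]
    refine Subtype.ext (Prod.ext (smul_one g).symm (units_ext_realEmb fun φ => ?_))
    refine (realEmb_expUnit _ _).trans (Eq.trans ?_ (realEmb_realAut g _ φ).symm)
    rw [Submodule.coe_smul, single_smul_fun]
    exact (realEmb_expUnit _ _).symm

theorem expMap_eq_iff {z : logModule K F} {p : fibreProduct F} : gval (expMap K F z) = p ↔
    p.1.1 = 1 ∧ ∀ φ, Complex.exp (z.1 φ) = realEmb F p.1.2 φ := by
  constructor
  · rintro rfl
    exact ⟨rfl, fun φ => (realEmb_expUnit z φ).symm⟩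
  · rintro ⟨h₁, h₂⟩
    refine Subtype.ext (Prod.ext h₁.symm (units_ext_realEmb fun φ => ?_))
    exact (realEmb_expUnit z φ).trans (h₂ φ)

theorem expMap_eq_zero_iff {z : logModule K F} :
    expMap K F z = 0 ↔ ∀ φ, Complex.exp (z.1 φ) = 1 := by
  refine Iff.trans (expMap_eq_iff (p := 1)) ?_
  have : ∀ φ, realEmb F (1 : fibreProduct F).1.2 φ = 1 := fun φ => congrFun (map_one (realEmb F)) φ
  simp_rw [this]
  exact ⟨fun h => h.2, fun h => ⟨rfl, h⟩⟩

theorem realEmb_unit_ne_zero (x : (RealAlg F)ˣ) (φ : F →+* ℂ) : realEmb F x φ ≠ 0 := by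
  have h : realEmb F x φ * realEmb F (x⁻¹ : (RealAlg F)ˣ) φ = 1 := by
    rw [← Pi.mul_apply, ← map_mul, Units.mul_inv, map_one, Pi.one_apply]
  exact left_ne_zero_of_mul_eq_one h

/-- Principal logarithms violate the conjugation symmetry at negative reals. They still lie in
`logModule`, where the symmetry is required only after exponentiation. -/
theorem exists_expMap_eq {p : fibreProduct F} (hp : p.1.1 = 1) :
    ∃ z : logModule K F, (∀ φ, z.1 φ = Complex.log (realEmb F p.1.2 φ)) ∧
      gval (expMap K F z) = p := by
  have he := fun φ => Complex.exp_log (realEmb_unit_ne_zero p.1.2 φ)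
  refine ⟨⟨fun φ => Complex.log (realEmb F p.1.2 φ), fun φ => ?_, ?_⟩, fun _ => rfl,
    expMap_eq_iff.2 ⟨hp, he⟩⟩
  · change Complex.exp (Complex.log _) = conj (Complex.exp (Complex.log _))
    rw [he, he, realEmb_conjugate]
  · have h : ∏ φ, ‖realEmb F p.1.2 φ‖ = 1 := by
      rw [← absNm_eq_prod, ← (mem_fibreProduct _).1 p.2, hp, map_one]
    simp_rw [Complex.log_re]
    rw [← Real.log_prod fun φ _ => norm_ne_zero_iff.2 (realEmb_unit_ne_zero p.1.2 φ), h,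
      Real.log_one]

variable (K F) in
/-- The projection `Id_F ×_{ℝ_{>0}} F_ℝ^× → Id_F`. -/
noncomputable def idealProj :
    GModule Gal(F/K) (fibreProduct F) →ₗ[MonoidAlgebra ℤ Gal(F/K)] GModule Gal(F/K) (FracIdeals F) :=
  gmap ((MonoidHom.fst _ _).comp (fibreProduct F).subtype) fun _ _ => rfl

/-- A real scalar suffices: the norm raises it to the number of embeddings, so the matching root of
`t` is taken. -/
theorem exists_absNm_eq {t : ℝ} (ht : 0 < t) : ∃ x : (RealAlg F)ˣ, absNm F x = t := by
  let n := Fintype.card (F →+* ℂ)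
  have hn : n ≠ 0 := by
    rw [show n = _ from Embeddings.card F ℂ]
    exact Module.finrank_pos.ne'
  have hs : 0 < t ^ ((n : ℝ)⁻¹) := Real.rpow_pos_of_pos ht _
  refine ⟨Units.map (algebraMap ℝ (RealAlg F) : ℝ →* RealAlg F) (Units.mk0 _ hs.ne'), ?_⟩
  rw [absNm_eq_prod]
  have : ∀ φ : F →+* ℂ, ‖realEmb F (algebraMap ℝ (RealAlg F) (t ^ ((n : ℝ)⁻¹))) φ‖ =
      t ^ ((n : ℝ)⁻¹) := fun φ => by
    rw [AlgHom.commutes]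
    exact (Complex.norm_real _).trans (Real.norm_of_nonneg hs.le)
  refine (Finset.prod_congr rfl fun φ _ => this φ).trans ?_
  rw [Finset.prod_const]
  exact Real.rpow_inv_natCast_pow ht.le hn

theorem idealNorm_pos (I : FracIdeals F) : 0 < idealNorm F I := by
  refine lt_of_le_of_ne ?_ ?_
  · exact Rat.cast_nonneg.2 (FractionalIdeal.absNorm_nonneg _)
  · intro h
    have : idealNorm F I * idealNorm F I⁻¹ = 1 := by rw [← map_mul, mul_inv_cancel, map_one]
    rw [← h, zero_mul] at this
    exact zero_ne_one this

theorem idealProj_surjective : Function.Surjective (idealProj K F) := by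
  refine gmap_surjective fun I => ?_
  obtain ⟨x, hx⟩ := exists_absNm_eq (F := F) (idealNorm_pos I)
  exact ⟨⟨(I, x), (mem_fibreProduct _).2 hx.symm⟩, rfl⟩

variable (K F) in
/-- The exponential map onto the kernel of the projection to `Id_F`. -/
noncomputable def expKer :
    logModule K F →ₗ[MonoidAlgebra ℤ Gal(F/K)] LinearMap.ker (idealProj K F) :=
  (expMap K F).codRestrict _ fun _ => rfl

/-- The kernel consists of arbitrary integer multiples of `2πi` at each embedding, with no relation
between conjugate embeddings. This makes it the full permutation module, which is free over `ℤ[G]`.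
-/
theorem hasIndex_expKer [NumberField K] [IsGalois K F] : HasIndex (expKer K F)
    (-(Module.finrank ℚ K • mk (MonoidAlgebra ℤ Gal(F/K)) (MonoidAlgebra ℤ Gal(F/K)))) := by
  rw [← mk_permModule_embeddings, ← mk_funModule]
  have hm : ∀ n : FunModule Gal(F/K) (F →+* ℂ) ℤ,
      (fun φ => n φ * (2 * Real.pi * Complex.I) : FunModule Gal(F/K) (F →+* ℂ) ℂ) ∈
        logModule K F := fun n =>
    ⟨fun φ => by rw [Complex.exp_int_mul_two_pi_mul_I, Complex.exp_int_mul_two_pi_mul_I, map_one],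
      Finset.sum_eq_zero fun φ _ => by simp⟩
  let i : FunModule Gal(F/K) (F →+* ℂ) ℤ →ₗ[MonoidAlgebra ℤ Gal(F/K)] logModule K F :=
    linearOfComm (AddMonoidHom.mk' (fun n => ⟨_, hm n⟩) fun m n => Subtype.ext (funext fun φ => by
      change ((m φ + n φ : ℤ) : ℂ) * _ = _ * _ + _ * _
      rw [Int.cast_add, add_mul])) fun g n => Subtype.ext (funext fun φ => by
      rw [Submodule.coe_smul, single_smul_fun]
      change ((MonoidAlgebra.single g (1 : ℤ) • n) φ : ℂ) * _ = _
      rw [single_smul_fun]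
      rfl)
  refine HasIndex.of_surjective (i := i) (fun m n h => ?_) (fun z => ?_) ?_
  · funext φ
    exact intCast_mul_two_pi_I_injective
      (congrFun (congrArg (Subtype.val : logModule K F → _) h) φ)
  · refine Iff.trans (Subtype.ext_iff.trans expMap_eq_zero_iff) ?_
    simp_rw [Complex.exp_eq_one_iff]
    constructor
    · intro h
      choose n hn using h
      exact ⟨n, Subtype.ext (funext fun φ => (hn φ).symm)⟩
    · rintro ⟨n, rfl⟩ φ
      exact ⟨n φ, rfl⟩
  · rintro ⟨p, hp⟩
    obtain ⟨z, -, hz⟩ := exists_expMap_eq (K := K) (p := gval p) hp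
    exact ⟨z, Subtype.ext (gval_injective hz)⟩

variable (K F) in
/-- The map from `Id_F ×_{ℝ_{>0}} F_ℝ^×` to the oriented Arakelov class group. -/
noncomputable def picProj :
    GModule Gal(F/K) (fibreProduct F) →ₗ[MonoidAlgebra ℤ Gal(F/K)] GModule Gal(F/K) (PicTilde F) :=
  gmap (QuotientGroup.mk' (principal F).range) fun _ _ => rfl

variable (K F) in
/-- The exponential map from the Lie algebra to the oriented Arakelov class group. -/
noncomputable def expPic : lieModule K F →ₗ[MonoidAlgebra ℤ Gal(F/K)] GModule Gal(F/K) (PicTilde F) :=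
  picProj K F ∘ₗ expMap K F ∘ₗ Submodule.inclusion lieModule_le_logModule

theorem toRealAlg_injective : Function.Injective (toRealAlg F) := fun α β h => by
  obtain ⟨φ⟩ : Nonempty (F →+* ℂ) := inferInstance
  refine Units.ext (φ.injective ?_)
  rw [← realEmb_toRealAlg, h, realEmb_toRealAlg]

theorem picProj_eq_zero_iff (p : GModule Gal(F/K) (fibreProduct F)) :
    picProj K F p = 0 ↔ ∃ α, principal F α = gval p :=
  (QuotientGroup.eq_one_iff (N := (principal F).range) (gval p)).trans Iff.rfl

theorem hasIndex_expPic [NumberField K] [IsGalois K F] [FiniteDimensional K F]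
    {x : G0 (MonoidAlgebra ℤ Gal(F/K))} (hx : HasIndex (principalIdealMap K F) x) :
    HasIndex (expPic K F)
      (mk (MonoidAlgebra ℤ Gal(F/K)) (PermModule Gal(F/K) (InfinitePlace F)) +
        (-(Module.finrank ℚ K • mk (MonoidAlgebra ℤ Gal(F/K)) (MonoidAlgebra ℤ Gal(F/K))) + x)) := by
  let b : GModule Gal(F/K) Fˣ →ₗ[MonoidAlgebra ℤ Gal(F/K)] GModule Gal(F/K) (fibreProduct F) :=
    gmap (principal F) fun g α => (smul_principal g α).symm
  -- In the fibre product, the quotient by `F^×` is the Arakelov class group and the quotient by the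
  -- elements of norm `±1` is `Id_F`.
  have h₁ : HasIndex (picProj K F ∘ₗ (LinearMap.ker (idealProj K F)).subtype) x := by
    refine HasIndex.swap (b := b) (p := idealProj K F) (Submodule.injective_subtype _)
      (LinearMap.exact_subtype_ker_map _) idealProj_surjective (fun α β h => ?_) (fun p => ?_)
      (gmap_surjective (QuotientGroup.mk'_surjective _)) hx
    · exact gval_injective (toRealAlg_injective (congrArg (fun p => (gval p).1.2) h))
    · exact picProj_eq_zero_iff p
  exact hasIndex_inclusion.comp (hasIndex_expKer.comp h₁)

end ExpMap

end Arakelov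

/-! ### The real structure of the Lie algebra, and the exponential as a local homeomorphism. -/

namespace Arakelov

open NumberField ComplexConjugate G0 Topology

theorem classGroup_mk_eq_one_iff {R K : Type*} [CommRing R] [IsDomain R] [Field K] [Algebra R K]
    [IsFractionRing R K] {I : (FractionalIdeal R⁰ K)ˣ} :
    ClassGroup.mk K I = 1 ↔ ∃ α, toPrincipalIdeal R K α = I := by
  rw [← (ClassGroup.equiv K).injective.eq_iff, map_one, ClassGroup.equiv_mk,
    FractionalIdeal.canonicalEquiv_self]
  exact QuotientGroup.eq_one_iff _

section LieModule

variable {K : Type v} {F : Type u} [Field K] [Field F] [Algebra K F] [NumberField F]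

noncomputable instance : NormedAddCommGroup (lieModule K F) := inferInstance

noncomputable instance : SMul ℝ (lieModule K F) where
  smul r z := ⟨fun φ => r * z.1 φ, fun φ => by
      change r * z.1 _ = conj (r * z.1 φ)
      rw [z.2.1, map_mul, Complex.conj_ofReal], by
      simp_rw [Complex.re_ofReal_mul]
      rw [← Finset.mul_sum, z.2.2, mul_zero]⟩

theorem real_smul_apply (r : ℝ) (z : lieModule K F) (φ : F →+* ℂ) :
    (r • z).1 φ = r * z.1 φ := rfl

theorem lie_ext {y z : lieModule K F} (h : ∀ φ, y.1 φ = z.1 φ) : y = z := Subtype.ext (funext h)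

variable (K F) in
/-- The inclusion of the Lie algebra in `∏_φ ℂ`. -/
noncomputable def lieCoe : lieModule K F →+ ((F →+* ℂ) → ℂ) := AddMonoidHom.mk' (fun z => z.1) fun _ _ => rfl

theorem lieCoe_injective : Function.Injective (lieCoe K F) := Subtype.val_injective

theorem lieCoe_smul (r : ℝ) (z : lieModule K F) : lieCoe K F (r • z) = r • lieCoe K F z :=
  funext fun _ => rfl

noncomputable instance : Module ℝ (lieModule K F) :=
  Function.Injective.module ℝ (lieCoe K F) lieCoe_injective lieCoe_smul

noncomputable instance : NormedSpace ℝ (lieModule K F) where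
  norm_smul_le r z := norm_smul_le r (lieCoe K F z)

instance : FiniteDimensional ℝ (lieModule K F) :=
  Module.Finite.of_injective
    ({ lieCoe K F with map_smul' := lieCoe_smul } : lieModule K F →ₗ[ℝ] ((F →+* ℂ) → ℂ))
    lieCoe_injective

theorem norm_apply_le (z : lieModule K F) (φ : F →+* ℂ) : ‖z.1 φ‖ ≤ ‖z‖ :=
  norm_le_pi_norm (lieCoe K F z) φ

theorem lie_norm_lt_iff {z : lieModule K F} {r : ℝ} (hr : 0 < r) :
    ‖z‖ < r ↔ ∀ φ, ‖z.1 φ‖ < r :=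
  pi_norm_lt_iff (x := lieCoe K F z) hr

theorem continuous_lie_apply (φ : F →+* ℂ) : Continuous fun z : lieModule K F => z.1 φ :=
  (continuous_apply φ).comp (continuous_subtype_val (p := (· ∈ lieModule K F)))

theorem exists_linearMap_single_smul (g : Gal(F/K)) :
    ∃ L : lieModule K F →ₗ[ℝ] lieModule K F, ∀ z, MonoidAlgebra.single g (1 : ℤ) • z = L z :=
  ⟨{ toFun := fun z => MonoidAlgebra.single g (1 : ℤ) • z
     map_add' := smul_add _
     map_smul' := fun r z => lie_ext fun φ => by
      rw [Submodule.coe_smul, single_smul_fun, RingHom.id_apply, real_smul_apply, real_smul_apply,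
        Submodule.coe_smul, single_smul_fun] }, fun _ => rfl⟩

end LieModule

section ExpPic

variable {K : Type v} {F : Type u} [Field K] [Field F] [Algebra K F] [NumberField F]

variable (K F) in
/-- The exponential map from the Lie algebra to `Id_F ×_{ℝ_{>0}} F_ℝ^×`. -/
noncomputable def lieExp (z : lieModule K F) : fibreProduct F :=
  gval (expMap K F (Submodule.inclusion lieModule_le_logModule z))

theorem lieExp_eq_iff {z : lieModule K F} {p : fibreProduct F} : lieExp K F z = p ↔
    p.1.1 = 1 ∧ ∀ φ, Complex.exp (z.1 φ) = realEmb F p.1.2 φ := expMap_eq_iff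

theorem continuous_lieExp : Continuous (lieExp K F) := by
  -- The topology on units requires continuity of the value and of the inverse, which correspond to
  -- `s = 1` and `s = -1`.
  have h : ∀ s : ℤˣ, Continuous fun z : lieModule K F =>
      expAlg (Submodule.inclusion (lieModule_le_logModule (K := K) (F := F)) ((s : ℤ) • z)) :=
    fun s => by
      refine continuous_realEmbEquiv_symm.comp (Continuous.subtype_mk (continuous_pi fun φ => ?_) _)
      refine Complex.continuous_exp.comp ?_
      exact (continuous_lie_apply φ).comp (continuous_const_smul (s : ℤ))
  refine Continuous.subtype_mk (continuous_const.prodMk (Units.continuous_iff.2 ⟨?_, ?_⟩)) _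
  · have := h 1
    simp only [Units.val_one, one_smul] at this
    exact this
  · have := h (-1)
    simp only [Units.val_neg, Units.val_one, neg_smul, one_smul] at this
    exact this

theorem continuous_gval_expPic : Continuous fun z => gval (expPic K F z) :=
  continuous_quot_mk.comp (continuous_lieExp (K := K) (F := F))

theorem image_gval_expPic_mem_nhds (U : Set (lieModule K F)) (hU : U ∈ 𝓝 0) :
    (fun z => gval (expPic K F z)) '' U ∈ 𝓝 1 := by
  obtain ⟨ε, hε, hεU⟩ := Metric.mem_nhds_iff.1 hU
  have hc : ∀ φ, Continuous fun p : fibreProduct F => realEmb F p.1.2 φ := fun φ =>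
    (continuous_apply φ).comp (continuous_realEmb.comp
      (Units.continuous_val.comp (continuous_snd.comp continuous_subtype_val)))
  have h1 : ∀ φ, realEmb F (1 : fibreProduct F).1.2 φ = 1 := fun φ => congrFun (map_one (realEmb F)) φ
  -- Near the identity the ideal is trivial, as `Id_F` is discrete, and all coordinates avoid the
  -- negative axis. There the principal logarithm commutes with conjugation, so it lands in the Lie
  -- algebra itself.
  have hV : ∀ᶠ p : fibreProduct F in 𝓝 1, p.1.1 = 1 ∧ ∀ φ, realEmb F p.1.2 φ ∈ Complex.slitPlane ∧
      ‖Complex.log (realEmb F p.1.2 φ)‖ < ε := by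
    refine Filter.Eventually.and ?_ (Filter.eventually_all.2 fun φ => Filter.Eventually.and ?_ ?_)
    · exact ((isOpen_discrete {1}).preimage
        (continuous_fst.comp continuous_subtype_val)).mem_nhds rfl
    · refine (Complex.isOpen_slitPlane.preimage (hc φ)).mem_nhds ?_
      rw [Set.mem_preimage, h1]
      exact Complex.one_mem_slitPlane
    · have : ContinuousAt (fun p : fibreProduct F => ‖Complex.log (realEmb F p.1.2 φ)‖) 1 := by
        refine ContinuousAt.norm (ContinuousAt.clog (hc φ).continuousAt ?_)
        rw [h1]
        exact Complex.one_mem_slitPlane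
      refine this.eventually_lt continuousAt_const ?_
      rwa [h1, Complex.log_one, norm_zero]
  have hO : IsOpenMap (QuotientGroup.mk' (principal F).range) := QuotientGroup.isOpenMap_coe
  refine Filter.mem_of_superset (hO.image_mem_nhds hV) ?_
  rintro _ ⟨p, ⟨hp, hp'⟩, rfl⟩
  obtain ⟨z, hz, hzp⟩ := exists_expMap_eq (K := K) hp
  refine ⟨⟨z.1, fun φ => ?_, z.2.2⟩, hεU ?_, congrArg (QuotientGroup.mk' (principal F).range) hzp⟩
  · rw [hz, hz, realEmb_conjugate, Complex.log_conj]
    exact (Complex.mem_slitPlane_iff_arg.1 (hp' φ).1).1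
  · rw [mem_ball_zero_iff, lie_norm_lt_iff hε]
    intro φ
    exact (congrArg norm (hz φ)).trans_lt (hp' φ).2

theorem expPic_eq_zero_iff {z : lieModule K F} : expPic K F z = 0 ↔
    ∃ u : (𝓞 F)ˣ, ∀ φ : F →+* ℂ, Complex.exp (z.1 φ) = φ (algebraMap (𝓞 F) F u) := by
  refine (picProj_eq_zero_iff _).trans ?_
  constructor
  · rintro ⟨α, hα⟩
    obtain ⟨h₁, h₂⟩ := lieExp_eq_iff.1 hα.symm
    obtain ⟨u, rfl⟩ := (toPrincipalIdeal_eq_one_iff α).1 h₁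
    exact ⟨u, fun φ => (h₂ φ).trans (realEmb_toRealAlg _ φ)⟩
  · rintro ⟨u, hu⟩
    refine ⟨Units.map (algebraMap (𝓞 F) F : 𝓞 F →* F) u, (lieExp_eq_iff.2 ⟨?_, fun φ => ?_⟩).symm⟩
    · exact (toPrincipalIdeal_eq_one_iff _).2 ⟨u, rfl⟩
    · exact (hu φ).trans (realEmb_toRealAlg (Units.map (algebraMap (𝓞 F) F : 𝓞 F →* F) u) φ).symm

/-- If `exp z` is a unit `u` and `z` is this small, then `‖exp z - 1‖ ≤ 2‖z‖ < 1` at every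
embedding. A nonzero algebraic integer cannot be smaller than `1` at all infinite places, so `u =
1`; imaginary parts below `π` then leave only the principal value `0`. -/
theorem eq_zero_of_expPic_eq_zero {z : lieModule K F} (hz : ‖z‖ < 1 / 2) (h : expPic K F z = 0) :
    z = 0 := by
  obtain ⟨u, hu⟩ := expPic_eq_zero_iff.1 h
  have hn : ∀ φ, ‖z.1 φ‖ < 1 / 2 := fun φ => (norm_apply_le z φ).trans_lt hz
  have h₁ : (u : 𝓞 F) - 1 = 0 := by
    by_contra hne
    have hlt : ∀ w : InfinitePlace F, w (((u : 𝓞 F) - 1 : 𝓞 F) : F) < 1 := fun w => by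
      rw [← InfinitePlace.norm_embedding_eq]
      have h := Complex.norm_exp_sub_one_le (x := z.1 w.embedding) (by linarith [hn w.embedding])
      rw [hu] at h
      change ‖w.embedding (algebraMap (𝓞 F) F (u - 1))‖ < 1
      rw [map_sub, map_sub, map_one, map_one]
      linarith [hn w.embedding]
    obtain ⟨w⟩ : Nonempty (InfinitePlace F) := inferInstance
    exact absurd (hlt w) (InfinitePlace.one_le_of_lt_one hne fun w' _ => hlt w').not_gt
  refine lie_ext fun φ => ?_
  have h₂ : Complex.exp (z.1 φ) = 1 := by rw [hu, sub_eq_zero.1 h₁, map_one, map_one]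
  have him := abs_lt.1 ((Complex.abs_im_le_norm _).trans_lt (hn φ))
  have hpi := Real.pi_gt_three
  have h₃ := Complex.log_exp (x := z.1 φ) (by linarith) (by linarith)
  rw [h₂, Complex.log_one] at h₃
  exact h₃.symm

/-- Adding to a logarithm its conjugate transform restores the symmetry, at the cost of
exponentiating to `p ^ 2` instead of `p`. -/
theorem exists_lieExp_eq_sq {p : fibreProduct F} (hp : p.1.1 = 1) : ∃ z : lieModule K F,
    (∀ φ, (z.1 φ).re = 2 * Real.log ‖realEmb F p.1.2 φ‖) ∧ lieExp K F z = p ^ 2 := by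
  obtain ⟨y, hy, hyp⟩ := exists_expMap_eq (K := K) hp
  obtain ⟨-, he⟩ := expMap_eq_iff.1 hyp
  have hre : ∀ φ, (y.1 φ).re = Real.log ‖realEmb F p.1.2 φ‖ := fun φ => by
    rw [hy, Complex.log_re]
  have hre' : ∀ φ, (y.1 φ + conj (y.1 (ComplexEmbedding.conjugate φ))).re =
      2 * Real.log ‖realEmb F p.1.2 φ‖ := fun φ => by
    rw [Complex.add_re, Complex.conj_re, hre, hre, realEmb_conjugate, Complex.norm_conj, two_mul]
  refine ⟨⟨fun φ => y.1 φ + conj (y.1 (ComplexEmbedding.conjugate φ)), fun φ => ?_, ?_⟩, hre',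
    lieExp_eq_iff.2 ⟨?_, fun φ => ?_⟩⟩
  · have h₂ : ComplexEmbedding.conjugate (ComplexEmbedding.conjugate φ) = φ := star_star φ
    change y.1 _ + conj (y.1 (ComplexEmbedding.conjugate (ComplexEmbedding.conjugate φ))) =
      conj (y.1 φ + conj (y.1 _))
    rw [h₂, map_add, Complex.conj_conj, add_comm]
  · simp_rw [hre']
    rw [← Finset.mul_sum, ← Finset.sum_congr rfl fun φ _ => hre φ, y.2.2, mul_zero]
  · change p.1.1 ^ 2 = 1
    rw [hp, one_pow]
  · change Complex.exp (y.1 φ + conj _) = realEmb F ((p.1.2 : RealAlg F) ^ 2) φ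
    rw [Complex.exp_add, Complex.exp_conj, he, he, realEmb_conjugate, Complex.conj_conj, map_pow,
      Pi.pow_apply, sq]

/-- The class number makes the ideal principal, so that division by an element of `F^×` trivialises
it; the factor `2` pays for the symmetrised logarithm. -/
theorem exists_gval_expPic_eq_pow (p : PicTilde F) :
    ∃ z, gval (expPic K F z) = p ^ (2 * Fintype.card (ClassGroup (𝓞 F))) := by
  let q : fibreProduct F →* PicTilde F := QuotientGroup.mk' (principal F).range
  obtain ⟨p, rfl⟩ : ∃ p', q p' = p := QuotientGroup.mk'_surjective (principal F).range p
  let c := Fintype.card (ClassGroup (𝓞 F))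
  have hI : ∃ α, toPrincipalIdeal (𝓞 F) F α = p.1.1 ^ c := by
    have h : ClassGroup.mk F (show (FractionalIdeal (𝓞 F)⁰ F)ˣ from p.1.1 ^ c) = 1 :=
      (map_pow (ClassGroup.mk F) (show (FractionalIdeal (𝓞 F)⁰ F)ˣ from p.1.1) c).trans
        pow_card_eq_one
    exact classGroup_mk_eq_one_iff.1 h
  obtain ⟨α, hα⟩ := hI
  obtain ⟨z, -, hz⟩ := exists_lieExp_eq_sq (K := K) (p := p ^ c * (principal F α)⁻¹) (by
    exact mul_inv_eq_one.2 hα.symm)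
  refine ⟨z, ?_⟩
  have h₁ : q (principal F α) = 1 := (QuotientGroup.eq_one_iff _).2 ⟨α, rfl⟩
  refine (congrArg q hz).trans (Eq.trans ?_ (map_pow q p (2 * c)))
  rw [mul_comm 2, pow_mul, map_pow, map_mul, map_inv, h₁, inv_one, mul_one, map_pow, map_pow, map_pow]

end ExpPic

/-! ### The kernel of the exponential spans the Lie algebra. -/

section Span

variable {K : Type v} {F : Type u} [Field K] [Field F] [Algebra K F] [NumberField F]

theorem mem_span_of_re_eq_zero {z : lieModule K F} (hz : ∀ φ, (z.1 φ).re = 0) :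
    z ∈ Submodule.span ℝ {z : lieModule K F | expPic K F z = 0} := by
  classical
  have hc : ∀ φ ψ : F →+* ℂ, ComplexEmbedding.conjugate φ = ψ ↔ φ = ComplexEmbedding.conjugate ψ :=
    fun φ ψ => star_eq_iff_star_eq.trans eq_comm
  -- The vector `b ψ` is `2πi` at `ψ` and `-2πi` at its conjugate, and zero if `ψ` is real. In the
  -- expansion below each conjugate pair contributes twice, whence the denominator `4π`.
  let n (ψ φ : F →+* ℂ) : ℤ :=
    (if φ = ψ then 1 else 0) - if φ = ComplexEmbedding.conjugate ψ then 1 else 0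
  have hn : ∀ ψ φ, n ψ (ComplexEmbedding.conjugate φ) = -n ψ φ := fun ψ φ => by
    simp only [n, hc]
    rw [show ComplexEmbedding.conjugate (ComplexEmbedding.conjugate ψ) = ψ from star_star ψ,
      neg_sub]
  let b (ψ : F →+* ℂ) : lieModule K F := ⟨fun φ => n ψ φ * (2 * Real.pi * Complex.I), fun φ => by
    change (n ψ _ : ℂ) * _ = conj ((n ψ φ : ℂ) * _)
    rw [hn]
    simp [map_ofNat], Finset.sum_eq_zero fun φ _ => by simp⟩
  have hb : ∀ ψ, b ψ ∈ {z : lieModule K F | expPic K F z = 0} := fun ψ =>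
    expPic_eq_zero_iff.2 ⟨1, fun φ => by
      rw [Units.val_one, map_one, map_one]
      exact Complex.exp_int_mul_two_pi_mul_I _⟩
  have hsum : z = ∑ ψ, ((z.1 ψ).im / (4 * Real.pi)) • b ψ := by
    refine lieCoe_injective (funext fun φ => ?_)
    rw [map_sum, Finset.sum_apply]
    have h₁ : ∀ ψ, lieCoe K F (((z.1 ψ).im / (4 * Real.pi)) • b ψ) φ =
        (if φ = ψ then ((z.1 ψ).im / 2 * Complex.I : ℂ) else 0) -
          if ComplexEmbedding.conjugate φ = ψ then ((z.1 ψ).im / 2 * Complex.I : ℂ) else 0 := by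
      intro ψ
      change ((((z.1 ψ).im / (4 * Real.pi) : ℝ)) : ℂ) * (n ψ φ * (2 * Real.pi * Complex.I)) = _
      have hpi : (Real.pi : ℂ) ≠ 0 := Complex.ofReal_ne_zero.2 Real.pi_ne_zero
      simp only [n, hc]
      push_cast
      split_ifs <;> field_simp <;> ring
    simp_rw [h₁]
    rw [Finset.sum_sub_distrib, Finset.sum_ite_eq, Finset.sum_ite_eq, if_pos (Finset.mem_univ _),
      if_pos (Finset.mem_univ _), z.2.1, Complex.conj_im]
    change z.1 φ = _
    conv_lhs => rw [← Complex.re_add_im (z.1 φ), hz]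
    push_cast
    ring
  rw [hsum]
  exact Submodule.sum_mem _ fun ψ _ => Submodule.smul_mem _ _ (Submodule.subset_span (hb ψ))

-- Imaginary directions are covered by `mem_span_of_re_eq_zero`; for the real parts this is
-- Dirichlet's theorem that the logarithms of units span the trace-zero hyperplane.
open Units dirichletUnitTheorem in
theorem span_ker_expPic : Submodule.span ℝ {z : lieModule K F | expPic K F z = 0} = ⊤ := by
  classical
  set W := Submodule.span ℝ {z : lieModule K F | expPic K F z = 0}
  -- The space `logSpace F` omits the coordinate at `w₀`; it is recovered from the condition that
  -- the coordinates sum to zero.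
  let Y (x : logSpace F) (w : InfinitePlace F) : ℝ :=
    if h : w = w₀ then -∑ w, x w else x ⟨w, h⟩
  have hYsum : ∀ x, ∑ w, Y x w = 0 := fun x => by
    rw [Fintype.sum_eq_add_sum_subtype_ne _ w₀]
    simp only [Y, dif_pos]
    refine add_eq_zero_iff_eq_neg.2 (congrArg _ (Finset.sum_congr rfl fun w _ => ?_))
    rw [dif_neg w.2]
  have hsum : ∀ y : InfinitePlace F → ℝ, ∑ φ : F →+* ℂ,
      y (InfinitePlace.mk φ) / (InfinitePlace.mk φ).mult = ∑ w, y w := fun y => by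
    rw [← Finset.sum_fiberwise Finset.univ (fun φ : F →+* ℂ => InfinitePlace.mk φ)]
    refine Finset.sum_congr rfl fun w _ => ?_
    rw [Finset.sum_congr rfl (g := fun _ => y w / w.mult) fun φ hφ => by
      rw [(Finset.mem_filter.1 hφ).2], Finset.sum_const, InfinitePlace.card_filter_mk_eq,
      nsmul_eq_mul, mul_div_cancel₀ _ InfinitePlace.mult_coe_ne_zero]
  -- Logarithmic coordinates carry the multiplicity of the place, so division by it gives the value
  -- at each embedding above the place.
  let T : logSpace F →ₗ[ℝ] lieModule K F :=
    { toFun := fun x => ⟨fun φ =>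
        ((Y x (InfinitePlace.mk φ) / (InfinitePlace.mk φ).mult : ℝ) : ℂ), fun φ => by
          change ((_ : ℝ) : ℂ) = conj ((_ : ℝ) : ℂ)
          rw [InfinitePlace.mk_conjugate_eq, Complex.conj_ofReal], by
          simp_rw [Complex.ofReal_re]
          rw [hsum, hYsum]⟩
      map_add' := fun x y => lie_ext fun φ => by
        change ((_ : ℝ) : ℂ) = ((_ : ℝ) : ℂ) + ((_ : ℝ) : ℂ)
        rw [← Complex.ofReal_add, ← add_div]
        congr 2
        simp only [Y]
        split_ifs with h
        · simp [Finset.sum_add_distrib, add_comm]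
        · rfl
      map_smul' := fun r x => lie_ext fun φ => by
        rw [RingHom.id_apply, real_smul_apply]
        change ((_ : ℝ) : ℂ) = (r : ℂ) * ((_ : ℝ) : ℂ)
        rw [← Complex.ofReal_mul, ← mul_div_assoc]
        congr 2
        simp only [Y]
        split_ifs with h
        · simp [Finset.mul_sum]
        · rfl }
  have hT : ∀ x φ, (T x).1 φ = ((Y x (InfinitePlace.mk φ) / (InfinitePlace.mk φ).mult : ℝ) : ℂ) :=
    fun _ _ => rfl
  -- Membership in `W` depends only on real parts.
  have key : ∀ {y z : lieModule K F}, y ∈ W → (∀ φ, (y.1 φ).re = (z.1 φ).re) → z ∈ W := by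
    intro y z hy h
    have := W.sub_mem hy (mem_span_of_re_eq_zero (z := y - z) fun φ => by
      change (y.1 φ - z.1 φ).re = 0
      rw [Complex.sub_re, h, sub_self])
    rwa [sub_sub_cancel] at this
  have hu : ∀ u : (𝓞 F)ˣ, T (logEmbedding F (Additive.ofMul u)) ∈ W := by
    intro u
    let α : Fˣ := Units.map (algebraMap (𝓞 F) F : 𝓞 F →* F) u
    obtain ⟨z, hz, hz'⟩ := exists_lieExp_eq_sq (K := K) (p := principal F α)
      ((toPrincipalIdeal_eq_one_iff _).2 ⟨u, rfl⟩)
    have hzW : z ∈ W := Submodule.subset_span ((picProj_eq_zero_iff _).2 ⟨α ^ 2, by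
      rw [map_pow]
      exact hz'.symm⟩)
    -- The vector `z` is a logarithm of `α ^ 2`, so half of it has the real parts `log ‖φ α‖`.
    refine key (W.smul_mem (1 / 2 : ℝ) hzW) fun φ => ?_
    rw [real_smul_apply, Complex.re_ofReal_mul, hz, hT, Complex.ofReal_re]
    have h₁ : realEmb F (principal F α).1.2 φ = φ α := realEmb_toRealAlg α φ
    have h₂ : Y (logEmbedding F (Additive.ofMul u)) (InfinitePlace.mk φ) =
        (InfinitePlace.mk φ).mult * Real.log ‖φ α‖ := by
      simp only [Y]
      split_ifs with h
      · rw [sum_logEmbedding_component, neg_mul, neg_neg, ← h]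
        rfl
      · rfl
    rw [h₁, h₂, mul_div_cancel_left₀ _ InfinitePlace.mult_coe_ne_zero]
    ring
  have hTW : ∀ x, T x ∈ W := by
    intro x
    have hx : x ∈ Submodule.span ℝ (unitLattice F : Set (logSpace F)) := by
      rw [unitLattice_span_eq_top]
      trivial
    have hle : Submodule.span ℝ (unitLattice F : Set (logSpace F)) ≤ W.comap T := by
      rw [Submodule.span_le]
      rintro _ ⟨u, -, rfl⟩
      exact hu u.toMul
    exact hle hx
  rw [eq_top_iff]
  intro z _
  let y (w : InfinitePlace F) : ℝ := w.mult * (z.1 w.embedding).re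
  have hy : ∀ φ, y (InfinitePlace.mk φ) / (InfinitePlace.mk φ).mult = (z.1 φ).re := fun φ => by
    simp only [y]
    rw [mul_div_cancel_left₀ _ InfinitePlace.mult_coe_ne_zero]
    obtain h | h := InfinitePlace.embedding_mk_eq φ
    · rw [h]
    · rw [h, z.2.1, Complex.conj_re]
  have hy0 : ∑ w, y w = 0 := by
    rw [← hsum]
    simp_rw [hy]
    exact z.2.2
  refine key (hTW fun w => y w) fun φ => ?_
  rw [hT, Complex.ofReal_re, ← hy]
  congr 1
  simp only [Y]
  split_ifs with h
  · rw [Fintype.sum_eq_add_sum_subtype_ne _ w₀] at hy0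
    rw [h]
    linarith
  · rfl

end Span

end Arakelov

/-! ### Assembly of the formula. -/

namespace Arakelov

open NumberField G0 IsDedekindDomain

variable {K : Type v} {F : Type u} [Field K] [NumberField K] [Field F] [NumberField F]
  [Algebra K F] [FiniteDimensional K F]

/-- `[ℤ[S]]` is the sum of the classes of the Archimedean and the finite part of `S`. -/
theorem mk_permModule_places (S : SubMulAction Gal(F/K) (Place F)) [Finite S]
    (hS : ∀ w : InfinitePlace F, (Sum.inl w : Place F) ∈ S) :
    mk (MonoidAlgebra ℤ Gal(F/K)) (PermModule Gal(F/K) S) =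
      mk (MonoidAlgebra ℤ Gal(F/K)) (PermModule Gal(F/K) (InfinitePlace F)) +
        mk (MonoidAlgebra ℤ Gal(F/K)) (PermModule Gal(F/K) (finPart S)) := by
  let f : InfinitePlace F ⊕ finPart S → S :=
    Sum.elim (fun w => ⟨Sum.inl w, hS w⟩) fun v => ⟨Sum.inr v.1, v.2⟩
  have hf : Function.Bijective f := by
    constructor
    · rintro (w | v) (w' | v') h
      · exact congrArg Sum.inl (Sum.inl_injective (congrArg Subtype.val h))
      · exact absurd (congrArg Subtype.val h) Sum.inl_ne_inr
      · exact absurd (congrArg Subtype.val h) Sum.inr_ne_inl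
      · exact congrArg Sum.inr (Subtype.ext (Sum.inr_injective (congrArg Subtype.val h)))
    · rintro ⟨w | v, h⟩
      · exact ⟨Sum.inl w, rfl⟩
      · exact ⟨Sum.inr ⟨v, h⟩, rfl⟩
  refine mk_permModule_of_equiv_sum (Equiv.ofBijective f hf) ?_
  rintro g (w | v) <;> rfl

/-- The class of the dual of the oriented Arakelov class group, in terms of the index of
`F^× → Id_F`. -/
theorem mk_picTildeDual [IsGalois K F] {x : G0 (MonoidAlgebra ℤ Gal(F/K))}
    (hx : HasIndex (principalIdealMap K F) x) :
    ∃ _ : Module.Finite (MonoidAlgebra ℤ Gal(F/K)) (GModule Gal(F/K) (PicTildeDual F)),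
      mk (MonoidAlgebra ℤ Gal(F/K)) (GModule Gal(F/K) (PicTildeDual F)) =
        -sigma Gal(F/K) (mk (MonoidAlgebra ℤ Gal(F/K)) (PermModule Gal(F/K) (InfinitePlace F)) +
          (-(Module.finrank ℚ K • mk (MonoidAlgebra ℤ Gal(F/K)) (MonoidAlgebra ℤ Gal(F/K))) +
            x)) :=
  mk_pontryaginDual exists_linearMap_single_smul (expPic K F) continuous_gval_expPic
    image_gval_expPic_mem_nhds
    ⟨Metric.ball 0 (1 / 2), Metric.ball_mem_nhds 0 (by norm_num), fun _ hz h =>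
      eq_zero_of_expPic_eq_zero (mem_ball_zero_iff.1 hz) h⟩
    span_ker_expPic (mul_ne_zero two_ne_zero Fintype.card_ne_zero) exists_gval_expPic_eq_pow
    (hasIndex_expPic hx)

end Arakelov

theorem mainTheorem3 {K : Type v} {F : Type u} [Field K] [NumberField K] [Field F] [NumberField F]
    [Algebra K F] [FiniteDimensional K F] [IsGalois K F]
    (S : SubMulAction Gal(F/K) (Arakelov.Place F)) [Finite S]
    (hS : ∀ w : NumberField.InfinitePlace F, (Sum.inl w : Arakelov.Place F) ∈ S) :
    ∃ (_ : Module.Finite (MonoidAlgebra ℤ Gal(F/K))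
          (Arakelov.GModule Gal(F/K) (Arakelov.PicTildeDual F)))
      (_ : Module.Finite (MonoidAlgebra ℤ Gal(F/K))
          (Arakelov.GModule Gal(F/K) (Arakelov.SIntegers S)ˣ))
      (_ : Module.Finite (MonoidAlgebra ℤ Gal(F/K))
          (Arakelov.GModule Gal(F/K) (ClassGroup (Arakelov.SIntegers S)))),
      G0.mk (MonoidAlgebra ℤ Gal(F/K)) (Arakelov.GModule Gal(F/K) (Arakelov.PicTildeDual F)) =
        Module.finrank ℚ K • G0.mk (MonoidAlgebra ℤ Gal(F/K)) (MonoidAlgebra ℤ Gal(F/K))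
        - G0.mk (MonoidAlgebra ℤ Gal(F/K)) (Arakelov.PermModule Gal(F/K) S)
        + G0.sigma Gal(F/K) (G0.mk (MonoidAlgebra ℤ Gal(F/K))
            (Arakelov.GModule Gal(F/K) (Arakelov.SIntegers S)ˣ))
        - G0.sigma Gal(F/K) (G0.mk (MonoidAlgebra ℤ Gal(F/K))
            (Arakelov.GModule Gal(F/K) (ClassGroup (Arakelov.SIntegers S)))) := by
  obtain ⟨hU, hC, hx⟩ := Arakelov.hasIndex_principalIdealMap S
  obtain ⟨hA, h⟩ := Arakelov.mk_picTildeDual hx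
  refine ⟨hA, hU, hC, ?_⟩
  rw [h, Arakelov.mk_permModule_places S hS]
  -- The duality automorphism fixes `ℤ[G]` and the permutation modules on both parts of `S`, so it
  -- survives only on the `S`-units and the `S`-class group.
  simp only [map_add, map_sub, map_neg, map_nsmul, Arakelov.sigma_mk_permModule,
    Arakelov.sigma_mk_groupRing]
  abel
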